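/- Computational model. A real RAM: a fixed finite program (assignments, sequencing, conditionals, while-loops) acting on natural-number and real registers and on natural-number and real arrays. Each elementary operation (reading a register, constant or array entry, writing, $+1$ and $-1$ on natural numbers, addition and subtraction of reals, comparison of two natural numbers or two reals, Boolean connectives) costs one step. There is no other arithmetic. Memory not holding input is initially zero. Input. A directed graph $G=(V,E)$ without self-loops or multiple edges, with $V=\{0,\dots,n-1\}$ and $m=|E|$, given as a list of its edges in arbitrary order together with their weights $w:E\to\mathbb{R}$ (possibly negative); a vertex $s\in V$; and the parent array of an elimination forest $F$ of $G$, i.e. of a rooted forest on $V$ such that for every edge $uv\in E$ one of $u,v$ is an ancestor of the other. The depth $k$ of $F$ is the maximum number of vertices on a path from a root to a leaf of $F$. Theorem. There are a program in this model and a constant $C$ such that, for every such input for which $G$ has no directed cycle of negative total weight, the program halts and outputs (as a parent array) a shortest-path tree of $G$ rooted at $s$, that is, a tree rooted at $s$, consisting of edges of $G$ directed away from $s$, whose vertices are exactly the vertices reachable from $s$ in $G$, and in which for every such vertex $v$ the tree path from $s$ to $v$ has minimum total weight among all paths from $s$ to $v$ in $G$. If $n\ge 2$, the program halts within $C\cdot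 k\,(m+n\log n)$ steps. -/

import Mathlib

/-! ## A random access machine over integers and reals

Programs are finite terms of a first-order imperative language. The memory consists of natural
number registers, real registers, arrays of natural numbers and arrays of reals; a program mentions
only finitely many registers and array names. Every elementary operation costs one step.
The only integer arithmetic is `+ 1` and `- 1` (so after `t` steps all integers exceed the
input by at most `t`, up to a constant: they fit in words of logarithmic size), and the only
operations on reals are copying, addition, subtraction and comparison. -/

namespace RAM

/-- Memory contents. -/
structure State where
  ireg : ℕ → ℕ
  rreg : ℕ → ℝ
  iarr : ℕ → ℕ → ℕ
  rarr : ℕ → ℕ → ℝ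

/-- Integer expressions; `get a i` reads entry `i` of the integer array number `a`. -/
inductive IExpr where
  | const (c : ℕ)
  | reg (x : ℕ)
  | get (a : ℕ) (i : IExpr)
  | succ (e : IExpr)
  | pred (e : IExpr)

/-- Real expressions; `get a i` reads entry `i` of the real array number `a`. -/
inductive RExpr where
  | zero
  | reg (x : ℕ)
  | get (a : ℕ) (i : IExpr)
  | add (e f : RExpr)
  | sub (e f : RExpr)

/-- Tests. -/
inductive BExpr where
  | ieq (e f : IExpr)
  | ilt (e f : IExpr)
  | rlt (e f : RExpr)
  | not (b : BExpr)
  | and (b c : BExpr)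

/-- Programs. -/
inductive Cmd where
  | skip
  | iset (x : ℕ) (e : IExpr)
  | rset (x : ℕ) (e : RExpr)
  | iput (a : ℕ) (i : IExpr) (e : IExpr)
  | rput (a : ℕ) (i : IExpr) (e : RExpr)
  | seq (c d : Cmd)
  | ite (b : BExpr) (c d : Cmd)
  | loop (b : BExpr) (c : Cmd)

def IExpr.eval (σ : State) : IExpr → ℕ
  | const c => c
  | reg x => σ.ireg x
  | get a i => σ.iarr a (i.eval σ)
  | succ e => e.eval σ + 1
  | pred e => e.eval σ - 1

noncomputable def RExpr.eval (σ : State) : RExpr → ℝ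
  | zero => 0
  | reg x => σ.rreg x
  | get a i => σ.rarr a (i.eval σ)
  | add e f => e.eval σ + f.eval σ
  | sub e f => e.eval σ - f.eval σ

def BExpr.holds (σ : State) : BExpr → Prop
  | ieq e f => e.eval σ = f.eval σ
  | ilt e f => e.eval σ < f.eval σ
  | rlt e f => e.eval σ < f.eval σ
  | not b => ¬ b.holds σ
  | and b c => b.holds σ ∧ c.holds σ

/-- Number of elementary operations in evaluating an expression. -/
def IExpr.cost : IExpr → ℕ
  | const _ => 1
  | reg _ => 1
  | get _ i => i.cost + 1
  | succ e => e.cost + 1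
  | pred e => e.cost + 1

def RExpr.cost : RExpr → ℕ
  | zero => 1
  | reg _ => 1
  | get _ i => i.cost + 1
  | add e f => e.cost + f.cost + 1
  | sub e f => e.cost + f.cost + 1

def BExpr.cost : BExpr → ℕ
  | ieq e f => e.cost + f.cost + 1
  | ilt e f => e.cost + f.cost + 1
  | rlt e f => e.cost + f.cost + 1
  | not b => b.cost + 1
  | and b c => b.cost + c.cost + 1

def State.iset (σ : State) (x v : ℕ) : State :=
  { σ with ireg := Function.update σ.ireg x v }

noncomputable def State.rset (σ : State) (x : ℕ) (v : ℝ) : State :=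
  { σ with rreg := Function.update σ.rreg x v }

def State.iput (σ : State) (a i v : ℕ) : State :=
  { σ with iarr := Function.update σ.iarr a (Function.update (σ.iarr a) i v) }

noncomputable def State.rput (σ : State) (a i : ℕ) (v : ℝ) : State :=
  { σ with rarr := Function.update σ.rarr a (Function.update (σ.rarr a) i v) }

/-- `Exec c σ t τ`: started in memory `σ`, the program `c` halts after exactly `t` steps with
memory `τ`. (A nonterminating run has no such `t` and `τ`.) -/
inductive Exec : Cmd → State → ℕ → State → Prop
  | skip (σ : State) : Exec .skip σ 1 σ
  | iset (σ : State) (x : ℕ) (e : IExpr) :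
      Exec (.iset x e) σ (e.cost + 1) (σ.iset x (e.eval σ))
  | rset (σ : State) (x : ℕ) (e : RExpr) :
      Exec (.rset x e) σ (e.cost + 1) (σ.rset x (e.eval σ))
  | iput (σ : State) (a : ℕ) (i e : IExpr) :
      Exec (.iput a i e) σ (i.cost + e.cost + 1) (σ.iput a (i.eval σ) (e.eval σ))
  | rput (σ : State) (a : ℕ) (i : IExpr) (e : RExpr) :
      Exec (.rput a i e) σ (i.cost + e.cost + 1) (σ.rput a (i.eval σ) (e.eval σ))
  | seq {c d : Cmd} {σ τ υ : State} {t u : ℕ} :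
      Exec c σ t τ → Exec d τ u υ → Exec (.seq c d) σ (t + u) υ
  | ite_true {b : BExpr} {c d : Cmd} {σ τ : State} {t : ℕ} :
      b.holds σ → Exec c σ t τ → Exec (.ite b c d) σ (b.cost + t) τ
  | ite_false {b : BExpr} {c d : Cmd} {σ τ : State} {t : ℕ} :
      ¬ b.holds σ → Exec d σ t τ → Exec (.ite b c d) σ (b.cost + t) τ
  | loop_true {b : BExpr} {c : Cmd} {σ τ υ : State} {t u : ℕ} :
      b.holds σ → Exec c σ t τ → Exec (.loop b c) τ u υ →
        Exec (.loop b c) σ (b.cost + t + u) υ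
  | loop_false {b : BExpr} {c : Cmd} {σ : State} :
      ¬ b.holds σ → Exec (.loop b c) σ b.cost σ

end RAM

/-! ## Directed graphs, paths and forests -/

namespace TreeDepth

/-- Total weight of the consecutive pairs of a vertex sequence. -/
def weight {V : Type*} (w : V → V → ℝ) : List V → ℝ
  | [] => 0
  | [_] => 0
  | u :: v :: p => w u v + weight w (v :: p)

/-- `p` is a (simple) directed path of `G` from `u` to `v`. -/
def IsPath {V : Type*} (G : Digraph V) (u v : V) (p : List V) : Prop :=
  p.IsChain G.Adj ∧ p.Nodup ∧ p.head? = some u ∧ p.getLast? = some v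

/-- `p` is a path from `u` to `v` whose weight is minimum among all paths from `u` to `v`. -/
def IsShortestPath {V : Type*} (G : Digraph V) (w : V → V → ℝ) (u v : V) (p : List V) : Prop :=
  IsPath G u v p ∧ ∀ q, IsPath G u v q → weight w p ≤ weight w q

/-- The sequence `v, p₁, …, pᵣ, v` is a (simple) directed cycle of `G`, where `p = [p₁, …, pᵣ]`. -/
def IsCycle {V : Type*} (G : Digraph V) (v : V) (p : List V) : Prop :=
  (v :: p).Nodup ∧ (v :: p ++ [v]).IsChain G.Adj

def HasNegativeCycle {V : Type*} (G : Digraph V) (w : V → V → ℝ) : Prop :=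
  ∃ v p, IsCycle G v p ∧ weight w (v :: p ++ [v]) < 0

/-- A rooted forest on the vertex set `V`, given by its parent function (roots have no parent). -/
structure RootedForest (V : Type*) where
  parent : V → Option V
  acyclic : ∀ v, ¬ Relation.TransGen (fun a b => parent b = some a) v v

namespace RootedForest

/-- `u` is an ancestor of `v`; every vertex is an ancestor of itself. -/
def IsAncestor {V : Type*} (F : RootedForest V) (u v : V) : Prop :=
  Relation.ReflTransGen (fun a b => F.parent b = some a) u v

/-- The maximum number of vertices on a path going down from a root; the vertices on the path from
the root to `v` are the ancestors of `v`. -/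
noncomputable def depth {V : Type*} [Fintype V] (F : RootedForest V) : ℕ :=
  Finset.univ.sup fun v => {u | F.IsAncestor u v}.ncard

/-- For every edge, one endpoint is an ancestor of the other. -/
def IsEliminationForest {V : Type*} (F : RootedForest V) (G : Digraph V) : Prop :=
  ∀ u v, G.Adj u v → F.IsAncestor u v ∨ F.IsAncestor v u

end RootedForest

/-- The parent function `par` describes a shortest-path tree of `G` rooted at `s`: its edges are
edges of `G`, its vertices are exactly the vertices reachable from `s`, and the tree path from `s`
to each of them is a shortest path of `G`. -/
def IsShortestPathTree {V : Type*} (G : Digraph V) (w : V → V → ℝ) (s : V)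
    (par : V → Option V) : Prop :=
  par s = none ∧
  (∀ u v, par v = some u → G.Adj u v) ∧
  (∀ v, v ≠ s → ((∃ u, par v = some u) ↔ Relation.ReflTransGen G.Adj s v)) ∧
  ∀ v, Relation.ReflTransGen G.Adj s v →
    ∃ p, p.IsChain (fun a b => par b = some a) ∧ IsShortestPath G w s v p

/-- An optional vertex is stored as a number: `0` for none, `u + 1` for the vertex `u`. -/
def encode {n : ℕ} : Option (Fin n) → ℕ
  | none => 0
  | some u => u + 1

/-- Initial memory. Registers `0, 1, 2` hold `n`, `m`, `s`; entry `i < m` of the integer arrays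
`0` and `1` and of the real array `0` holds the tail, the head and the weight of the `i`-th edge in
the enumeration `e`; entry `v < n` of integer array `2` holds the parent of `v` in the forest.
Everything else is `0`. -/
noncomputable def input {n m : ℕ} {G : Digraph (Fin n)} (w : Fin n → Fin n → ℝ) (s : Fin n)
    (F : RootedForest (Fin n)) (e : Fin m ≃ {p : Fin n × Fin n // G.Adj p.1 p.2}) :
    RAM.State where
  ireg x := if x = 0 then n else if x = 1 then m else if x = 2 then s else 0
  rreg _ := 0
  iarr a i :=
    if a = 0 then (if h : i < m then (e ⟨i, h⟩).1.1 else 0)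
    else if a = 1 then (if h : i < m then (e ⟨i, h⟩).1.2 else 0)
    else if a = 2 then (if h : i < n then encode (F.parent ⟨i, h⟩) else 0)
    else 0
  rarr a i :=
    if a = 0 then (if h : i < m then w (e ⟨i, h⟩).1.1 (e ⟨i, h⟩).1.2 else 0) else 0

/-- Output convention: integer array `3` holds the parent function. -/
def Outputs {n : ℕ} (σ : RAM.State) (par : Fin n → Option (Fin n)) : Prop :=
  ∀ v : Fin n, σ.iarr 3 v = encode (par v)

end TreeDepth

/-! ### Weakest preconditions with step counts, and frames -/

namespace RAM

/-! The level of a vertex is its number of ancestors in the forest, itself included. Replacing the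
weight of an edge `uv` by `φ u + w u v - φ v` changes the weight of a path only by terms at its two
ends. So once a potential `φ` makes all these reduced lengths nonnegative, a single run of
Dijkstra's algorithm from `s` yields the tree (`isShortestPathTree_of_search`). Such a potential is
built one level at a time, from the greatest level down to level 1, with one run of Dijkstra's
algorithm for each level.

Let `φ` be feasible on the edges between vertices of level greater than `j`. No edge joins two
vertices of level `j` (`level_ne`). Raising `φ` at level `j` repairs the edges leaving that level
towards greater levels. The edges entering level `j` may keep negative reduced lengths. The start
label of a vertex of level `j` is the minimum of 0 and the reduced lengths of the edges entering it
from greater levels; vertices of greater level start at 0. Dijkstra's algorithm is run from all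
these vertices at once and ignores the edges into level `j`.

The crux is `label_le`: the final labels `d` satisfy the triangle inequality on the ignored edges
too. Let `ur` be one, and take a path from a source that realizes `d u`. If the source has level
greater than `j`, then `d u ≥ 0`, and the start label of `r` is already small enough. Otherwise the
source has level `j`, and the path stays among its descendants, because edges join only comparable
vertices. Now `r` and the source are ancestors of `u` on the same level, hence equal; the path
closed by `ur` is a cycle, and its weight is nonnegative. Therefore `φ + d` is feasible from level
`j` on (`levelStep_spec`).

A run must take `O(m + n log n)` steps, so the priority queue is a hollow heap. Decreasing a key
moves the item to a new node and leaves a hollow node that keeps two children. A node of rank `r`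
forces `Nat.fib (r + 1)` nodes (`Shape.fib_le_card`), a run creates at most `n + m ≤ n + n * n`
nodes, and so ranks are logarithmic in `n`. A potential counting stack entries, occupied slots and
hollow nodes makes `decreaseKey` amortized constant and `deleteMin` amortized logarithmic. In the
program logic, postconditions see the number of steps and loop invariants carry such a potential
(`wp_loop`). -/

/-- Started in `σ`, the program `c` halts, and time and final memory satisfy `Q`. -/
def WP (c : Cmd) (σ : State) (Q : ℕ → State → Prop) : Prop :=
  ∃ t τ, Exec c σ t τ ∧ Q t τ

theorem WP.mono {c : Cmd} {σ : State} {Q Q' : ℕ → State → Prop} (h : WP c σ Q)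
    (hQ : ∀ t τ, Q t τ → Q' t τ) : WP c σ Q' := by
  obtain ⟨t, τ, hc, hq⟩ := h
  exact ⟨t, τ, hc, hQ t τ hq⟩

/-- To prove `WP c σ Q` one may replace `Q` by a variable. -/
theorem WP.of_forall {c : Cmd} {σ : State} {Q : ℕ → State → Prop}
    (h : ∀ Q' : ℕ → State → Prop, (∀ t τ, Q t τ → Q' t τ) → WP c σ Q') : WP c σ Q :=
  h Q fun _ _ h => h

section rules

variable (σ : State) (Q : ℕ → State → Prop)

@[simp] theorem wp_skip : WP .skip σ Q ↔ Q 1 σ :=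
  ⟨fun ⟨_, _, h, hq⟩ => by cases h; exact hq, fun h => ⟨_, _, .skip σ, h⟩⟩

@[simp] theorem wp_iset (x : ℕ) (e : IExpr) :
    WP (.iset x e) σ Q ↔ Q (e.cost + 1) (σ.iset x (e.eval σ)) :=
  ⟨fun ⟨_, _, h, hq⟩ => by cases h; exact hq, fun h => ⟨_, _, .iset σ x e, h⟩⟩

@[simp] theorem wp_rset (x : ℕ) (e : RExpr) :
    WP (.rset x e) σ Q ↔ Q (e.cost + 1) (σ.rset x (e.eval σ)) :=
  ⟨fun ⟨_, _, h, hq⟩ => by cases h; exact hq, fun h => ⟨_, _, .rset σ x e, h⟩⟩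

@[simp] theorem wp_iput (a : ℕ) (i e : IExpr) :
    WP (.iput a i e) σ Q ↔ Q (i.cost + e.cost + 1) (σ.iput a (i.eval σ) (e.eval σ)) :=
  ⟨fun ⟨_, _, h, hq⟩ => by cases h; exact hq, fun h => ⟨_, _, .iput σ a i e, h⟩⟩

@[simp] theorem wp_rput (a : ℕ) (i : IExpr) (e : RExpr) :
    WP (.rput a i e) σ Q ↔ Q (i.cost + e.cost + 1) (σ.rput a (i.eval σ) (e.eval σ)) :=
  ⟨fun ⟨_, _, h, hq⟩ => by cases h; exact hq, fun h => ⟨_, _, .rput σ a i e, h⟩⟩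

@[simp] theorem wp_seq (c d : Cmd) :
    WP (.seq c d) σ Q ↔ WP c σ fun t τ => WP d τ fun u υ => Q (t + u) υ := by
  constructor
  · rintro ⟨_, _, h, hq⟩
    cases h with
    | seq h₁ h₂ => exact ⟨_, _, h₁, _, _, h₂, hq⟩
  · rintro ⟨_, _, h₁, _, _, h₂, hq⟩
    exact ⟨_, _, .seq h₁ h₂, hq⟩

@[simp] theorem wp_ite (b : BExpr) (c d : Cmd) :
    WP (.ite b c d) σ Q ↔
      (b.holds σ → WP c σ fun t τ => Q (b.cost + t) τ) ∧
      (¬ b.holds σ → WP d σ fun t τ => Q (b.cost + t) τ) := by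
  constructor
  · rintro ⟨_, _, h, hq⟩
    cases h with
    | ite_true hb h => exact ⟨fun _ => ⟨_, _, h, hq⟩, fun hn => absurd hb hn⟩
    | ite_false hb h => exact ⟨fun hn => absurd hn hb, fun _ => ⟨_, _, h, hq⟩⟩
  · rintro ⟨h₁, h₂⟩
    by_cases hb : b.holds σ
    · obtain ⟨t, τ, h, hq⟩ := h₁ hb
      exact ⟨_, _, .ite_true hb h, hq⟩
    · obtain ⟨t, τ, h, hq⟩ := h₂ hb
      exact ⟨_, _, .ite_false hb h, hq⟩

end rules

/-- Sequential composition of a list of programs. -/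
def Cmd.block : List Cmd → Cmd
  | [] => .skip
  | c :: cs => .seq c (block cs)

@[simp] theorem wp_block_nil (σ : State) (Q : ℕ → State → Prop) :
    WP (.block []) σ Q ↔ Q 1 σ := wp_skip σ Q

@[simp] theorem wp_block_cons (c : Cmd) (cs : List Cmd) (σ : State) (Q : ℕ → State → Prop) :
    WP (.block (c :: cs)) σ Q ↔ WP c σ fun t τ => WP (.block cs) τ fun u υ => Q (t + u) υ :=
  wp_seq σ Q c _

/-- The registers and arrays that a program can change, tagged `0` and `1` for integer and real
registers, `2` and `3` for integer and real arrays. -/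
def Cmd.writes : Cmd → List (ℕ × ℕ)
  | skip => []
  | iset x _ => [(0, x)]
  | rset x _ => [(1, x)]
  | iput a _ _ => [(2, a)]
  | rput a _ _ => [(3, a)]
  | seq c d => c.writes ++ d.writes
  | ite _ c d => c.writes ++ d.writes
  | loop _ c => c.writes

/-- The memories `σ` and `τ` agree outside the places listed in `l`. -/
structure Frame (l : List (ℕ × ℕ)) (σ τ : State) : Prop where
  ireg : ∀ x, (0, x) ∉ l → τ.ireg x = σ.ireg x
  rreg : ∀ x, (1, x) ∉ l → τ.rreg x = σ.rreg x
  iarr : ∀ a, (2, a) ∉ l → τ.iarr a = σ.iarr a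
  rarr : ∀ a, (3, a) ∉ l → τ.rarr a = σ.rarr a

theorem Frame.refl (l : List (ℕ × ℕ)) (σ : State) : Frame l σ σ :=
  ⟨fun _ _ => rfl, fun _ _ => rfl, fun _ _ => rfl, fun _ _ => rfl⟩

theorem Frame.trans {l : List (ℕ × ℕ)} {σ τ υ : State} (h : Frame l σ τ) (h' : Frame l τ υ) :
    Frame l σ υ :=
  ⟨fun x hx => (h'.ireg x hx).trans (h.ireg x hx), fun x hx => (h'.rreg x hx).trans (h.rreg x hx),
    fun x hx => (h'.iarr x hx).trans (h.iarr x hx), fun x hx => (h'.rarr x hx).trans (h.rarr x hx)⟩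

theorem Frame.mono {l l' : List (ℕ × ℕ)} {σ τ : State} (h : Frame l σ τ) (hl : l ⊆ l') :
    Frame l' σ τ :=
  ⟨fun x hx => h.ireg x fun h => hx (hl h), fun x hx => h.rreg x fun h => hx (hl h),
    fun x hx => h.iarr x fun h => hx (hl h), fun x hx => h.rarr x fun h => hx (hl h)⟩

/-- Syntactic footprints suffice because all addresses of registers and arrays are literals.
Specifications therefore mention only what changes; everything else is carried across a call by
deciding membership in `Cmd.writes`. -/
theorem Exec.frame {c : Cmd} {σ τ : State} {t : ℕ} (h : Exec c σ t τ) : Frame c.writes σ τ := by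
  induction h with
  | skip => exact .refl _ _
  | iset σ x e =>
    refine ⟨fun y hy => ?_, fun _ _ => rfl, fun _ _ => rfl, fun _ _ => rfl⟩
    exact Function.update_of_ne (by rintro rfl; simp [Cmd.writes] at hy) _ _
  | rset σ x e =>
    refine ⟨fun _ _ => rfl, fun y hy => ?_, fun _ _ => rfl, fun _ _ => rfl⟩
    exact Function.update_of_ne (by rintro rfl; simp [Cmd.writes] at hy) _ _
  | iput σ x e =>
    refine ⟨fun _ _ => rfl, fun _ _ => rfl, fun y hy => ?_, fun _ _ => rfl⟩
    exact Function.update_of_ne (by rintro rfl; simp [Cmd.writes] at hy) _ _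
  | rput σ x e =>
    refine ⟨fun _ _ => rfl, fun _ _ => rfl, fun _ _ => rfl, fun y hy => ?_⟩
    exact Function.update_of_ne (by rintro rfl; simp [Cmd.writes] at hy) _ _
  | seq _ _ ih₁ ih₂ =>
    exact (ih₁.mono (List.subset_append_left _ _)).trans (ih₂.mono (List.subset_append_right _ _))
  | ite_true _ _ ih => exact ih.mono (List.subset_append_left _ _)
  | ite_false _ _ ih => exact ih.mono (List.subset_append_right _ _)
  | loop_true _ _ _ ih₁ ih₂ => exact Frame.trans ih₁ ih₂
  | loop_false => exact .refl _ _

theorem WP.frame {c : Cmd} {σ : State} {Q : ℕ → State → Prop} (h : WP c σ Q) :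
    WP c σ fun t τ => Q t τ ∧ Frame c.writes σ τ := by
  obtain ⟨t, τ, hc, hq⟩ := h
  exact ⟨t, τ, hc, hq, hc.frame⟩

theorem BExpr.cost_pos (b : BExpr) : 0 < b.cost := by
  cases b <;> simp [BExpr.cost]

/-- Loop rule with a potential `φ` that pays for the steps. -/
theorem wp_loop {b : BExpr} {c : Cmd} (I : State → ℕ → Prop) {σ₀ : State} {φ₀ : ℕ}
    (h₀ : I σ₀ φ₀)
    (hstep : ∀ σ φ, I σ φ → Frame c.writes σ₀ σ → b.holds σ →
      WP c σ fun t τ => ∃ φ', I τ φ' ∧ b.cost + t + φ' ≤ φ) :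
    WP (.loop b c) σ₀ fun t τ =>
      ∃ φ, I τ φ ∧ ¬ b.holds τ ∧ Frame c.writes σ₀ τ ∧ t + φ ≤ φ₀ + b.cost := by
  -- Induction on a bound for the potential: every test costs at least one step, so each round
  -- strictly lowers it. This gives termination along with the time bound.
  suffices H : ∀ k σ φ, φ ≤ k → I σ φ → Frame c.writes σ₀ σ →
      WP (.loop b c) σ fun t τ =>
        ∃ φ', I τ φ' ∧ ¬ b.holds τ ∧ Frame c.writes σ₀ τ ∧ t + φ' ≤ φ + b.cost from
    H φ₀ σ₀ φ₀ le_rfl h₀ (.refl _ _)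
  intro k
  induction k with
  | zero =>
    intro σ φ hφ hI hF
    by_cases hb : b.holds σ
    · obtain ⟨t, τ, -, φ', -, h⟩ := hstep σ φ hI hF hb
      have := b.cost_pos
      omega
    · exact ⟨_, _, .loop_false hb, φ, hI, hb, hF, by omega⟩
  | succ k ih =>
    intro σ φ hφ hI hF
    by_cases hb : b.holds σ
    · obtain ⟨t, τ, hc, φ', hI', h⟩ := hstep σ φ hI hF hb
      have := b.cost_pos
      obtain ⟨u, υ, hl, φ'', hI'', hb', hF', h'⟩ :=
        ih τ φ' (by omega) hI' (hF.trans hc.frame)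
      exact ⟨_, _, .loop_true hb hc hl, φ'', hI'', hb', hF', by omega⟩
    · exact ⟨_, _, .loop_false hb, φ, hI, hb, hF, by omega⟩

section simp

variable (σ : State) (x a i v : ℕ) (r : ℝ)

@[simp] theorem iset_ireg : (σ.iset x v).ireg = Function.update σ.ireg x v := rfl
@[simp] theorem iset_rreg : (σ.iset x v).rreg = σ.rreg := rfl
@[simp] theorem iset_iarr : (σ.iset x v).iarr = σ.iarr := rfl
@[simp] theorem iset_rarr : (σ.iset x v).rarr = σ.rarr := rfl
@[simp] theorem rset_ireg : (σ.rset x r).ireg = σ.ireg := rfl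
@[simp] theorem rset_rreg : (σ.rset x r).rreg = Function.update σ.rreg x r := rfl
@[simp] theorem rset_iarr : (σ.rset x r).iarr = σ.iarr := rfl
@[simp] theorem rset_rarr : (σ.rset x r).rarr = σ.rarr := rfl
@[simp] theorem iput_ireg : (σ.iput a i v).ireg = σ.ireg := rfl
@[simp] theorem iput_rreg : (σ.iput a i v).rreg = σ.rreg := rfl
@[simp] theorem iput_iarr :
    (σ.iput a i v).iarr = Function.update σ.iarr a (Function.update (σ.iarr a) i v) := rfl
@[simp] theorem iput_rarr : (σ.iput a i v).rarr = σ.rarr := rfl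
@[simp] theorem rput_ireg : (σ.rput a i r).ireg = σ.ireg := rfl
@[simp] theorem rput_rreg : (σ.rput a i r).rreg = σ.rreg := rfl
@[simp] theorem rput_iarr : (σ.rput a i r).iarr = σ.iarr := rfl
@[simp] theorem rput_rarr :
    (σ.rput a i r).rarr = Function.update σ.rarr a (Function.update (σ.rarr a) i r) := rfl

end simp

attribute [simp] IExpr.eval RExpr.eval BExpr.holds IExpr.cost RExpr.cost BExpr.cost

end RAM

/-! ### Linked lists stored in arrays -/

/-- The null-terminated linked list with successor function `next` starting at `c` is `l`. -/
def Linked (next : ℕ → ℕ) : ℕ → List ℕ → Prop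
  | c, [] => c = 0
  | c, y :: l => c = y ∧ y ≠ 0 ∧ Linked next (next y) l

theorem linked_zero {next : ℕ → ℕ} {l : List ℕ} (h : Linked next 0 l) : l = [] := by
  cases l with
  | nil => rfl
  | cons y l => exact absurd h.1.symm h.2.1

theorem exists_cons_of_linked {next : ℕ → ℕ} {c : ℕ} {l : List ℕ} (h : Linked next c l)
    (hc : c ≠ 0) : ∃ l', l = c :: l' ∧ Linked next (next c) l' := by
  cases l with
  | nil => exact absurd h hc
  | cons y l =>
    obtain ⟨rfl, -, h⟩ := h
    exact ⟨l, rfl, h⟩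

theorem Linked.congr {next next' : ℕ → ℕ} {c : ℕ} {l : List ℕ} (h : Linked next c l)
    (hn : ∀ y ∈ l, next' y = next y) : Linked next' c l := by
  induction l generalizing c with
  | nil => exact h
  | cons y l ih =>
    refine ⟨h.1, h.2.1, ?_⟩
    rw [hn y (by simp)]
    exact ih h.2.2 fun z hz => hn z (by simp [hz])

/-! ## Hollow heaps -/

namespace HollowHeap

/-- The shape of a hollow heap with node set `P`. Node `x` has rank `rk x`, key `key x`, first child
`child x` and next sibling `next x`; it is hollow if `item x = 0`. The parent function `p` is not
stored; roots have parent `0`. The children of a full node of rank `r` have ranks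
`r - 1, …, 0`; of these a hollow node has only the first two. -/
structure Shape (rk item child next : ℕ → ℕ) (key : ℕ → ℝ) (p : ℕ → ℕ) (P : Finset ℕ) : Prop where
  zero_notMem : 0 ∉ P
  par_mem : ∀ x ∈ P, p x ≠ 0 → p x ∈ P
  rk_lt : ∀ x ∈ P, p x ≠ 0 → rk x < rk (p x)
  inj : ∀ x ∈ P, ∀ y ∈ P, p x ≠ 0 → p x = p y → rk x = rk y → x = y
  key_le : ∀ x ∈ P, p x ≠ 0 → key (p x) ≤ key x
  child_zero : ∀ x ∈ P, rk x = 0 → child x = 0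
  child_mem : ∀ x ∈ P, rk x ≠ 0 → child x ∈ P
  par_child : ∀ x ∈ P, rk x ≠ 0 → p (child x) = x
  rk_child : ∀ x ∈ P, rk x ≠ 0 → rk (child x) + 1 = rk x
  next_zero : ∀ x ∈ P, p x ≠ 0 → rk x = 0 → next x = 0
  next_hollow : ∀ x ∈ P, p x ≠ 0 → item (p x) = 0 → rk x + 2 = rk (p x) → next x = 0
  next_mem : ∀ x ∈ P, p x ≠ 0 → rk x ≠ 0 → item (p x) ≠ 0 ∨ rk x + 1 = rk (p x) → next x ∈ P
  par_next : ∀ x ∈ P, p x ≠ 0 → rk x ≠ 0 → item (p x) ≠ 0 ∨ rk x + 1 = rk (p x) → p (next x) = p x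
  rk_next : ∀ x ∈ P, p x ≠ 0 → rk x ≠ 0 → item (p x) ≠ 0 ∨ rk x + 1 = rk (p x) →
    rk (next x) + 1 = rk x
  rk_le : ∀ x ∈ P, p x ≠ 0 → item (p x) = 0 → rk (p x) ≤ rk x + 2

variable {rk item child next : ℕ → ℕ} {key : ℕ → ℝ} {p : ℕ → ℕ} {P : Finset ℕ}

theorem Shape.ne_zero (h : Shape rk item child next key p P) {x : ℕ} (hx : x ∈ P) : x ≠ 0 := by
  rintro rfl
  exact h.zero_notMem hx

/-- Every node of rank `r + 1` has a first child of rank `r`, and every node of rank `r + 2`, hollow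
or not, has a second child of rank `r`. Parents are unique, so these children are all distinct. -/
theorem Shape.card_rank (h : Shape rk item child next key p P) (r : ℕ) :
    (P.filter fun x => rk x = r + 1).card + (P.filter fun x => rk x = r + 2).card ≤
      (P.filter fun x => rk x = r).card := by
  have h1 : Set.InjOn child (P.filter fun x => rk x = r + 1 : Finset ℕ) := by
    intro x hx y hy hxy
    simp only [Finset.coe_filter, Set.mem_ofPred_eq] at hx hy
    rw [← h.par_child x hx.1 (by omega), ← h.par_child y hy.1 (by omega), hxy]
  have key2 : ∀ x ∈ P, rk x = r + 2 →
      next (child x) ∈ P ∧ p (next (child x)) = x ∧ rk (next (child x)) = r := by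
    intro x hx hr
    have a := h.child_mem x hx (by omega)
    have b := h.par_child x hx (by omega)
    have c := h.rk_child x hx (by omega)
    have z := h.ne_zero hx
    refine ⟨h.next_mem _ a (by omega) (by omega) (Or.inr (by rw [b]; omega)), ?_, ?_⟩
    · rw [h.par_next _ a (by omega) (by omega) (Or.inr (by rw [b]; omega)), b]
    · have := h.rk_next _ a (by omega) (by omega) (Or.inr (by rw [b]; omega))
      omega
  have h2 : Set.InjOn (fun x => next (child x)) (P.filter fun x => rk x = r + 2 : Finset ℕ) := by
    intro x hx y hy hxy
    simp only [Finset.coe_filter, Set.mem_ofPred_eq] at hx hy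
    simp only at hxy
    rw [← (key2 x hx.1 hx.2).2.1, ← (key2 y hy.1 hy.2).2.1, hxy]
  rw [← Finset.card_image_of_injOn h1, ← Finset.card_image_of_injOn h2,
    ← Finset.card_union_of_disjoint]
  · apply Finset.card_le_card
    intro z hz
    simp only [Finset.mem_union, Finset.mem_image, Finset.mem_filter] at hz ⊢
    rcases hz with ⟨x, ⟨hx, hr⟩, rfl⟩ | ⟨x, ⟨hx, hr⟩, rfl⟩
    · have := h.rk_child x hx (by omega)
      exact ⟨h.child_mem x hx (by omega), by omega⟩
    · exact ⟨(key2 x hx hr).1, (key2 x hx hr).2.2⟩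
  · rw [Finset.disjoint_left]
    intro z hz hz'
    simp only [Finset.mem_image, Finset.mem_filter] at hz hz'
    obtain ⟨x, ⟨hx, hr⟩, rfl⟩ := hz
    obtain ⟨y, ⟨hy, hr'⟩, hxy⟩ := hz'
    have a := h.par_child x hx (by omega)
    rw [← hxy, (key2 y hy hr').2.1] at a
    subst a
    omega

/-- Descending from the rank of `x`, the numbers of nodes of each rank grow at least like the
Fibonacci numbers, by `Shape.card_rank`; rank 0 gives the bound. This replaces counting subtrees. -/
theorem Shape.fib_le_card (h : Shape rk item child next key p P) {x : ℕ} (hx : x ∈ P) :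
    Nat.fib (rk x + 1) ≤ P.card := by
  have H : ∀ i, (i ≤ rk x → Nat.fib (i + 1) ≤ (P.filter fun y => rk y = rk x - i).card) := by
    intro i
    induction i using Nat.twoStepInduction with
    | zero =>
      intro _
      exact Finset.card_pos.2 ⟨x, by simp [hx]⟩
    | one =>
      intro hi
      have := h.card_rank (rk x - 1)
      have h1 : 0 < (P.filter fun y => rk y = rk x - 1 + 1).card :=
        Finset.card_pos.2 ⟨x, by simp [hx]; omega⟩
      have : Nat.fib (1 + 1) = 1 := rfl
      omega
    | more i ih1 ih2 =>
      intro hi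
      have := h.card_rank (rk x - (i + 2))
      rw [show rk x - (i + 2) + 1 = rk x - (i + 1) by omega,
        show rk x - (i + 2) + 2 = rk x - i by omega] at this
      have a := ih1 (by omega)
      have b := ih2 (by omega)
      rw [show i + 2 + 1 = i + 1 + 2 by omega, Nat.fib_add_two]
      simp only [show i + 1 + 1 = i + 2 by omega] at *
      omega
  exact (H (rk x) le_rfl).trans (Finset.card_le_card (Finset.filter_subset _ _))

/-- Heap order, followed upwards. Ranks strictly increase towards the parent and are bounded on `P`,
so the climb ends at a root. -/
theorem Shape.le_key (h : Shape rk item child next key p P) {μ : ℝ}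
    (hμ : ∀ x ∈ P, p x = 0 → μ ≤ key x) : ∀ x ∈ P, μ ≤ key x := by
  have hb : ∀ x ∈ P, rk x ≤ P.sup rk := fun x hx => Finset.le_sup (f := rk) hx
  suffices H : ∀ k, ∀ x ∈ P, P.sup rk - rk x = k → μ ≤ key x from fun x hx => H _ x hx rfl
  intro k
  induction k using Nat.strong_induction_on with
  | _ k ih =>
    intro x hx hk
    by_cases hp : p x = 0
    · exact hμ x hx hp
    · have a := h.rk_lt x hx hp
      have b := hb _ (h.par_mem x hx hp)
      exact (ih _ (by omega) (p x) (h.par_mem x hx hp) rfl).trans (h.key_le x hx hp)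

/-- The children of a node form a list. -/
theorem Shape.exists_children (h : Shape rk item child next key p P) {x : ℕ} (hx : x ∈ P) :
    ∃ l : List ℕ, Linked next (child x) l ∧ l.Nodup ∧ (∀ y, y ∈ l ↔ y ∈ P ∧ p y = x) ∧
      l.length ≤ rk x ∧ (item x = 0 → l.length ≤ 2) := by
  have hx0 := h.ne_zero hx
  -- The sibling list from the child of rank `r` enumerates the children of rank at most `r`. Below
  -- a hollow node it stops at rank `rk x - 2`, which the last inequality records; for the first
  -- child, `r + 1 = rk x`, it gives length at most 2.
  have H : ∀ r, ∀ c ∈ P, p c = x → rk c = r →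
      ∃ l : List ℕ, Linked next c l ∧ l.Nodup ∧ (∀ y, y ∈ l ↔ y ∈ P ∧ p y = x ∧ rk y ≤ r) ∧
        l.length ≤ r + 1 ∧ (item x = 0 → l.length + rk x ≤ r + 3) := by
    intro r
    induction r with
    | zero =>
      intro c hc hp hr
      have hx0' : p c ≠ 0 := by rw [hp]; exact hx0
      refine ⟨[c], ⟨rfl, h.ne_zero hc, h.next_zero c hc hx0' hr⟩, by simp, ?_, by simp, ?_⟩
      · intro y
        simp only [List.mem_singleton]
        constructor
        · rintro rfl
          exact ⟨hc, hp, hr.le⟩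
        · rintro ⟨a, b, e⟩
          exact h.inj y a c hc (by rw [b]; exact hx0) (by rw [b, hp]) (by omega)
      · intro hi
        have := h.rk_le c hc hx0' (by rw [hp]; exact hi)
        rw [hp] at this
        simp; omega
    | succ r ih =>
      intro c hc hp hr
      have hx0' : p c ≠ 0 := by rw [hp]; exact hx0
      have hlt := h.rk_lt c hc hx0'
      rw [hp] at hlt
      by_cases hcont : item (p c) ≠ 0 ∨ rk c + 1 = rk (p c)
      · have a := h.next_mem c hc hx0' (by omega) hcont
        have b := h.par_next c hc hx0' (by omega) hcont
        have d := h.rk_next c hc hx0' (by omega) hcont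
        obtain ⟨l, h1, h2, h3, h4, h5⟩ := ih _ a (b.trans hp) (by omega)
        refine ⟨c :: l, ⟨rfl, h.ne_zero hc, h1⟩, ?_, ?_, by simp; omega, ?_⟩
        · refine List.nodup_cons.2 ⟨fun hm => ?_, h2⟩
          have := (h3 c).1 hm
          omega
        · intro y
          simp only [List.mem_cons, h3]
          constructor
          · rintro (rfl | ⟨q, q', q''⟩)
            · exact ⟨hc, hp, hr.le⟩
            · exact ⟨q, q', by omega⟩
          · rintro ⟨q, q', q''⟩
            by_cases hy : rk y = r + 1
            · exact Or.inl (h.inj y q c hc (by rw [q']; exact hx0) (by rw [q', hp]) (by omega))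
            · exact Or.inr ⟨q, q', by omega⟩
        · intro hi
          have := h5 hi
          simp; omega
      · push Not at hcont
        rw [hp] at hcont
        have hle := h.rk_le c hc hx0' (by rw [hp]; exact hcont.1)
        rw [hp] at hle
        refine ⟨[c], ⟨rfl, h.ne_zero hc, h.next_hollow c hc hx0' (by rw [hp]; exact hcont.1)
          (by rw [hp]; omega)⟩, by simp, ?_, by simp, ?_⟩
        · intro y
          simp only [List.mem_singleton]
          constructor
          · rintro rfl
            exact ⟨hc, hp, hr.le⟩
          · rintro ⟨q, q', q''⟩
            have hy0 : p y ≠ 0 := by rw [q']; exact hx0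
            have := h.rk_le y q hy0 (by rw [q']; exact hcont.1)
            rw [q'] at this
            exact h.inj y q c hc hy0 (by rw [q', hp]) (by omega)
        · intro _
          simp; omega
  by_cases hr : rk x = 0
  · refine ⟨[], h.child_zero x hx hr, by simp, ?_, by simp, by simp⟩
    intro y
    simp only [List.not_mem_nil, false_iff, not_and]
    intro hy hp
    have := h.rk_lt y hy (by rw [hp]; exact hx0)
    rw [hp] at this
    omega
  · have hc := h.rk_child x hx hr
    obtain ⟨l, h1, h2, h3, h4, h5⟩ :=
      H _ (child x) (h.child_mem x hx hr) (h.par_child x hx hr) rfl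
    refine ⟨l, h1, h2, ?_, by omega, fun hi => by have := h5 hi; omega⟩
    intro y
    rw [h3]
    constructor
    · exact fun q => ⟨q.1, q.2.1⟩
    · rintro ⟨q, q'⟩
      have := h.rk_lt y q (by rw [q']; exact hx0)
      rw [q'] at this
      exact ⟨q, q', by omega⟩

/-- Removing a root makes its children roots. -/
theorem Shape.destroy (h : Shape rk item child next key p P) {x : ℕ} (hx : x ∈ P) (hp : p x = 0) :
    Shape rk item child next key (fun y => if p y = x then 0 else p y) (P.erase x) := by
  have hx0 := h.ne_zero hx
  have hpar : ∀ y ∈ P, p y = x → y ≠ x := by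
    rintro y hy hyx rfl
    omega
  constructor
  · simp [h.zero_notMem]
  all_goals simp only [Finset.mem_erase]
  · rintro y ⟨hy, hy'⟩ hq
    split_ifs at hq ⊢ with hyx
    · exact absurd rfl hq
    · exact ⟨hyx, h.par_mem y hy' hq⟩
  · rintro y ⟨hy, hy'⟩ hq
    split_ifs at hq ⊢ with hyx
    · exact absurd rfl hq
    · exact h.rk_lt y hy' hq
  · rintro y ⟨hy, hy'⟩ z ⟨hz, hz'⟩ hq
    split_ifs at hq ⊢ with hyx hzx
    · exact absurd rfl hq
    · exact absurd rfl hq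
    · exact fun a => absurd a hq
    · exact h.inj y hy' z hz' hq
  · rintro y ⟨hy, hy'⟩ hq
    split_ifs at hq ⊢ with hyx
    · exact absurd rfl hq
    · exact h.key_le y hy' hq
  · rintro y ⟨hy, hy'⟩
    exact h.child_zero y hy'
  · rintro y ⟨hy, hy'⟩ hr
    refine ⟨?_, h.child_mem y hy' hr⟩
    intro e
    have := h.par_child y hy' hr
    rw [e, hp] at this
    exact h.ne_zero hy' this.symm
  · rintro y ⟨hy, hy'⟩ hr
    rw [h.par_child y hy' hr, if_neg hy]
  · rintro y ⟨hy, hy'⟩ hr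
    exact h.rk_child y hy' hr
  · rintro y ⟨hy, hy'⟩ hq
    split_ifs at hq ⊢ with hyx
    · exact absurd rfl hq
    · exact h.next_zero y hy' hq
  · rintro y ⟨hy, hy'⟩ hq
    split_ifs at hq ⊢ with hyx
    · exact absurd rfl hq
    · exact h.next_hollow y hy' hq
  · rintro y ⟨hy, hy'⟩ hq hr
    split_ifs at hq ⊢ with hyx
    · exact absurd rfl hq
    · intro hc
      refine ⟨?_, h.next_mem y hy' hq hr hc⟩
      intro e
      have := h.par_next y hy' hq hr hc
      rw [e, hp] at this
      exact hq this.symm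
  · rintro y ⟨hy, hy'⟩ hq hr
    split_ifs at hq with hyx
    · exact absurd rfl hq
    · simp only [hyx, if_false]
      intro hc
      rw [h.par_next y hy' hq hr hc, if_neg hyx]
  · rintro y ⟨hy, hy'⟩ hq hr
    split_ifs at hq ⊢ with hyx
    · exact absurd rfl hq
    · exact h.rk_next y hy' hq hr
  · rintro y ⟨hy, hy'⟩ hq
    split_ifs at hq ⊢ with hyx
    · exact absurd rfl hq
    · exact h.rk_le y hy' hq

/-- The conditions that concern a single node. -/
theorem Shape.local (h : Shape rk item child next key p P) (x : ℕ) (hx : x ∈ P) :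
    x ≠ 0 ∧ (p x ≠ 0 → p x ∈ P ∧ rk x < rk (p x) ∧ key (p x) ≤ key x ∧ (rk x = 0 → next x = 0) ∧
      (item (p x) = 0 → rk x + 2 = rk (p x) → next x = 0) ∧
      (rk x ≠ 0 → item (p x) ≠ 0 ∨ rk x + 1 = rk (p x) →
        next x ∈ P ∧ p (next x) = p x ∧ rk (next x) + 1 = rk x) ∧
      (item (p x) = 0 → rk (p x) ≤ rk x + 2)) ∧
    (rk x = 0 → child x = 0) ∧
    (rk x ≠ 0 → child x ∈ P ∧ p (child x) = x ∧ rk (child x) + 1 = rk x) :=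
  ⟨h.ne_zero hx, fun hp => ⟨h.par_mem x hx hp, h.rk_lt x hx hp, h.key_le x hx hp,
    h.next_zero x hx hp, h.next_hollow x hx hp,
    fun a b => ⟨h.next_mem x hx hp a b, h.par_next x hx hp a b, h.rk_next x hx hp a b⟩,
    h.rk_le x hx hp⟩, h.child_zero x hx,
    fun a => ⟨h.child_mem x hx a, h.par_child x hx a, h.rk_child x hx a⟩⟩

open Function in
/-- Linking the root `y` below the full root `x` of the same rank. -/
theorem Shape.link (h : Shape rk item child next key p P) {x y : ℕ} (hx : x ∈ P) (hy : y ∈ P)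
    (hpx : p x = 0) (hpy : p y = 0) (hxy : x ≠ y) (hi : item x ≠ 0) (hr : rk x = rk y)
    (hk : key x ≤ key y) :
    Shape (update rk x (rk x + 1)) item (update child x y) (update next y (child x)) key
      (update p y x) P := by
  have hx0 := h.ne_zero hx
  have hX := h.local x hx
  have hY := h.local y hy
  constructor
  all_goals try simp only [update_apply]
  · have := h.zero_notMem
    exact this
  · intro z hz
    have H := h.local z
    grind
  · intro z hz
    have H := h.local z
    grind
  · intro z hz z' hz'
    have H := h.local z
    have H' := h.local z'
    have I := h.inj z
    grind
  · intro z hz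
    have H := h.local z
    grind
  · intro z hz
    have H := h.local z
    grind
  · intro z hz
    have H := h.local z
    grind
  · intro z hz
    have H := h.local z
    grind
  · intro z hz
    have H := h.local z
    grind
  · intro z hz
    have H := h.local z
    grind
  · intro z hz
    have H := h.local z
    grind
  · intro z hz
    have H := h.local z
    grind
  · intro z hz
    have H := h.local z
    grind
  · intro z hz
    have H := h.local z
    grind
  · intro z hz
    have H := h.local z
    grind

open Function in
/-- Decreasing the key of the item at `u`: the item moves to a new node `x`, together with all
but the first two children of `u`, which becomes hollow. For `u = 0` this is an insertion. -/
theorem Shape.update (h : Shape rk item child next key p P) {x u i : ℕ} {k : ℝ}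
    (hc0 : child 0 = 0) (hn0 : next 0 = 0) (hr0 : rk 0 = 0)
    (hx : x ∉ P) (hx0 : x ≠ 0) (hi : i ≠ 0)
    (hu : u = 0 ∨ u ∈ P ∧ item u ≠ 0 ∧ k ≤ key u) :
    Shape (update rk x (rk u - 1 - 1)) (update (update item x i) u 0)
      (update child x (next (next (child u)))) (update next (next (child u)) 0) (update key x k)
      (fun c => if c = x then 0 else if u ≠ 0 ∧ p c = u ∧ rk c + 2 < rk u then x else p c)
      (insert x P) := by
  have hz0 := h.zero_notMem
  rcases hu with rfl | ⟨hu, hiu, hku⟩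
  · simp only [hc0, hn0, hr0, ne_eq, not_true, false_and, if_false]
    rw [show Function.update next 0 0 = next by
      funext z; by_cases hz : z = 0 <;> simp [hz, hn0]]
    constructor
    all_goals try simp only [update_apply, Finset.mem_insert]
    · have := h.zero_notMem
      grind
    · intro z hz
      have H := h.local z
      grind
    · intro z hz
      have H := h.local z
      grind
    · intro z hz z' hz'
      have H := h.local z
      have H' := h.local z'
      have I := h.inj z
      grind
    · intro z hz
      have H := h.local z
      grind
    · intro z hz
      have H := h.local z
      grind
    · intro z hz
      have H := h.local z
      grind
    · intro z hz
      have H := h.local z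
      grind
    · intro z hz
      have H := h.local z
      grind
    · intro z hz
      have H := h.local z
      grind
    · intro z hz
      have H := h.local z
      grind
    · intro z hz
      have H := h.local z
      grind
    · intro z hz
      have H := h.local z
      grind
    · intro z hz
      have H := h.local z
      grind
    · intro z hz
      have H := h.local z
      grind
  · have hu0 := h.ne_zero hu
    -- `c` is the second child of `u` and `c'` the third, or 0 when missing. The list is cut between
    -- them; `c'` exists for rank at least 3 because `u` is still full.
    obtain ⟨c, hc⟩ : ∃ c, c = next (child u) := ⟨_, rfl⟩
    obtain ⟨c', hc'⟩ : ∃ c', c' = next c := ⟨_, rfl⟩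
    have hA : rk u < 2 → c = 0 := by
      intro hr
      by_cases hr0 : rk u = 0
      · rw [hc, h.child_zero u hu hr0, hn0]
      · have := h.rk_child u hu hr0
        rw [hc]
        exact h.next_zero _ (h.child_mem u hu hr0) (by rw [h.par_child u hu hr0]; exact hu0)
          (by omega)
    have hB : 2 ≤ rk u → c ∈ P ∧ p c = u ∧ rk c + 2 = rk u := by
      intro hr
      have b1 := h.child_mem u hu (by omega)
      have b2 := h.par_child u hu (by omega)
      have b3 := h.rk_child u hu (by omega)
      have b4 : p (child u) ≠ 0 := by rw [b2]; exact hu0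
      have b5 : item (p (child u)) ≠ 0 ∨ rk (child u) + 1 = rk (p (child u)) :=
        Or.inr (by rw [b2]; exact b3)
      have := h.rk_next _ b1 b4 (by omega) b5
      rw [hc]
      exact ⟨h.next_mem _ b1 b4 (by omega) b5, (h.par_next _ b1 b4 (by omega) b5).trans b2,
        by omega⟩
    have hC : rk u < 3 → c' = 0 := by
      intro hr
      by_cases hr2 : rk u < 2
      · rw [hc', hA hr2, hn0]
      · obtain ⟨b1, b2, b3⟩ := hB (by omega)
        rw [hc']
        exact h.next_zero _ b1 (by rw [b2]; exact hu0) (by omega)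
    have hD : 3 ≤ rk u → c' ∈ P ∧ p c' = u ∧ rk c' + 3 = rk u := by
      intro hr
      obtain ⟨b1, b2, b3⟩ := hB (by omega)
      have b4 : p c ≠ 0 := by rw [b2]; exact hu0
      have b5 : item (p c) ≠ 0 ∨ rk c + 1 = rk (p c) := Or.inl (by rw [b2]; exact hiu)
      have := h.rk_next _ b1 b4 (by omega) b5
      rw [hc']
      exact ⟨h.next_mem _ b1 b4 (by omega) b5, (h.par_next _ b1 b4 (by omega) b5).trans b2,
        by omega⟩
    rw [← hc, ← hc']
    have hxu : x ≠ u := by rintro rfl; exact hx hu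
    simp only [hu0, ne_eq, not_false_eq_true, true_and]
    have hU := h.local u hu
    constructor
    all_goals try simp only [update_apply, Finset.mem_insert]
    · have := h.zero_notMem
      grind
    · intro z hz
      have H := h.local z
      grind
    · intro z hz
      have H := h.local z
      grind
    · intro z hz z' hz'
      have H := h.local z
      have H' := h.local z'
      have I := h.inj z
      grind
    · intro z hz
      have H := h.local z
      grind
    · intro z hz
      have H := h.local z
      grind
    · intro z hz
      have H := h.local z
      grind
    · intro z hz
      have H := h.local z
      grind
    · intro z hz
      have H := h.local z
      grind
    · intro z hz
      have H := h.local z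
      grind
    · intro z hz
      have H := h.local z
      -- Siblings of equal rank coincide, so the child of rank `rk u - 2` is the one whose successor
      -- has just been cleared.
      have E : z ∈ P → p z = u → rk z + 2 = rk u → z = c := fun a b e =>
        h.inj z a c (hB (by omega)).1 (by omega) (by rw [b, (hB (by omega)).2.1])
          (by have := (hB (by omega)).2.2; omega)
      grind
    · intro z hz
      have H := h.local z
      grind
    · intro z hz
      have H := h.local z
      grind
    · intro z hz
      have H := h.local z
      grind
    · intro z hz
      have H := h.local z
      grind

end HollowHeap

/-! ### Heap operations as changes of memory -/

open RAM

namespace HollowHeap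

/-- The first `c` entries of an array. -/
def contents (a : ℕ → ℕ) (c : ℕ) : List ℕ := (List.range c).map a

theorem contents_zero (a : ℕ → ℕ) : contents a 0 = [] := rfl

theorem contents_succ (a : ℕ → ℕ) (c : ℕ) : contents a (c + 1) = contents a c ++ [a c] := by
  simp [contents, List.range_succ]

theorem contents_update (a : ℕ → ℕ) (c x : ℕ) :
    contents (Function.update a c x) c = contents a c := by
  apply List.map_congr_left
  intro i hi
  rw [List.mem_range] at hi
  exact Function.update_of_ne hi.ne _ _

theorem contents_push (a : ℕ → ℕ) (c x : ℕ) :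
    contents (Function.update a c x) (c + 1) = contents a c ++ [x] := by
  rw [contents_succ, contents_update, Function.update_self]

/-- The memory `σ` holds a hollow heap with items `H` and keys `kf`; `S` lists the roots that are
not in the slot array, and `R` is the set of the ranks of the others. -/
structure Core (σ : State) (M : ℕ) (H : Finset ℕ) (kf : ℕ → ℝ) (p : ℕ → ℕ) (P : Finset ℕ)
    (S : List ℕ) (R : Finset ℕ) : Prop where
  shape : Shape (σ.iarr 9) (σ.iarr 8) (σ.iarr 10) (σ.iarr 11) (σ.rarr 3) p P
  null_child : σ.iarr 10 0 = 0
  null_next : σ.iarr 11 0 = 0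
  null_rk : σ.iarr 9 0 = 0
  le_count : ∀ x ∈ P, x ≤ σ.ireg 7
  fib_le : Nat.fib (σ.ireg 9 + 1) ≤ M
  full : ∀ x ∈ P, σ.iarr 8 x ≠ 0 → σ.iarr 8 x - 1 ∈ H ∧ σ.iarr 7 (σ.iarr 8 x - 1) = x
  node_mem : ∀ v ∈ H, σ.iarr 7 v ∈ P
  item_node : ∀ v ∈ H, σ.iarr 8 (σ.iarr 7 v) = v + 1
  key_node : ∀ v ∈ H, σ.rarr 3 (σ.iarr 7 v) = kf v
  nodup : S.Nodup
  roots : ∀ x, (x ∈ P ∧ p x = 0) ↔ (x ∈ S ∨ (x ≠ 0 ∧ σ.iarr 13 (σ.iarr 9 x) = x))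
  mem_slots : ∀ r, r ∈ R ↔ σ.iarr 13 r ≠ 0
  slots : ∀ r ∈ R, σ.iarr 9 (σ.iarr 13 r) = r ∧ σ.iarr 8 (σ.iarr 13 r) ≠ 0 ∧
    σ.iarr 13 r ∉ S ∧ r ≤ σ.ireg 9

variable {σ τ : State} {M : ℕ} {H : Finset ℕ} {kf : ℕ → ℝ} {p : ℕ → ℕ} {P : Finset ℕ}
  {S S' : List ℕ} {R : Finset ℕ}

theorem Core.perm (h : Core σ M H kf p P S R) (hS : S.Perm S') : Core σ M H kf p P S' R where
  __ := h
  nodup := hS.nodup_iff.1 h.nodup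
  roots x := by rw [h.roots, hS.mem_iff]
  slots r hr := by rw [← hS.mem_iff]; exact h.slots r hr

/-- Nodes are numbered consecutively from 1 and register 7 holds the last number used, so there are
at most `M` of them. -/
theorem Core.fib_rank (h : Core σ M H kf p P S R) (hM : σ.ireg 7 ≤ M) {x : ℕ} (hx : x ∈ P) :
    Nat.fib (σ.iarr 9 x + 1) ≤ M := by
  refine (h.shape.fib_le_card hx).trans (le_trans ?_ hM)
  have : P ⊆ Finset.Icc 1 (σ.ireg 7) := fun y hy =>
    Finset.mem_Icc.2 ⟨Nat.pos_of_ne_zero (h.shape.ne_zero hy), h.le_count y hy⟩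
  simpa using Finset.card_le_card this

/-- One statement serves both uses. For a hollow `x` the condition on `H'` gives `H' = H`, since `v
+ 1` is never 0; for the full root of minimum key, `H'` loses exactly its item. -/
theorem Core.destroy {x : ℕ} (h : Core σ M H kf p P (x :: S) R) {H' : Finset ℕ} {l : List ℕ}
    (hl : l.Nodup) (hl' : ∀ y, y ∈ l ↔ y ∈ P ∧ p y = x)
    (hH : ∀ v, v ∈ H' ↔ v ∈ H ∧ v + 1 ≠ σ.iarr 8 x)
    (e7 : τ.iarr 7 = σ.iarr 7) (e8 : τ.iarr 8 = σ.iarr 8) (e9 : τ.iarr 9 = σ.iarr 9)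
    (e10 : τ.iarr 10 = σ.iarr 10) (e11 : τ.iarr 11 = σ.iarr 11) (e13 : τ.iarr 13 = σ.iarr 13)
    (ek : τ.rarr 3 = σ.rarr 3) (eN : τ.ireg 7 = σ.ireg 7) (er : τ.ireg 9 = σ.ireg 9) :
    Core τ M H' kf (fun y => if p y = x then 0 else p y) (P.erase x) (S ++ l) R := by
  have hx := (h.roots x).2 (Or.inl (by simp))
  have hx0 := h.shape.ne_zero hx.1
  have hnd := List.nodup_cons.1 h.nodup
  have hroot : ∀ y, y ∈ S → y ∈ P ∧ p y = 0 := fun y hy => (h.roots y).2 (Or.inl (by simp [hy]))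
  constructor
  · rw [e8, e9, e10, e11, ek]
    exact h.shape.destroy hx.1 hx.2
  · rw [e10]; exact h.null_child
  · rw [e11]; exact h.null_next
  · rw [e9]; exact h.null_rk
  · rw [eN]; exact fun y hy => h.le_count y (Finset.mem_of_mem_erase hy)
  · rw [er]; exact h.fib_le
  · rw [e8, e7]
    intro y hy hi
    rw [Finset.mem_erase] at hy
    obtain ⟨a, b⟩ := h.full y hy.2 hi
    refine ⟨(hH _).2 ⟨a, fun e => hy.1 ?_⟩, b⟩
    rw [← b, ← (h.full x hx.1 (by omega)).2]
    congr 1; omega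
  · rw [e7]
    intro v hv
    rw [hH] at hv
    refine Finset.mem_erase.2 ⟨?_, h.node_mem v hv.1⟩
    rintro e
    apply hv.2
    rw [← e, h.item_node v hv.1]
  · rw [e7, e8]; exact fun v hv => h.item_node v ((hH v).1 hv).1
  · rw [e7, ek]; exact fun v hv => h.key_node v ((hH v).1 hv).1
  · refine List.nodup_append.2 ⟨hnd.2, hl, ?_⟩
    rintro a ha b hb rfl
    have := (hl' a).1 hb
    have := hroot a ha
    omega
  · intro y
    rw [e13, e9]
    have := h.roots y
    simp only [List.mem_cons] at this
    have hs := h.slots (σ.iarr 9 y)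
    rw [h.mem_slots] at hs
    have hn := hnd.1
    -- A root in the slot array is not loose, whereas `x` is.
    have hs' : ∀ y, y ≠ 0 ∧ σ.iarr 13 (σ.iarr 9 y) = y → y ≠ x := by
      rintro y ⟨hy, hy'⟩ rfl
      have := h.slots (σ.iarr 9 y) ((h.mem_slots _).2 (by omega))
      simp [hy'] at this
    have hs'' := hs' y
    simp only [List.mem_append, hl', Finset.mem_erase]
    by_cases hp : p y = x
    · have : y ≠ x := by rintro rfl; omega
      simp only [hp, if_true, and_true]
      constructor
      · rintro ⟨_, b⟩
        exact Or.inl (Or.inr b)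
      · rintro ((a | a) | a)
        · have := hroot y a; omega
        · exact ⟨this, a⟩
        · have := (h.roots y).2 (Or.inr a)
          omega
    · simp only [hp, if_false, and_false, or_false]
      constructor
      · rintro ⟨⟨a, b⟩, c⟩
        have := this.1 ⟨b, c⟩
        tauto
      · rintro (a | a)
        · have := hroot y a
          refine ⟨⟨?_, this.1⟩, this.2⟩
          rintro rfl; exact hn a
        · have := this.2 (Or.inr a)
          exact ⟨⟨hs'' a, this.1⟩, this.2⟩
  · rw [e13]; exact h.mem_slots
  · rw [e9, e13, e8, er]
    intro r hr
    obtain ⟨a, b, c, d⟩ := h.slots r hr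
    refine ⟨a, b, ?_, d⟩
    simp only [List.mem_cons, not_or] at c
    simp only [List.mem_append, hl', not_or]
    refine ⟨c.2, ?_⟩
    rintro ⟨-, hp⟩
    have := (h.roots (σ.iarr 13 r)).2 (Or.inr ⟨(h.mem_slots r).1 hr, by rw [a]⟩)
    omega

open Function in
/-- Linking the loose root `z ∈ {x, y}` below the other one, where `y` is the root of the same rank
in the slot array. -/
theorem Core.link {x y a b : ℕ} (h : Core σ M H kf p P (x :: S) R)
    (hi : σ.iarr 8 x ≠ 0) (hy0 : y ≠ 0) (hy : y = σ.iarr 13 (σ.iarr 9 x))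
    (hab : a = x ∧ b = y ∨ a = y ∧ b = x) (hk : σ.rarr 3 a ≤ σ.rarr 3 b)
    (e7 : τ.iarr 7 = σ.iarr 7) (e8 : τ.iarr 8 = σ.iarr 8)
    (e9 : τ.iarr 9 = update (σ.iarr 9) a (σ.iarr 9 x + 1))
    (e10 : τ.iarr 10 = update (σ.iarr 10) a b)
    (e11 : τ.iarr 11 = update (σ.iarr 11) b (σ.iarr 10 a))
    (e13 : τ.iarr 13 = update (σ.iarr 13) (σ.iarr 9 x) 0)
    (ek : τ.rarr 3 = σ.rarr 3) (eN : τ.ireg 7 = σ.ireg 7) (er : τ.ireg 9 = σ.ireg 9) :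
    Core τ M H kf (update p b a) P (a :: S) (R.erase (σ.iarr 9 x)) := by
  have hx := (h.roots x).2 (Or.inl (by simp))
  have hyR := (h.mem_slots (σ.iarr 9 x)).2 (by omega)
  obtain ⟨hyr, hyi, hyS, hyle⟩ := h.slots _ hyR
  rw [← hy] at hyr hyi hyS
  have hyP := (h.roots y).2 (Or.inr ⟨hy0, by rw [hyr, ← hy]⟩)
  have hxy : x ≠ y := by rintro rfl; simp at hyS
  have hx0 := h.shape.ne_zero hx.1
  have hnd := List.nodup_cons.1 h.nodup
  simp only [List.mem_cons, not_or] at hyS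
  have hroot : ∀ z, z ∈ S → z ∈ P ∧ p z = 0 := fun y hy => (h.roots y).2 (Or.inl (by simp [hy]))
  have hsh : Shape (update (σ.iarr 9) a (σ.iarr 9 x + 1)) (σ.iarr 8) (update (σ.iarr 10) a b)
      (update (σ.iarr 11) b (σ.iarr 10 a)) (σ.rarr 3) (update p b a) P := by
    rcases hab with ⟨rfl, rfl⟩ | ⟨rfl, rfl⟩
    · exact h.shape.link hx.1 hyP.1 hx.2 hyP.2 hxy hi hyr.symm hk
    · rw [← hyr]
      exact h.shape.link hyP.1 hx.1 hyP.2 hx.2 hxy.symm hyi hyr hk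
  have ha0 : a ≠ 0 := by omega
  have hb0 : b ≠ 0 := by omega
  have hbP : b ∈ P := by rcases hab with ⟨rfl, rfl⟩ | ⟨rfl, rfl⟩; exacts [hyP.1, hx.1]
  have hslot : ∀ r ∈ R.erase (σ.iarr 9 x), σ.iarr 13 r ≠ a ∧ σ.iarr 13 r ≠ b := by
    intro r hr
    rw [Finset.mem_erase] at hr
    obtain ⟨q1, q2, q3, q4⟩ := h.slots r hr.2
    have c1 : σ.iarr 13 r ≠ x := by intro e; rw [e] at q1; exact hr.1 q1.symm
    have c2 : σ.iarr 13 r ≠ y := by intro e; rw [e, hyr] at q1; exact hr.1 q1.symm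
    rcases hab with ⟨rfl, rfl⟩ | ⟨rfl, rfl⟩
    exacts [⟨c1, c2⟩, ⟨c2, c1⟩]
  constructor
  · rw [e8, e9, e10, e11, ek]; exact hsh
  · rw [e10, update_of_ne ha0.symm]; exact h.null_child
  · rw [e11, update_of_ne hb0.symm]; exact h.null_next
  · rw [e9, update_of_ne ha0.symm]; exact h.null_rk
  · rw [eN]; exact h.le_count
  · rw [er]; exact h.fib_le
  · rw [e7, e8]; exact h.full
  · rw [e7]; exact h.node_mem
  · rw [e7, e8]; exact h.item_node
  · rw [e7, ek]; exact h.key_node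
  · refine List.nodup_cons.2 ⟨?_, hnd.2⟩
    rcases hab with ⟨rfl, rfl⟩ | ⟨rfl, rfl⟩
    exacts [hnd.1, hyS.2]
  · intro z
    have hz := h.roots z
    rw [e13, e9]
    have hsz := h.mem_slots (σ.iarr 9 z)
    have hsz' := h.slots (σ.iarr 9 z)
    have hxn := hnd.1
    have hrz := hroot z
    -- The new rank of the winner may already be occupied in the slot array. The occupant had that
    -- rank before the link, so it is not the winner.
    have hsx := h.slots (σ.iarr 9 x + 1)
    have hsx' := h.mem_slots (σ.iarr 9 x + 1)
    simp only [List.mem_cons, update_apply] at *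
    rcases hab with ⟨rfl, rfl⟩ | ⟨rfl, rfl⟩
    · grind
    · grind
  · intro r
    rw [e13, Finset.mem_erase, h.mem_slots, update_apply]
    split_ifs with hr <;> simp [hr]
  · intro r hr
    have hs := hslot r hr
    rw [Finset.mem_erase] at hr
    obtain ⟨q1, q2, q3, q4⟩ := h.slots r hr.2
    rw [e13, update_of_ne hr.1, e9, update_of_ne hs.1, e8, er]
    simp only [List.mem_cons, not_or] at q3 ⊢
    exact ⟨q1, q2, ⟨hs.1, q3.2⟩, q4⟩

open Function in
/-- Moving a loose root into the slot array. -/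
theorem Core.place {x : ℕ} (h : Core σ M H kf p P (x :: S) R) (hM : σ.ireg 7 ≤ M)
    (hi : σ.iarr 8 x ≠ 0) (hs : σ.iarr 13 (σ.iarr 9 x) = 0)
    (e7 : τ.iarr 7 = σ.iarr 7) (e8 : τ.iarr 8 = σ.iarr 8) (e9 : τ.iarr 9 = σ.iarr 9)
    (e10 : τ.iarr 10 = σ.iarr 10) (e11 : τ.iarr 11 = σ.iarr 11)
    (e13 : τ.iarr 13 = update (σ.iarr 13) (σ.iarr 9 x) x)
    (ek : τ.rarr 3 = σ.rarr 3) (eN : τ.ireg 7 = σ.ireg 7)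
    (er : τ.ireg 9 = max (σ.ireg 9) (σ.iarr 9 x)) :
    Core τ M H kf p P S (insert (σ.iarr 9 x) R) := by
  have hx := (h.roots x).2 (Or.inl (by simp))
  have hx0 := h.shape.ne_zero hx.1
  have hnd := List.nodup_cons.1 h.nodup
  constructor
  · rw [e8, e9, e10, e11, ek]; exact h.shape
  · rw [e10]; exact h.null_child
  · rw [e11]; exact h.null_next
  · rw [e9]; exact h.null_rk
  · rw [eN]; exact h.le_count
  · rw [er]
    rcases max_cases (σ.ireg 9) (σ.iarr 9 x) with ⟨e, -⟩ | ⟨e, -⟩ <;> rw [e]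
    exacts [h.fib_le, h.fib_rank hM hx.1]
  · rw [e7, e8]; exact h.full
  · rw [e7]; exact h.node_mem
  · rw [e7, e8]; exact h.item_node
  · rw [e7, ek]; exact h.key_node
  · exact hnd.2
  · intro z
    have hz := h.roots z
    rw [e13, e9]
    have hxn := hnd.1
    simp only [List.mem_cons, update_apply] at *
    grind
  · intro r
    rw [e13, Finset.mem_insert, h.mem_slots, update_apply]
    split_ifs with hr <;> simp [hr, hx0]
  · intro r hr
    rw [e13, e9, e8, er, update_apply]
    split_ifs with hrx
    · exact ⟨hrx.symm, hi, hnd.1, by omega⟩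
    · obtain ⟨q1, q2, q3, q4⟩ := h.slots r (Finset.mem_of_mem_insert_of_ne hr hrx)
      simp only [List.mem_cons, not_or] at q3
      exact ⟨q1, q2, q3.2, by omega⟩

open Function in
/-- Moving a root out of the slot array. -/
theorem Core.unplace {r : ℕ} (h : Core σ M H kf p P S R) (hs : σ.iarr 13 r ≠ 0)
    (e7 : τ.iarr 7 = σ.iarr 7) (e8 : τ.iarr 8 = σ.iarr 8) (e9 : τ.iarr 9 = σ.iarr 9)
    (e10 : τ.iarr 10 = σ.iarr 10) (e11 : τ.iarr 11 = σ.iarr 11)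
    (e13 : τ.iarr 13 = update (σ.iarr 13) r 0)
    (ek : τ.rarr 3 = σ.rarr 3) (eN : τ.ireg 7 = σ.ireg 7) (er : τ.ireg 9 = σ.ireg 9) :
    Core τ M H kf p P (σ.iarr 13 r :: S) (R.erase r) := by
  obtain ⟨a, b, c, d⟩ := h.slots r ((h.mem_slots r).2 hs)
  constructor
  · rw [e8, e9, e10, e11, ek]; exact h.shape
  · rw [e10]; exact h.null_child
  · rw [e11]; exact h.null_next
  · rw [e9]; exact h.null_rk
  · rw [eN]; exact h.le_count
  · rw [er]; exact h.fib_le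
  · rw [e7, e8]; exact h.full
  · rw [e7]; exact h.node_mem
  · rw [e7, e8]; exact h.item_node
  · rw [e7, ek]; exact h.key_node
  · exact List.nodup_cons.2 ⟨c, h.nodup⟩
  · intro z
    have hz := h.roots z
    rw [e13, e9]
    simp only [List.mem_cons, update_apply]
    grind
  · intro r
    rw [e13, Finset.mem_erase, h.mem_slots, update_apply]
    split_ifs with hr <;> simp [hr]
  · intro q hq
    rw [Finset.mem_erase] at hq
    obtain ⟨q1, q2, q3, q4⟩ := h.slots q hq.2
    rw [e13, e9, e8, er, update_of_ne hq.1]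
    refine ⟨q1, q2, ?_, q4⟩
    simp only [List.mem_cons, not_or]
    refine ⟨fun e => hq.1 ?_, q3⟩
    rw [← q1, e, a]

open Function in
/-- Inserting an item, or decreasing its key. -/
theorem Core.update {v : ℕ} {k : ℝ} (h : Core σ M H kf p P S ∅)
    (hv : v ∈ H ∧ k ≤ kf v ∨ v ∉ H ∧ σ.iarr 7 v = 0)
    (e7 : τ.iarr 7 = update (σ.iarr 7) v (σ.ireg 7 + 1))
    (e8 : τ.iarr 8 = update (update (σ.iarr 8) (σ.ireg 7 + 1) (v + 1)) (σ.iarr 7 v) 0)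
    (e9 : τ.iarr 9 = update (σ.iarr 9) (σ.ireg 7 + 1) (σ.iarr 9 (σ.iarr 7 v) - 1 - 1))
    (e10 : τ.iarr 10 = update (σ.iarr 10) (σ.ireg 7 + 1)
      (σ.iarr 11 (σ.iarr 11 (σ.iarr 10 (σ.iarr 7 v)))))
    (e11 : τ.iarr 11 = update (σ.iarr 11) (σ.iarr 11 (σ.iarr 10 (σ.iarr 7 v))) 0)
    (e13 : τ.iarr 13 = σ.iarr 13)
    (ek : τ.rarr 3 = update (σ.rarr 3) (σ.ireg 7 + 1) k)
    (eN : τ.ireg 7 = σ.ireg 7 + 1) (er : τ.ireg 9 = σ.ireg 9) :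
    ∃ p', Core τ M (insert v H) (update kf v k) p' (insert (σ.ireg 7 + 1) P)
      (S ++ [σ.ireg 7 + 1]) ∅ := by
  have hN : σ.ireg 7 + 1 ∉ P := fun hm => by have := h.le_count _ hm; omega
  have hu : σ.iarr 7 v = 0 ∨ σ.iarr 7 v ∈ P ∧ σ.iarr 8 (σ.iarr 7 v) ≠ 0 ∧
      k ≤ σ.rarr 3 (σ.iarr 7 v) := by
    rcases hv with ⟨a, b⟩ | ⟨a, b⟩
    · refine Or.inr ⟨h.node_mem v a, ?_, ?_⟩
      · rw [h.item_node v a]; omega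
      · rw [h.key_node v a]; exact b
    · exact Or.inl b
  have hsl : ∀ r, σ.iarr 13 r = 0 := by
    intro r
    by_contra hr
    simpa using (h.mem_slots r).2 hr
  have hnode : ∀ w ∈ H, w ≠ v → σ.iarr 7 w ≠ σ.iarr 7 v := by
    intro w hw hwv e
    rcases hv with ⟨a, b⟩ | ⟨a, b⟩
    · have h1 := h.item_node v a
      rw [← e, h.item_node w hw] at h1
      omega
    · rw [b] at e
      exact h.shape.ne_zero (h.node_mem w hw) e
  have hnN : ∀ w ∈ H, σ.iarr 7 w ≠ σ.ireg 7 + 1 := fun w hw e => hN (e ▸ h.node_mem w hw)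
  have hneN : σ.ireg 7 + 1 ≠ σ.iarr 7 v := by
    rcases hu with e | ⟨e, -⟩
    · omega
    · have := h.le_count _ e; omega
  refine ⟨fun c => if c = σ.ireg 7 + 1 then 0 else
    if σ.iarr 7 v ≠ 0 ∧ p c = σ.iarr 7 v ∧ σ.iarr 9 c + 2 < σ.iarr 9 (σ.iarr 7 v) then σ.ireg 7 + 1
    else p c, ?_⟩
  constructor
  · rw [e8, e9, e10, e11, ek]
    exact h.shape.update h.null_child h.null_next h.null_rk hN (by omega) (by omega) hu
  · rw [e10, update_of_ne (by omega)]; exact h.null_child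
  · rw [e11, update_apply]; split_ifs; exacts [rfl, h.null_next]
  · rw [e9, update_of_ne (by omega)]; exact h.null_rk
  · rw [eN]
    intro x hx
    rcases Finset.mem_insert.1 hx with rfl | hx
    · exact le_rfl
    · have := h.le_count x hx; omega
  · rw [er]; exact h.fib_le
  · intro x hx hi
    rw [e8] at hi ⊢
    rw [e7]
    by_cases hxu : x = σ.iarr 7 v
    · rw [hxu, update_self] at hi
      exact absurd rfl hi
    · rw [update_of_ne hxu] at hi ⊢
      rcases Finset.mem_insert.1 hx with rfl | hx
      · simp
      · have hxN : x ≠ σ.ireg 7 + 1 := fun e => hN (e ▸ hx)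
        rw [update_of_ne hxN] at hi ⊢
        obtain ⟨q1, q2⟩ := h.full x hx hi
        refine ⟨Finset.mem_insert_of_mem q1, ?_⟩
        rw [update_of_ne, q2]
        intro e
        rw [e] at q2
        exact hxu q2.symm
  · intro w hw
    rw [e7, update_apply]
    split_ifs with hwv
    · simp
    · exact Finset.mem_insert_of_mem (h.node_mem w (Finset.mem_of_mem_insert_of_ne hw hwv))
  · intro w hw
    rw [e7, e8]
    by_cases hwv : w = v
    · rw [hwv, update_self, update_of_ne hneN, update_self]
    · have hw := Finset.mem_of_mem_insert_of_ne hw hwv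
      rw [update_of_ne hwv, update_of_ne (hnode w hw hwv), update_of_ne (hnN w hw),
        h.item_node w hw]
  · intro w hw
    rw [e7, ek]
    by_cases hwv : w = v
    · rw [hwv, update_self, update_self, update_self]
    · have hw := Finset.mem_of_mem_insert_of_ne hw hwv
      rw [update_of_ne hwv, update_of_ne (hnN w hw), h.key_node w hw, update_of_ne hwv]
  · refine List.nodup_append.2 ⟨h.nodup, by simp, ?_⟩
    rintro a ha b hb rfl
    rw [List.mem_singleton] at hb
    rw [hb] at ha
    exact hN ((h.roots _).2 (Or.inl ha)).1
  · intro x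
    rw [e13, hsl]
    have hx := h.roots x
    rw [hsl] at hx
    simp only [Finset.mem_insert, List.mem_append, List.mem_singleton]
    grind
  · intro r; rw [e13]; exact h.mem_slots r
  · intro r hr; simp at hr

/-! ### Heap programs and their amortized cost -/

/-- Push the list of siblings starting at register `13` onto the stack. -/
def pushList : Cmd :=
  .loop (.ilt (.const 0) (.reg 13)) (.block
    [.iput 12 (.reg 8) (.reg 13), .iset 8 (.succ (.reg 8)), .iset 13 (.get 11 (.reg 13))])

/-- Link the full root in register `10` of rank given by register `12` with the roots in the slot
array until its rank is free. -/
def linkRoots : Cmd :=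
  .loop (.ilt (.const 0) (.get 13 (.reg 12))) (.block
    [.iset 11 (.get 13 (.reg 12)),
     .iput 13 (.reg 12) (.const 0),
     .ite (.rlt (.get 3 (.reg 11)) (.get 3 (.reg 10)))
       (.block [.iset 13 (.reg 10), .iset 10 (.reg 11), .iset 11 (.reg 13)]) .skip,
     .iput 11 (.reg 11) (.get 10 (.reg 10)),
     .iput 10 (.reg 10) (.reg 11),
     .iset 12 (.succ (.reg 12)),
     .iput 9 (.reg 10) (.reg 12)])

/-- Empty the stack: replace hollow roots by their children, and link full ones. -/
def emptyStack : Cmd :=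
  .loop (.ilt (.const 0) (.reg 8)) (.block
    [.iset 8 (.pred (.reg 8)),
     .iset 10 (.get 12 (.reg 8)),
     .ite (.ieq (.get 8 (.reg 10)) (.const 0))
       (.block [.iset 13 (.get 10 (.reg 10)), pushList])
       (.block
         [.iset 12 (.get 9 (.reg 10)),
          linkRoots,
          .iput 13 (.reg 12) (.reg 10),
          .ite (.ilt (.reg 9) (.reg 12)) (.iset 9 (.reg 12)) .skip])])

/-- Find the root of minimum key in the slot array and push the others back onto the stack. -/
def scanSlots : Cmd :=
  .block
    [.iset 14 (.const 0),
     .iset 15 (.const 0),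
     .loop (.not (.ilt (.reg 9) (.reg 14))) (.block
      [.iset 10 (.get 13 (.reg 14)),
       .ite (.ilt (.const 0) (.reg 10))
         (.block
           [.iput 13 (.reg 14) (.const 0),
            .ite (.ieq (.reg 15) (.const 0)) (.iset 15 (.reg 10))
              (.block
                [.ite (.rlt (.get 3 (.reg 10)) (.get 3 (.reg 15)))
                  (.block [.iset 13 (.reg 15), .iset 15 (.reg 10), .iset 10 (.reg 13)]) .skip,
                 .iput 12 (.reg 8) (.reg 10), .iset 8 (.succ (.reg 8))])])
         .skip,
       .iset 14 (.succ (.reg 14))])]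

/-- Delete the item of minimum key; register `16` receives the item, and register `15` becomes `0`
if there was none. -/
def deleteMin : Cmd :=
  .block
    [emptyStack, scanSlots,
     .ite (.ilt (.const 0) (.reg 15))
       (.block
         [.iset 16 (.pred (.get 8 (.reg 15))), .iset 13 (.get 10 (.reg 15)), pushList])
       .skip]

/-- Insert the vertex in register `17`, or decrease its key, to its entry in real array `2`. -/
def decreaseKey : Cmd :=
  .block
    [.iset 7 (.succ (.reg 7)),
     .iset 10 (.get 7 (.reg 17)),
     .iset 13 (.get 11 (.get 10 (.reg 10))),
     .iput 8 (.reg 7) (.succ (.reg 17)),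
     .rput 3 (.reg 7) (.get 2 (.reg 17)),
     .iput 9 (.reg 7) (.pred (.pred (.get 9 (.reg 10)))),
     .iput 10 (.reg 7) (.get 11 (.reg 13)),
     .iput 11 (.reg 13) (.const 0),
     .iput 8 (.reg 10) (.const 0),
     .iput 7 (.reg 17) (.reg 7),
     .iput 12 (.reg 8) (.reg 7),
     .iset 8 (.succ (.reg 8))]

theorem pushList_spec {σ : State} {l : List ℕ} (h : Linked (σ.iarr 11) (σ.ireg 13) l) :
    WP pushList σ fun t τ =>
      contents (τ.iarr 12) (τ.ireg 8) = contents (σ.iarr 12) (σ.ireg 8) ++ l ∧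
      τ.ireg 8 = σ.ireg 8 + l.length ∧ Frame pushList.writes σ τ ∧ t ≤ 13 * l.length + 3 := by
  refine (wp_loop (σ₀ := σ) (φ₀ := 13 * l.length) (fun τ φ => ∃ l₁ l₂, l = l₁ ++ l₂ ∧
    Linked (σ.iarr 11) (τ.ireg 13) l₂ ∧
    contents (τ.iarr 12) (τ.ireg 8) = contents (σ.iarr 12) (σ.ireg 8) ++ l₁ ∧
    τ.ireg 8 = σ.ireg 8 + l₁.length ∧ φ = 13 * l₂.length)
    ⟨[], l, rfl, h, by simp, by simp, rfl⟩ ?_).mono ?_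
  · rintro τ φ ⟨l₁, l₂, rfl, hl, hc, hn, rfl⟩ hF hb
    simp only [BExpr.holds, IExpr.eval] at hb
    obtain ⟨l', rfl, hl'⟩ := exists_cons_of_linked hl hb.ne'
    have e11 := hF.iarr 11 (by decide)
    refine WP.of_forall fun Q hQ => ?_
    simp
    refine hQ _ _ ⟨_, ⟨l₁ ++ [τ.ireg 13], l', by simp, ?_, ?_, ?_, rfl⟩, ?_⟩
    · simpa [e11] using hl'
    · simp [contents_push, hc]
    · simp; omega
    · simp; omega
  · rintro t τ ⟨φ, ⟨l₁, l₂, rfl, hl, hc, hn, rfl⟩, hb, hF, ht⟩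
    simp at hb ht
    rw [hb] at hl
    obtain rfl := linked_zero hl
    refine ⟨by simpa using hc, by simpa using hn, hF, ?_⟩
    simp at ht ⊢
    omega

/-- Each link empties one slot, and the 60 units stored for that slot pay for the round. The winner
keeps a nonzero item, as both roots are full. -/
theorem linkRoots_spec (h : Core σ M H kf p P (σ.ireg 10 :: S) R)
    (hr : σ.ireg 12 = σ.iarr 9 (σ.ireg 10)) (hi : σ.iarr 8 (σ.ireg 10) ≠ 0) :
    WP linkRoots σ fun t τ => ∃ p' R', Core τ M H kf p' P (τ.ireg 10 :: S) R' ∧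
      τ.ireg 12 = τ.iarr 9 (τ.ireg 10) ∧ τ.iarr 8 (τ.ireg 10) ≠ 0 ∧
      τ.iarr 13 (τ.ireg 12) = 0 ∧ Frame linkRoots.writes σ τ ∧
      t + 60 * R'.card ≤ 60 * R.card + 4 := by
  refine (wp_loop (σ₀ := σ) (φ₀ := 60 * R.card) (fun τ φ => ∃ p' R',
    Core τ M H kf p' P (τ.ireg 10 :: S) R' ∧
      τ.ireg 12 = τ.iarr 9 (τ.ireg 10) ∧ τ.iarr 8 (τ.ireg 10) ≠ 0 ∧ φ = 60 * R'.card)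
    ⟨p, R, h, hr, hi, rfl⟩ ?_).mono ?_
  · rintro τ φ ⟨p', R', h, hr, hi, rfl⟩ hF hb
    simp only [BExpr.holds, IExpr.eval] at hb
    have hR := (h.mem_slots _).2 hb.ne'
    obtain ⟨s1, s2, s3, s4⟩ := h.slots _ hR
    have hne : τ.ireg 10 ≠ τ.iarr 13 (τ.ireg 12) := by
      intro e
      rw [← e] at s3
      simp at s3
    have hcard := Finset.card_erase_add_one hR
    refine WP.of_forall fun Q hQ => ?_
    simp
    constructor
    · intro hlt
      refine hQ _ _ ⟨_, ⟨_, _, h.link (a := τ.iarr 13 (τ.ireg 12)) (b := τ.ireg 10) hi hb.ne'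
        (by rw [hr]) (Or.inr ⟨rfl, rfl⟩) hlt.le ?_ ?_ ?_ ?_ ?_ ?_ ?_ ?_ ?_, ?_, ?_, rfl⟩, ?_⟩
      all_goals simp [← hr]
      · exact s2
      · omega
    · intro hlt
      refine hQ _ _ ⟨_, ⟨_, _, h.link (b := τ.iarr 13 (τ.ireg 12)) (a := τ.ireg 10) hi hb.ne'
        (by rw [hr]) (Or.inl ⟨rfl, rfl⟩) hlt ?_ ?_ ?_ ?_ ?_ ?_ ?_ ?_ ?_, ?_, ?_, rfl⟩, ?_⟩
      all_goals simp [← hr]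
      · exact hi
      · omega
  · rintro t τ ⟨φ, ⟨p', R', h, hr, hi, rfl⟩, hb, hF, ht⟩
    simp at hb ht
    exact ⟨p', R', h, hr, hi, hb, hF, ht⟩

/-- The number of hollow nodes. -/
def hollows (σ : State) (P : Finset ℕ) : ℕ := (P.filter fun x => σ.iarr 8 x = 0).card

/-- The potential is 120 per stack entry, 60 per occupied slot and 300 per hollow node. Destroying a
hollow root releases 300, enough to push its at most two children. A popped full root releases 120,
which covers its own handling and the 60 units for the slot it fills; the links are paid by the
slots they empty. -/
theorem emptyStack_spec (h : Core σ M H kf p P (contents (σ.iarr 12) (σ.ireg 8)) R)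
    (hM : σ.ireg 7 ≤ M) :
    WP emptyStack σ fun t τ => ∃ p' P' R', Core τ M H kf p' P' [] R' ∧ τ.ireg 8 = 0 ∧
      Frame emptyStack.writes σ τ ∧
      t + 60 * R'.card + 300 * hollows τ P' ≤
        120 * σ.ireg 8 + 60 * R.card + 300 * hollows σ P + 3 := by
  refine (wp_loop (σ₀ := σ) (φ₀ := 120 * σ.ireg 8 + 60 * R.card + 300 * hollows σ P)
    (fun τ φ => ∃ p' P' R', Core τ M H kf p' P' (contents (τ.iarr 12) (τ.ireg 8)) R' ∧
      φ = 120 * τ.ireg 8 + 60 * R'.card + 300 * hollows τ P')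
    ⟨p, P, R, h, rfl⟩ ?_).mono ?_
  · rintro τ φ ⟨p', P', R', h, rfl⟩ hF hb
    simp only [BExpr.holds, IExpr.eval] at hb
    obtain ⟨c, hc⟩ : ∃ c, τ.ireg 8 = c + 1 := ⟨τ.ireg 8 - 1, by omega⟩
    have hM' : τ.ireg 7 ≤ M := by rw [hF.ireg 7 (by decide)]; exact hM
    have h1 : Core τ M H kf p' P' (τ.iarr 12 c :: contents (τ.iarr 12) c) R' := by
      refine h.perm ?_
      rw [hc, contents_succ]
      exact List.perm_append_singleton _ _
    have hx := (h1.roots (τ.iarr 12 c)).2 (Or.inl (by simp))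
    refine WP.of_forall fun Q hQ => ?_
    simp [hc]
    constructor
    · intro hi
      obtain ⟨l, q1, q2, q3, q4, q5⟩ := h1.shape.exists_children hx.1
      refine (pushList_spec (l := l) (by simpa using q1)).mono ?_
      rintro t υ ⟨r1, r2, r3, r4⟩
      have hcard : hollows υ (P'.erase (τ.iarr 12 c)) + 1 = hollows τ P' := by
        have e8 := r3.iarr 8 (by decide)
        simp at e8
        rw [hollows, hollows, e8, Finset.filter_erase,
          Finset.card_erase_add_one (by simp [hx.1, hi])]
      have hcore := h1.destroy (τ := υ) q2 q3 (H' := H) (by intro v; simp [hi])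
        (by simpa using r3.iarr 7 (by decide)) (by simpa using r3.iarr 8 (by decide))
        (by simpa using r3.iarr 9 (by decide)) (by simpa using r3.iarr 10 (by decide))
        (by simpa using r3.iarr 11 (by decide)) (by simpa using r3.iarr 13 (by decide))
        (by simpa using r3.rarr 3 (by decide)) (by simpa using r3.ireg 7 (by decide))
        (by simpa using r3.ireg 9 (by decide))
      refine hQ _ _ ⟨_, ⟨_, _, _, by rw [r1]; simpa using hcore, rfl⟩, ?_⟩
      have := q5 hi
      simp at r2 ⊢
      omega
    · intro hi
      have h2 : Core (((τ.iset 8 c).iset 10 (τ.iarr 12 c)).iset 12 (τ.iarr 9 (τ.iarr 12 c)))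
          M H kf p' P' (τ.iarr 12 c :: contents (τ.iarr 12) c) R' := by
        constructor
        all_goals try simp
        exacts [h1.shape, h1.null_child, h1.null_next, h1.null_rk, h1.le_count, h1.fib_le, h1.full,
          h1.node_mem, h1.item_node, h1.key_node, by simpa using h1.nodup, by simpa using h1.roots,
          by simpa using h1.mem_slots, by simpa using h1.slots]
      refine (linkRoots_spec (S := contents (τ.iarr 12) c) (by simpa using h2) (by simp)
        (by simpa using hi)).mono ?_
      rintro t υ ⟨p'', R'', r1, r2, r3, r4, r5, r6⟩
      have e8 : υ.iarr 8 = τ.iarr 8 := by simpa using r5.iarr 8 (by decide)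
      have e12 : υ.iarr 12 = τ.iarr 12 := by simpa using r5.iarr 12 (by decide)
      have e7 : υ.ireg 7 = τ.ireg 7 := by simpa using r5.ireg 7 (by decide)
      have ec : υ.ireg 8 = c := by simpa using r5.ireg 8 (by decide)
      have hh : hollows υ P' = hollows τ P' := by rw [hollows, hollows, e8]
      have hcard : (insert (υ.ireg 12) R'').card ≤ R''.card + 1 := Finset.card_insert_le _ _
      rw [r2] at hcard
      constructor
      · intro hlt
        refine hQ _ _ ⟨_, ⟨p'', P', insert (υ.iarr 9 (υ.ireg 10)) R'', ?_, rfl⟩, ?_⟩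
        · simp [e12, ec]
          refine r1.place (by omega) r3 (by rw [← r2]; exact r4) ?_ ?_ ?_ ?_ ?_ ?_ ?_ ?_ ?_
          all_goals simp [r2]
          rw [r2] at hlt
          omega
        · simp [hollows, ec] at hh ⊢
          omega
      · intro hlt
        refine hQ _ _ ⟨_, ⟨p'', P', insert (υ.iarr 9 (υ.ireg 10)) R'', ?_, rfl⟩, ?_⟩
        · simp [e12, ec]
          refine r1.place (by omega) r3 (by rw [← r2]; exact r4) ?_ ?_ ?_ ?_ ?_ ?_ ?_ ?_ ?_
          all_goals simp [r2]
          rw [r2] at hlt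
          omega
        · simp [hollows, ec] at hh ⊢
          omega
  · rintro t τ ⟨φ, ⟨p', P', R', h, rfl⟩, hb, hF, ht⟩
    simp at hb ht
    rw [hb, contents_zero] at h
    refine ⟨p', P', R', h, hb, hF, ?_⟩
    omega

/-- Registers that a core does not depend on. -/
theorem Core.congr (h : Core σ M H kf p P S R)
    (e7 : τ.iarr 7 = σ.iarr 7) (e8 : τ.iarr 8 = σ.iarr 8) (e9 : τ.iarr 9 = σ.iarr 9)
    (e10 : τ.iarr 10 = σ.iarr 10) (e11 : τ.iarr 11 = σ.iarr 11) (e13 : τ.iarr 13 = σ.iarr 13)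
    (ek : τ.rarr 3 = σ.rarr 3) (eN : τ.ireg 7 = σ.ireg 7) (er : τ.ireg 9 = σ.ireg 9) :
    Core τ M H kf p P S R := by
  constructor
  · rw [e8, e9, e10, e11, ek]; exact h.shape
  · rw [e10]; exact h.null_child
  · rw [e11]; exact h.null_next
  · rw [e9]; exact h.null_rk
  · rw [eN]; exact h.le_count
  · rw [er]; exact h.fib_le
  · rw [e7, e8]; exact h.full
  · rw [e7]; exact h.node_mem
  · rw [e7, e8]; exact h.item_node
  · rw [e7, ek]; exact h.key_node
  · exact h.nodup
  · rw [e9, e13]; exact h.roots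
  · rw [e13]; exact h.mem_slots
  · rw [e8, e9, e13, er]; exact h.slots

/-- The best root so far, in register 15, is in neither stack nor slot array, so it is prepended to
the list of loose roots; 0 means that no root has been met, and then nothing has been pushed. Its
rank bound is kept in order to bound the number of children later. -/
theorem scanSlots_spec (h : Core σ M H kf p P [] R) (hc : σ.ireg 8 = 0) :
    WP scanSlots σ fun t τ =>
      Core τ M H kf p P (if τ.ireg 15 = 0 then contents (τ.iarr 12) (τ.ireg 8) else
        τ.ireg 15 :: contents (τ.iarr 12) (τ.ireg 8)) ∅ ∧
      (τ.ireg 15 = 0 → τ.ireg 8 = 0) ∧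
      (τ.ireg 15 ≠ 0 → τ.iarr 8 (τ.ireg 15) ≠ 0 ∧ τ.iarr 9 (τ.ireg 15) ≤ τ.ireg 9 ∧
        ∀ y ∈ contents (τ.iarr 12) (τ.ireg 8), τ.rarr 3 (τ.ireg 15) ≤ τ.rarr 3 y) ∧
      τ.ireg 8 ≤ σ.ireg 9 + 1 ∧ t ≤ 100 * (σ.ireg 9 + 1) + 100 := by
  rw [scanSlots, wp_block_cons, wp_iset, wp_block_cons, wp_iset, wp_block_cons]
  refine (wp_loop (φ₀ := 100 * (σ.ireg 9 + 1)) (fun τ φ => ∃ R',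
    Core τ M H kf p P (if τ.ireg 15 = 0 then contents (τ.iarr 12) (τ.ireg 8) else
      τ.ireg 15 :: contents (τ.iarr 12) (τ.ireg 8)) R' ∧
    (τ.ireg 15 = 0 → τ.ireg 8 = 0) ∧
    (τ.ireg 15 ≠ 0 → τ.iarr 8 (τ.ireg 15) ≠ 0 ∧ τ.iarr 9 (τ.ireg 15) ≤ τ.ireg 9 ∧
      ∀ y ∈ contents (τ.iarr 12) (τ.ireg 8), τ.rarr 3 (τ.ireg 15) ≤ τ.rarr 3 y) ∧
    τ.ireg 8 ≤ τ.ireg 14 ∧ τ.ireg 14 ≤ σ.ireg 9 + 1 ∧ (∀ r ∈ R', τ.ireg 14 ≤ r) ∧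
    φ = 100 * (σ.ireg 9 + 1 - τ.ireg 14)) ?_ ?_).mono ?_
  · refine ⟨R, ?_, ?_⟩
    · simp [hc, contents_zero]
      refine h.congr ?_ ?_ ?_ ?_ ?_ ?_ ?_ ?_ ?_ <;> simp
    · simp [hc]
  · rintro τ φ ⟨R', h, h1, h2, h3, h4, h5, rfl⟩ hF hb
    have e9 : τ.ireg 9 = σ.ireg 9 := by simpa using hF.ireg 9 (by decide)
    simp [e9] at hb
    refine WP.of_forall fun Q hQ => ?_
    simp
    constructor
    · intro hx
      have hR := (h.mem_slots _).2 hx.ne'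
      obtain ⟨s1, s2, s3, s4⟩ := h.slots _ hR
      have hu := h.unplace (τ := ((τ.iset 10 (τ.iarr 13 (τ.ireg 14))).iput 13 (τ.ireg 14) 0)) hx.ne'
        (by simp) (by simp) (by simp) (by simp) (by simp) (by simp) (by simp) (by simp) (by simp)
      have hR' : ∀ r ∈ R'.erase (τ.ireg 14), τ.ireg 14 + 1 ≤ r := by
        intro r hr
        rw [Finset.mem_erase] at hr
        have := h5 r hr.2
        omega
      refine ⟨fun h0 => ?_, fun h0 => ⟨fun hlt => ?_, fun hlt => ?_⟩⟩
      · refine hQ _ _ ⟨_, ⟨R'.erase (τ.ireg 14), ?_, ?_, ?_, ?_, ?_, ?_, rfl⟩, ?_⟩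
        · simp [hx.ne', h0] at hu ⊢
          refine hu.congr ?_ ?_ ?_ ?_ ?_ ?_ ?_ ?_ ?_ <;> simp
        · simp [hx.ne']
        · simp [h1 h0, contents_zero, s1, s2, s4]
        · simp; omega
        · simp; omega
        · simpa using hR'
        · simp; omega
      · obtain ⟨g1, g2, g3⟩ := h2 h0
        refine hQ _ _ ⟨_, ⟨R'.erase (τ.ireg 14), ?_, ?_, ?_, ?_, ?_, ?_, rfl⟩, ?_⟩
        · simp [hx.ne', h0] at hu ⊢
          refine (hu.perm (S' := _) ?_).congr ?_ ?_ ?_ ?_ ?_ ?_ ?_ ?_ ?_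
          rotate_left
          iterate 9 simp
          rw [contents_push]
          exact (List.perm_append_singleton _ _).symm.cons _
        · simp [hx.ne']
        · simp [s1, s2, s4, contents_push]
          rintro - y (hy | rfl)
          exacts [hlt.le.trans (g3 y hy), hlt.le]
        · simp; omega
        · simp; omega
        · simpa using hR'
        · simp; omega
      · obtain ⟨g1, g2, g3⟩ := h2 h0
        refine hQ _ _ ⟨_, ⟨R'.erase (τ.ireg 14), ?_, ?_, ?_, ?_, ?_, ?_, rfl⟩, ?_⟩
        · simp [h0] at hu ⊢
          refine (hu.perm (S' := _) ?_).congr ?_ ?_ ?_ ?_ ?_ ?_ ?_ ?_ ?_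
          rotate_left
          iterate 9 simp
          rw [contents_push]
          exact (List.Perm.swap _ _ _).trans ((List.perm_append_singleton _ _).symm.cons _)
        · simp [h0]
        · simp [g1, g2, contents_push]
          rintro - y (hy | rfl)
          exacts [g3 y hy, hlt]
        · simp; omega
        · simp; omega
        · simpa using hR'
        · simp; omega
    · intro hx
      refine hQ _ _ ⟨_, ⟨R', ?_, ?_, ?_, ?_, ?_, ?_, rfl⟩, ?_⟩
      · simp
        refine h.congr ?_ ?_ ?_ ?_ ?_ ?_ ?_ ?_ ?_ <;> simp
      · simpa using h1
      · simpa using h2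
      · simp; omega
      · simp; omega
      · intro r hr
        have := h5 r hr
        have hr' : r ≠ τ.ireg 14 := by
          rintro rfl
          exact (h.mem_slots _).1 hr hx
        simp
        omega
      · simp; omega
  · rintro t τ ⟨φ, ⟨R', h, h1, h2, h3, h4, h5, rfl⟩, hb, hF, ht⟩
    have e9 : τ.ireg 9 = σ.ireg 9 := by simpa using hF.ireg 9 (by decide)
    simp [e9] at hb
    -- Remaining ranks are at least register 14, which now exceeds register 9, the bound on all
    -- occupied ranks.
    have hR : R' = ∅ := by
      rw [Finset.eq_empty_iff_forall_notMem]
      intro r hr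
      have := h5 r hr
      have := (h.slots r hr).2.2.2
      omega
    subst hR
    simp at ht ⊢
    exact ⟨h, h1, by simpa using h2, by omega, by omega⟩

/-- The memory `σ` holds a hollow heap with items `H`, keys `kf` and potential `φ`. -/
def IsHeap (σ : State) (M : ℕ) (H : Finset ℕ) (kf : ℕ → ℝ) (φ : ℕ) : Prop :=
  ∃ p P, Core σ M H kf p P (contents (σ.iarr 12) (σ.ireg 8)) ∅ ∧
    φ = 120 * σ.ireg 8 + 300 * hollows σ P

/-- The null node is unused and the slot array is empty. -/
structure Clean (σ : State) : Prop where
  null_rk : σ.iarr 9 0 = 0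
  null_child : σ.iarr 10 0 = 0
  null_next : σ.iarr 11 0 = 0
  slots : ∀ r, σ.iarr 13 r = 0

theorem Core.clean (h : Core σ M H kf p P S ∅) : Clean σ where
  null_rk := h.null_rk
  null_child := h.null_child
  null_next := h.null_next
  slots r := by
    by_contra hr
    simpa using (h.mem_slots r).2 hr

theorem Clean.congr (h : Clean σ) (e9 : τ.iarr 9 = σ.iarr 9) (e10 : τ.iarr 10 = σ.iarr 10)
    (e11 : τ.iarr 11 = σ.iarr 11) (e13 : τ.iarr 13 = σ.iarr 13) : Clean τ := by
  constructor
  · rw [e9]; exact h.null_rk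
  · rw [e10]; exact h.null_child
  · rw [e11]; exact h.null_next
  · rw [e13]; exact h.slots

/-- A heap without nodes constrains only the null node and the slot array. Old node records need not
be erased between runs: allocation overwrites all fields but `next`, which is not constrained at a
root. -/
theorem Clean.isHeap (h : Clean σ) (h8 : σ.ireg 8 = 0) (h9 : σ.ireg 9 = 0)
    (hM : 1 ≤ M) (kf : ℕ → ℝ) : IsHeap σ M ∅ kf 0 := by
  refine ⟨fun _ => 0, ∅, ?_, by simp [h8, hollows]⟩
  rw [h8, contents_zero]
  constructor
  · constructor <;> simp
  · exact h.null_child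
  · exact h.null_next
  · exact h.null_rk
  · simp
  · simpa [h9] using hM
  · simp
  · simp
  · simp
  · simp
  · simp
  · intro x
    simp [h.slots, eq_comm]
  · simp [h.slots]
  · simp

/-- `L` bounds every rank in sight, hence the slots scanned, the roots pushed back and the children
of the deleted root; these account for the term in `L`. Emptying the stack is paid by the potential.
By heap order the least root is the global minimum. -/
theorem deleteMin_spec {φ L : ℕ} (h : IsHeap σ M H kf φ) (hM : σ.ireg 7 ≤ M)
    (hL : ∀ r, Nat.fib (r + 1) ≤ M → r ≤ L) :
    WP deleteMin σ fun t τ => ∃ φ', t + φ' ≤ φ + 400 * L + 500 ∧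
      (τ.ireg 15 = 0 → H = ∅ ∧ Clean τ) ∧
      (τ.ireg 15 ≠ 0 → τ.ireg 16 ∈ H ∧ (∀ v ∈ H, kf (τ.ireg 16) ≤ kf v) ∧
        IsHeap τ M (H.erase (τ.ireg 16)) kf φ') := by
  obtain ⟨p, P, h, rfl⟩ := h
  rw [deleteMin, wp_block_cons]
  refine (emptyStack_spec h hM).mono ?_
  rintro t₁ σ₁ ⟨p, P', R, h1, h2, h3, h4⟩
  rw [wp_block_cons]
  refine (scanSlots_spec h1 h2).frame.mono ?_
  rintro t₂ σ₂ ⟨⟨g1, g2, g3, g4, g6⟩, g5⟩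
  have e9 : σ₂.ireg 9 = σ₁.ireg 9 := g5.ireg 9 (by decide)
  have e8 : σ₂.iarr 8 = σ₁.iarr 8 := g5.iarr 8 (by decide)
  have hr := hL _ h1.fib_le
  simp at h4
  refine WP.of_forall fun Q hQ => ?_
  simp
  constructor
  · intro hb
    rw [if_neg hb.ne'] at g1
    obtain ⟨g31, g32, g33⟩ := g3 hb.ne'
    have hx := (g1.roots (σ₂.ireg 15)).2 (Or.inl (by simp))
    obtain ⟨l, q1, q2, q3, q4, q5⟩ := g1.shape.exists_children hx.1
    refine (pushList_spec (l := l) (by simpa using q1)).mono ?_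
    rintro t₃ σ₃ ⟨r1, r2, r3, r4⟩
    obtain ⟨f1, f2⟩ := g1.full _ hx.1 g31
    have hcore := g1.destroy (τ := σ₃) (H' := H.erase (σ₂.iarr 8 (σ₂.ireg 15) - 1)) q2 q3
      (by intro v; rw [Finset.mem_erase]; constructor
          · rintro ⟨a, b⟩; exact ⟨b, by omega⟩
          · rintro ⟨a, b⟩; exact ⟨by omega, a⟩)
      (by simpa using r3.iarr 7 (by decide)) (by simpa using r3.iarr 8 (by decide))
      (by simpa using r3.iarr 9 (by decide)) (by simpa using r3.iarr 10 (by decide))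
      (by simpa using r3.iarr 11 (by decide)) (by simpa using r3.iarr 13 (by decide))
      (by simpa using r3.rarr 3 (by decide)) (by simpa using r3.ireg 7 (by decide))
      (by simpa using r3.ireg 9 (by decide))
    have e15 : σ₃.ireg 15 = σ₂.ireg 15 := by simpa using r3.ireg 15 (by decide)
    have e16 : σ₃.ireg 16 = σ₂.iarr 8 (σ₂.ireg 15) - 1 := by simpa using r3.ireg 16 (by decide)
    have e8' : σ₃.iarr 8 = σ₂.iarr 8 := by simpa using r3.iarr 8 (by decide)
    have hh : hollows σ₃ (P'.erase (σ₂.ireg 15)) ≤ hollows σ₁ P' := by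
      rw [hollows, hollows, e8', e8]
      exact Finset.card_le_card (Finset.filter_subset_filter _ (Finset.erase_subset _ _))
    refine hQ _ _ ⟨_, ?_, ?_, fun _ => ⟨?_, ?_, _, _, by rw [e16, r1]; simpa using hcore, rfl⟩⟩
    · simp at r2
      omega
    · intro h0; omega
    · rw [e16]; exact f1
    · rw [e16]
      intro v hv
      rw [← g1.key_node v hv, ← g1.key_node _ f1, f2]
      refine g1.shape.le_key ?_ _ (g1.node_mem v hv)
      intro y hy hpy
      rcases (g1.roots y).1 ⟨hy, hpy⟩ with hm | hm
      · rcases List.mem_cons.1 hm with rfl | hm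
        exacts [le_rfl, g33 y hm]
      · have := (g1.mem_slots (σ₂.iarr 9 y)).2 (by omega)
        simp at this
  · intro h0
    refine hQ _ _ ⟨0, ?_, ?_, ?_⟩
    · omega
    · intro _
      rw [if_pos h0, g2 h0, contents_zero] at g1
      refine ⟨?_, g1.clean⟩
      rw [Finset.eq_empty_iff_forall_notMem]
      intro v hv
      have hr : ∀ y ∈ P', p y ≠ 0 := by
        intro y hy hp
        rcases (g1.roots y).1 ⟨hy, hp⟩ with hm | hm
        · simp at hm
        · have := (g1.mem_slots (σ₂.iarr 9 y)).2 (by omega)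
          simp at this
      have hv' := g1.node_mem v hv
      -- Without roots, any `μ` bounds the root keys vacuously; a value above the key of an existing
      -- node is a contradiction.
      have := g1.shape.le_key (μ := σ₂.rarr 3 (σ₂.iarr 7 v) + 1)
        (fun y hy hp => absurd hp (hr y hy)) _ hv'
      linarith
    · intro h; exact absurd h0 h

/-- The operation adds one stack entry and at most one hollow node, 420 units of potential; 500 also
covers the steps. An entry 0 in integer array 7 makes the null node the old node, which turns a
decrease into an insertion. -/
theorem decreaseKey_spec {φ v : ℕ} (h : IsHeap σ M H kf φ) (hv' : σ.ireg 17 = v)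
    (hv : v ∈ H ∧ σ.rarr 2 v ≤ kf v ∨ v ∉ H ∧ σ.iarr 7 v = 0) :
    WP decreaseKey σ fun t τ => ∃ φ', t + φ' ≤ φ + 500 ∧
      IsHeap τ M (insert v H) (Function.update kf v (σ.rarr 2 v)) φ' ∧
      τ.ireg 7 = σ.ireg 7 + 1 ∧ τ.iarr 7 = Function.update (σ.iarr 7) v (σ.ireg 7 + 1) := by
  subst hv'
  obtain ⟨p, P, h, rfl⟩ := h
  have hN : ∀ x, x ∈ P → x ≠ σ.ireg 7 + 1 := fun x hx => by have := h.le_count x hx; omega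
  have hu : σ.iarr 7 (σ.ireg 17) ≠ σ.ireg 7 + 1 := by
    rcases hv with ⟨a, -⟩ | ⟨-, a⟩
    · exact hN _ (h.node_mem _ a)
    · omega
  refine WP.of_forall fun Q hQ => ?_
  simp [decreaseKey]
  obtain ⟨p', hp'⟩ := h.update (k := σ.rarr 2 (σ.ireg 17)) hv
    (τ := ((((((((((((σ.iset 7 (σ.ireg 7 + 1)).iset 10 (σ.iarr 7 (σ.ireg 17))).iset 13
      (σ.iarr 11 (σ.iarr 10 (σ.iarr 7 (σ.ireg 17))))).iput 8 (σ.ireg 7 + 1) (σ.ireg 17 + 1)).rput 3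
      (σ.ireg 7 + 1) (σ.rarr 2 (σ.ireg 17))).iput 9 (σ.ireg 7 + 1)
      (σ.iarr 9 (σ.iarr 7 (σ.ireg 17)) - 1 - 1)).iput 10 (σ.ireg 7 + 1)
      (σ.iarr 11 (σ.iarr 11 (σ.iarr 10 (σ.iarr 7 (σ.ireg 17)))))).iput 11
      (σ.iarr 11 (σ.iarr 10 (σ.iarr 7 (σ.ireg 17)))) 0).iput 8 (σ.iarr 7 (σ.ireg 17)) 0).iput 7
      (σ.ireg 17) (σ.ireg 7 + 1)).iput 12 (σ.ireg 8) (σ.ireg 7 + 1)).iset 8 (σ.ireg 8 + 1)))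
    (by simp) (by simp) (by simp) (by simp) (by simp) (by simp) (by simp) (by simp) (by simp)
  refine hQ _ _ ⟨_, ?_, ⟨p', insert (σ.ireg 7 + 1) P, ?_, rfl⟩, by simp, by simp⟩
  · have hh : ∀ τ : State, τ.iarr 8 = Function.update (Function.update (σ.iarr 8) (σ.ireg 7 + 1)
        (σ.ireg 17 + 1)) (σ.iarr 7 (σ.ireg 17)) 0 →
        hollows τ (insert (σ.ireg 7 + 1) P) ≤ hollows σ P + 1 := by
      intro τ hτ
      rw [hollows, hollows, hτ]
      refine le_trans (Finset.card_le_card (t := insert (σ.iarr 7 (σ.ireg 17))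
        (P.filter fun x => σ.iarr 8 x = 0)) ?_) (Finset.card_insert_le _ _)
      intro x hx
      rw [Finset.mem_filter, Finset.mem_insert] at hx
      rw [Finset.mem_insert, Finset.mem_filter]
      by_cases hxu : x = σ.iarr 7 (σ.ireg 17)
      · exact Or.inl hxu
      · obtain ⟨hx, hi⟩ := hx
        rw [Function.update_of_ne hxu] at hi
        rcases hx with rfl | hx
        · simp at hi
        · rw [Function.update_of_ne (hN x hx)] at hi
          exact Or.inr ⟨hx, hi⟩
    refine (Nat.add_le_add_left (Nat.add_le_add_left (Nat.mul_le_mul_left 300 (hh _ ?_)) _)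
      _).trans ?_
    · simp
    · simp
      omega
  · simp only [iset_iarr, iput_iarr, rput_iarr, iset_ireg, iput_ireg, rput_ireg,
      Function.update_self, contents_push] at hp' ⊢
    simpa [contents_push] using hp'

end HollowHeap

/-! ## Dijkstra's algorithm with several sources -/

/-- A network: edge `e < m` goes from `tl e` to `hd e` and has length `len e`; only the edges whose
head has level more than `j` are used. The vertices `v` in `seeds` start with label `init v`. -/
structure Net where
  n : ℕ
  m : ℕ
  j : ℕ
  tl : ℕ → ℕ
  hd : ℕ → ℕ
  lev : ℕ → ℕ
  len : ℕ → ℝ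
  seeds : Finset ℕ
  init : ℕ → ℝ

namespace Net

structure Valid (G : Net) : Prop where
  hd_lt : ∀ e < G.m, G.hd e < G.n
  len_nonneg : ∀ e < G.m, G.j ≤ G.lev (G.tl e) → G.j < G.lev (G.hd e) → 0 ≤ G.len e

/-- The invariant of Dijkstra's algorithm. The vertices in `D` are finished, in the order given by
`ord`; those in `H` are labelled but not finished; the edges in `E` have been relaxed. -/
structure Inv (G : Net) (D H : Finset ℕ) (ord : ℕ → ℕ) (d : ℕ → ℝ) (par : ℕ → ℕ)
    (E : Finset ℕ) : Prop where
  disj : ∀ v ∈ H, v ∉ D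
  lt : ∀ v ∈ D ∪ H, v < G.n
  lev_le : ∀ v ∈ D ∪ H, G.j ≤ G.lev v
  mono : ∀ u ∈ D, ∀ v ∈ H, d u ≤ d v
  seed_mem : ∀ v ∈ G.seeds, v ∈ D ∪ H
  seed_le : ∀ v ∈ G.seeds, d v ≤ G.init v
  edge_lt : ∀ e ∈ E, e < G.m
  edge_tl : ∀ e ∈ E, G.tl e ∈ D
  edge_hd : ∀ e ∈ E, G.j < G.lev (G.hd e) → G.hd e ∈ D ∪ H
  edge_le : ∀ e ∈ E, G.j < G.lev (G.hd e) → d (G.hd e) ≤ d (G.tl e) + G.len e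
  origin : ∀ v ∈ D ∪ H, (v ∈ G.seeds ∧ d v = G.init v ∧ par v = 0) ∨
    ∃ e < G.m, G.tl e ∈ D ∧ G.hd e = v ∧ G.j < G.lev v ∧ par v = G.tl e + 1 ∧
      d v = d (G.tl e) + G.len e ∧ (v ∈ D → ord (G.tl e) < ord v)
  ord_lt : ∀ v ∈ D, ord v < D.card
  unseen : ∀ v < G.n, v ∉ D ∪ H → par v = 0

variable {G : Net} {D H E : Finset ℕ} {ord : ℕ → ℕ} {d : ℕ → ℝ} {par : ℕ → ℕ}

/-- Minimality of `d u` in `H` preserves the separation of finished and unfinished labels. Numbering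
`u` by the current size of `D` puts it after its parent; labels alone cannot orient the tree, as
edges may have length 0. -/
theorem Inv.finish (h : G.Inv D H ord d par E) {u : ℕ} (hu : u ∈ H) (hmin : ∀ v ∈ H, d u ≤ d v) :
    G.Inv (insert u D) (H.erase u) (Function.update ord u D.card) d par E := by
  have huD := h.disj u hu
  have hun : insert u D ∪ H.erase u = D ∪ H := by
    ext v
    simp only [Finset.mem_union, Finset.mem_insert, Finset.mem_erase]
    by_cases hv : v = u <;> simp [hv, hu]
  constructor
  · intro v hv
    rw [Finset.mem_erase] at hv
    rw [Finset.mem_insert, not_or]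
    exact ⟨hv.1, h.disj v hv.2⟩
  · rw [hun]; exact h.lt
  · rw [hun]; exact h.lev_le
  · intro v hv w hw
    rcases Finset.mem_insert.1 hv with rfl | hv
    · exact hmin w (Finset.mem_of_mem_erase hw)
    · exact h.mono v hv w (Finset.mem_of_mem_erase hw)
  · rw [hun]; exact h.seed_mem
  · exact h.seed_le
  · exact h.edge_lt
  · exact fun e he => Finset.mem_insert_of_mem (h.edge_tl e he)
  · rw [hun]; exact h.edge_hd
  · exact h.edge_le
  · rw [hun]
    intro v hv
    rcases h.origin v hv with h' | ⟨e, a, b, c, c', f, g, i⟩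
    · exact Or.inl h'
    · refine Or.inr ⟨e, a, Finset.mem_insert_of_mem b, c, c', f, g, ?_⟩
      have hne : G.tl e ≠ u := fun e => huD (e ▸ b)
      rw [Function.update_of_ne hne]
      intro hvD
      by_cases hvu : v = u
      · rw [hvu, Function.update_self]
        exact h.ord_lt _ b
      · rw [Function.update_of_ne hvu]
        exact i (Finset.mem_of_mem_insert_of_ne hvD hvu)
  · intro v hv
    rw [Finset.card_insert_of_notMem huD]
    by_cases hvu : v = u
    · rw [hvu, Function.update_self]; omega
    · rw [Function.update_of_ne hvu]
      have := h.ord_lt v (Finset.mem_of_mem_insert_of_ne hv hvu)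
      omega
  · rw [hun]; exact h.unseen

/-- This covers both an edge into a vertex of level at most `j`, where the hypothesis is vacuous,
and an edge that brings no improvement. -/
theorem Inv.skip (h : G.Inv D H ord d par E) {e : ℕ} (he : e < G.m) (ht : G.tl e ∈ D)
    (hs : G.j < G.lev (G.hd e) → G.hd e ∈ D ∪ H ∧ d (G.hd e) ≤ d (G.tl e) + G.len e) :
    G.Inv D H ord d par (insert e E) where
  __ := h
  edge_lt := by
    intro f hf
    rcases Finset.mem_insert.1 hf with rfl | hf
    exacts [he, h.edge_lt f hf]
  edge_tl := by
    intro f hf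
    rcases Finset.mem_insert.1 hf with rfl | hf
    exacts [ht, h.edge_tl f hf]
  edge_hd := by
    intro f hf
    rcases Finset.mem_insert.1 hf with rfl | hf
    exacts [fun hj => (hs hj).1, h.edge_hd f hf]
  edge_le := by
    intro f hf
    rcases Finset.mem_insert.1 hf with rfl | hf
    exacts [fun hj => (hs hj).2, h.edge_le f hf]

open Function in
-- The tail has the largest finished label and the edge has nonnegative length, so no finished
-- vertex can be strictly improved. Hence labels change only outside `D`, and all equations and
-- inequalities recorded at finished tails survive.
theorem Inv.relax (hG : G.Valid) (h : G.Inv D H ord d par E) {e : ℕ} (he : e < G.m)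
    (ht : G.tl e ∈ D) (hmax : ∀ a ∈ D, d a ≤ d (G.tl e)) (hj : G.j < G.lev (G.hd e))
    (hs : G.hd e ∉ D ∪ H ∨ d (G.tl e) + G.len e < d (G.hd e)) :
    G.hd e ∉ D ∧ G.Inv D (insert (G.hd e) H) ord (update d (G.hd e) (d (G.tl e) + G.len e))
      (update par (G.hd e) (G.tl e + 1)) (insert e E) := by
  have hlen := hG.len_nonneg e he (h.lev_le _ (Finset.mem_union_left _ ht)) hj
  have hvD : G.hd e ∉ D := by
    intro hv
    rcases hs with hs | hs
    · exact hs (Finset.mem_union_left _ hv)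
    · have := hmax _ hv
      linarith
  have hne : ∀ u ∈ D, u ≠ G.hd e := fun u hu e => hvD (e ▸ hu)
  have hun : D ∪ insert (G.hd e) H = insert (G.hd e) (D ∪ H) := by
    rw [Finset.union_insert]
  have hle : ∀ v ∈ D ∪ H, update d (G.hd e) (d (G.tl e) + G.len e) v ≤ d v := by
    intro v hv
    by_cases hve : v = G.hd e
    · rw [hve, update_self]
      rw [hve] at hv
      rcases hs with hs | hs
      exacts [absurd hv hs, hs.le]
    · rw [update_of_ne hve]
  refine ⟨hvD, ?_⟩
  constructor
  · intro v hv
    rcases Finset.mem_insert.1 hv with rfl | hv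
    exacts [hvD, h.disj v hv]
  · rw [hun]
    intro v hv
    rcases Finset.mem_insert.1 hv with rfl | hv
    exacts [hG.hd_lt e he, h.lt v hv]
  · rw [hun]
    intro v hv
    rcases Finset.mem_insert.1 hv with rfl | hv
    exacts [hj.le, h.lev_le v hv]
  · intro u hu v hv
    rw [update_of_ne (hne u hu)]
    by_cases hve : v = G.hd e
    · rw [hve, update_self]
      have := hmax u hu
      linarith
    · rw [update_of_ne hve]
      exact h.mono u hu v (Finset.mem_of_mem_insert_of_ne hv hve)
  · rw [hun]; exact fun v hv => Finset.mem_insert_of_mem (h.seed_mem v hv)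
  · exact fun v hv => (hle v (h.seed_mem v hv)).trans (h.seed_le v hv)
  · intro f hf
    rcases Finset.mem_insert.1 hf with rfl | hf
    exacts [he, h.edge_lt f hf]
  · intro f hf
    rcases Finset.mem_insert.1 hf with rfl | hf
    exacts [ht, h.edge_tl f hf]
  · rw [hun]
    intro f hf hjf
    rcases Finset.mem_insert.1 hf with rfl | hf
    exacts [Finset.mem_insert_self _ _, Finset.mem_insert_of_mem (h.edge_hd f hf hjf)]
  · intro f hf hjf
    rcases Finset.mem_insert.1 hf with rfl | hf
    · rw [update_self, update_of_ne (hne _ ht)]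
    · rw [update_of_ne (hne _ (h.edge_tl f hf))]
      exact (hle _ (h.edge_hd f hf hjf)).trans (h.edge_le f hf hjf)
  · rw [hun]
    intro v hv
    by_cases hve : v = G.hd e
    · refine Or.inr ⟨e, he, ht, hve.symm, hve ▸ hj, ?_, ?_, fun hv' => absurd (hve ▸ hv') hvD⟩
      · rw [hve, update_self]
      · rw [hve, update_self, update_of_ne (hne _ ht)]
    · rw [update_of_ne hve, update_of_ne hve]
      rcases h.origin v (Finset.mem_of_mem_insert_of_ne hv hve) with h' | ⟨f, a, b, c, c', i, g, k⟩
      · exact Or.inl h'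
      · refine Or.inr ⟨f, a, b, c, c', i, ?_, k⟩
        rw [update_of_ne (hne _ b), g]
  · exact h.ord_lt
  · rw [hun]
    intro v hv hv'
    rw [Finset.mem_insert, not_or] at hv'
    rw [update_of_ne hv'.1]
    exact h.unseen v hv hv'.2

/-! ### Dijkstra's algorithm as a program -/

/-- The network `G` with adjacency lists is stored in the memory `σ`. -/
structure Stored (G : Net) (σ : State) : Prop where
  j_eq : σ.ireg 4 = G.j
  hd_eq : σ.iarr 1 = G.hd
  lev_eq : σ.iarr 4 = G.lev
  len_eq : ∀ e, G.len e = σ.rarr 1 (G.tl e) + σ.rarr 0 e - σ.rarr 1 (G.hd e)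
  adj : ∀ u < G.n, ∃ l : List ℕ, Linked (σ.iarr 6) (σ.iarr 5 u) l ∧ l.Nodup ∧
    ∀ i, i ∈ l ↔ ∃ e < G.m, i = e + 1 ∧ G.tl e = u

theorem Stored.congr {σ τ : State} (h : G.Stored σ) (e4 : τ.ireg 4 = σ.ireg 4)
    (a1 : τ.iarr 1 = σ.iarr 1) (a4 : τ.iarr 4 = σ.iarr 4) (a5 : τ.iarr 5 = σ.iarr 5)
    (a6 : τ.iarr 6 = σ.iarr 6) (r0 : τ.rarr 0 = σ.rarr 0) (r1 : τ.rarr 1 = σ.rarr 1) :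
    G.Stored τ := by
  constructor
  · rw [e4]; exact h.j_eq
  · rw [a1]; exact h.hd_eq
  · rw [a4]; exact h.lev_eq
  · rw [r0, r1]; exact h.len_eq
  · rw [a5, a6]; exact h.adj

end Net

namespace HollowHeap

theorem IsHeap.congr_keys {σ : State} {M φ : ℕ} {H : Finset ℕ} {kf kf' : ℕ → ℝ}
    (h : IsHeap σ M H kf φ) (hk : ∀ v ∈ H, kf v = kf' v) : IsHeap σ M H kf' φ := by
  obtain ⟨p, P, h, hφ⟩ := h
  exact ⟨p, P, { h with key_node := fun v hv => (h.key_node v hv).trans (hk v hv) }, hφ⟩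

theorem IsHeap.congr {σ τ : State} {M φ : ℕ} {H : Finset ℕ} {kf : ℕ → ℝ}
    (h : IsHeap σ M H kf φ)
    (e7 : τ.iarr 7 = σ.iarr 7) (e8 : τ.iarr 8 = σ.iarr 8) (e9 : τ.iarr 9 = σ.iarr 9)
    (e10 : τ.iarr 10 = σ.iarr 10) (e11 : τ.iarr 11 = σ.iarr 11) (e12 : τ.iarr 12 = σ.iarr 12)
    (e13 : τ.iarr 13 = σ.iarr 13) (ek : τ.rarr 3 = σ.rarr 3) (eN : τ.ireg 7 = σ.ireg 7)
    (ec : τ.ireg 8 = σ.ireg 8) (er : τ.ireg 9 = σ.ireg 9) : IsHeap τ M H kf φ := by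
  obtain ⟨p, P, h, hφ⟩ := h
  refine ⟨p, P, ?_, ?_⟩
  · rw [e12, ec]
    exact h.congr e7 e8 e9 e10 e11 e13 ek eN er
  · rw [hφ, hollows, hollows, e8, ec]

end HollowHeap

open HollowHeap

/-- Relax the edges in the adjacency list at register `18`, which leave the vertex in
register `16`. -/
def relaxEdges : Cmd :=
  .loop (.ilt (.const 0) (.reg 18)) (.block
    [.iset 6 (.pred (.reg 18)),
     .iset 17 (.get 1 (.reg 6)),
     .ite (.ilt (.reg 4) (.get 4 (.reg 17)))
       (.block
         [.rset 0 (.sub (.add (.add (.get 2 (.reg 16)) (.get 1 (.reg 16))) (.get 0 (.reg 6)))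
            (.get 1 (.reg 17))),
          .ite (.and (.not (.ieq (.get 7 (.reg 17)) (.const 0)))
              (.not (.rlt (.reg 0) (.get 2 (.reg 17))))) .skip
            (.block
              [.rput 2 (.reg 17) (.reg 0), .iput 3 (.reg 17) (.succ (.reg 16)), decreaseKey])])
       .skip,
     .iset 18 (.get 6 (.reg 18))])

def dijkstra : Cmd :=
  .block [deleteMin,
    .loop (.ilt (.const 0) (.reg 15))
      (.block [.iset 18 (.get 5 (.reg 16)), relaxEdges, deleteMin])]

namespace Net

/-- The invariant of Dijkstra's algorithm together with the heap of unfinished vertices. -/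
structure Search (G : Net) (σ : State) (D H : Finset ℕ) (ord : ℕ → ℕ) (E : Finset ℕ)
    (φ : ℕ) : Prop where
  inv : G.Inv D H ord (σ.rarr 2) (σ.iarr 3) E
  heap : IsHeap σ (G.n + G.m) H (σ.rarr 2) φ
  node : ∀ v < G.n, σ.iarr 7 v = 0 ↔ v ∉ D ∪ H
  count : σ.ireg 7 ≤ G.n + E.card

/-- Each listed edge is new to `E` and causes at most one `decreaseKey`, whence 600 per edge. The
same accounting keeps the number of heap nodes below `G.n + E.card`, as required by the bound on
ranks. -/
theorem relaxEdges_spec {G : Net} (hG : G.Valid) {σ : State} (hσ : G.Stored σ) {D H : Finset ℕ}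
    {ord : ℕ → ℕ} {E : Finset ℕ} {φ : ℕ} (h : G.Search σ D H ord E φ) (hu : σ.ireg 16 ∈ D)
    (hmax : ∀ a ∈ D, σ.rarr 2 a ≤ σ.rarr 2 (σ.ireg 16)) {l : List ℕ}
    (hl : Linked (σ.iarr 6) (σ.ireg 18) l) (hl' : l.Nodup)
    (hlE : ∀ i ∈ l, ∃ e < G.m, i = e + 1 ∧ G.tl e = σ.ireg 16 ∧ e ∉ E) :
    WP relaxEdges σ fun t τ => ∃ H' E' φ', G.Search τ D H' ord E' φ' ∧
      E'.card = E.card + l.length ∧ (∀ e, e ∈ E' ↔ e ∈ E ∨ e + 1 ∈ l) ∧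
      t + φ' ≤ φ + 600 * l.length + 3 := by
  refine (wp_loop (σ₀ := σ) (φ₀ := φ + 600 * l.length) (fun τ ψ => ∃ H' E' φ' l',
      G.Search τ D H' ord E' φ' ∧ (∀ a ∈ D, τ.rarr 2 a ≤ τ.rarr 2 (σ.ireg 16)) ∧
      Linked (σ.iarr 6) (τ.ireg 18) l' ∧ l'.Nodup ∧
      (∀ i ∈ l', ∃ e < G.m, i = e + 1 ∧ G.tl e = σ.ireg 16 ∧ e ∉ E') ∧
      E'.card + l'.length = E.card + l.length ∧
      (∀ e, (e ∈ E' ∨ e + 1 ∈ l') ↔ (e ∈ E ∨ e + 1 ∈ l)) ∧ ψ = φ' + 600 * l'.length)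
    ⟨H, E, φ, l, h, hmax, hl, hl', hlE, rfl, fun _ => Iff.rfl, rfl⟩ ?_).mono ?_
  · rintro τ ψ ⟨H', E', φ', l', h, hmax, hl, hl', hlE, hcard, hiff, rfl⟩ hF hb
    simp only [BExpr.holds, IExpr.eval] at hb
    obtain ⟨l'', rfl, hl''⟩ := exists_cons_of_linked hl hb.ne'
    obtain ⟨e, he, hi, hte, heE⟩ := hlE _ (List.mem_cons_self ..)
    have e6 : τ.iarr 6 = σ.iarr 6 := hF.iarr 6 (by decide)
    have e16 : τ.ireg 16 = σ.ireg 16 := hF.ireg 16 (by decide)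
    have hτ := hσ.congr (hF.ireg 4 (by decide)) (hF.iarr 1 (by decide)) (hF.iarr 4 (by decide))
      (hF.iarr 5 (by decide)) (hF.iarr 6 (by decide)) (hF.rarr 0 (by decide))
      (hF.rarr 1 (by decide))
    have hnd := List.nodup_cons.1 hl'
    have hlen : τ.rarr 2 (τ.ireg 16) + τ.rarr 1 (τ.ireg 16) + τ.rarr 0 e - τ.rarr 1 (G.hd e) =
        τ.rarr 2 (G.tl e) + G.len e := by
      rw [hτ.len_eq, hte, e16]; ring
    have hrest : ∀ i ∈ l'', ∃ f < G.m, i = f + 1 ∧ G.tl f = σ.ireg 16 ∧ f ∉ insert e E' := by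
      intro i hil
      obtain ⟨f, f1, f2, f3, f4⟩ := hlE i (List.mem_cons_of_mem _ hil)
      refine ⟨f, f1, f2, f3, ?_⟩
      rw [Finset.mem_insert, not_or]
      refine ⟨?_, f4⟩
      rintro rfl
      rw [hi, ← f2] at hnd
      exact hnd.1 hil
    have hcard' : (insert e E').card + l''.length = E.card + l.length := by
      rw [Finset.card_insert_of_notMem heE]
      simp at hcard
      omega
    have hiff' : ∀ f, (f ∈ insert e E' ∨ f + 1 ∈ l'') ↔ (f ∈ E ∨ f + 1 ∈ l) := by
      intro f
      rw [← hiff f, Finset.mem_insert, List.mem_cons, hi]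
      have : f = e ↔ f + 1 = e + 1 := by omega
      tauto
    have hcount : τ.ireg 7 ≤ G.n + (insert e E').card := by
      have := h.count
      rw [Finset.card_insert_of_notMem heE]
      omega
    have hpred : τ.ireg 18 - 1 = e := by omega
    have hnode := h.node _ (hG.hd_lt e he)
    refine WP.of_forall fun Q hQ => ?_
    simp [hpred, hτ.hd_eq, hτ.lev_eq, hτ.j_eq, hlen]
    refine ⟨fun hj => ⟨fun h1 h2 => ?_, fun h1 => ?_⟩, fun hj => ?_⟩
    · have hskip := h.inv.skip he (by rw [hte]; exact hu) (fun _ =>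
        ⟨by rw [hnode] at h1; exact not_not.1 h1, h2⟩)
      refine hQ _ _ ⟨_, ⟨H', insert e E', φ', l'', ⟨hskip, ?_, ?_, ?_⟩, ?_, ?_, hnd.2, hrest, hcard',
        hiff', rfl⟩, ?_⟩
      · refine h.heap.congr ?_ ?_ ?_ ?_ ?_ ?_ ?_ ?_ ?_ ?_ ?_ <;> simp
      · simpa using h.node
      · simpa using hcount
      · simpa using hmax
      · simpa [e6] using hl''
      · simp; omega
    · have hs : G.hd e ∉ D ∪ H' ∨ τ.rarr 2 (G.tl e) + G.len e < τ.rarr 2 (G.hd e) := by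
        rw [← hnode]
        by_cases h0 : τ.iarr 7 (G.hd e) = 0
        exacts [Or.inl h0, Or.inr (h1 h0)]
      obtain ⟨hvD, hrelax⟩ := h.inv.relax hG he (by rw [hte]; exact hu) (by rw [hte]; exact hmax)
        hj hs
      have hne : ∀ a ∈ D, a ≠ G.hd e := fun a ha e => hvD (e ▸ ha)
      refine (decreaseKey_spec (v := G.hd e) (M := G.n + G.m) (H := H') (kf := τ.rarr 2) (φ := φ')
        ?_ ?_ ?_).frame.mono ?_
      · refine h.heap.congr ?_ ?_ ?_ ?_ ?_ ?_ ?_ ?_ ?_ ?_ ?_ <;> simp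
      · simp
      · simp
        rcases hs with hs | hs
        · refine Or.inr ⟨fun hv => hs (Finset.mem_union_right _ hv), hnode.2 hs⟩
        · by_cases hv : G.hd e ∈ H'
          · exact Or.inl ⟨hv, hs.le⟩
          · refine Or.inr ⟨hv, hnode.2 ?_⟩
            rw [Finset.mem_union, not_or]
            exact ⟨hvD, hv⟩
      · rintro t υ ⟨⟨φ'', q1, q2, q3, q4⟩, q5⟩
        have r2 : υ.rarr 2 = Function.update (τ.rarr 2) (G.hd e) (τ.rarr 2 (G.tl e) + G.len e) := by
          simpa using q5.rarr 2 (by decide)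
        have a3 : υ.iarr 3 = Function.update (τ.iarr 3) (G.hd e) (G.tl e + 1) := by
          simpa [hte, e16] using q5.iarr 3 (by decide)
        have a6 : υ.iarr 6 = σ.iarr 6 := by
          rw [← e6]; simpa using q5.iarr 6 (by decide)
        have a18 : υ.ireg 18 = τ.ireg 18 := by simpa using q5.ireg 18 (by decide)
        simp at q2 q3 q4
        refine hQ _ _ ⟨_, ⟨insert (G.hd e) H', insert e E', φ'', l'', ⟨?_, ?_, ?_, ?_⟩, ?_, ?_,
          hnd.2, hrest, hcard', hiff', rfl⟩, ?_⟩
        · simp [r2, a3]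
          exact hrelax
        · simp [r2]
          refine q2.congr ?_ ?_ ?_ ?_ ?_ ?_ ?_ ?_ ?_ ?_ ?_ <;> simp
        · simp [q4]
          intro v hv
          have := h.node v hv
          rw [Function.update_apply]
          simp at this
          split_ifs with hve
          · simp [hve]
          · simp [hve, this]
        · have := h.count
          simp [q3, Finset.card_insert_of_notMem heE]
          omega
        · simp [r2]
          intro a ha
          rw [Function.update_of_ne (hne a ha), Function.update_of_ne (hne _ hu)]
          exact hmax a ha
        · simp [a6, a18]
          exact hl''
        · simp; omega
    · have hskip := h.inv.skip he (by rw [hte]; exact hu) (fun h => absurd h (by omega))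
      refine hQ _ _ ⟨_, ⟨H', insert e E', φ', l'', ⟨hskip, ?_, ?_, ?_⟩, ?_, ?_, hnd.2, hrest, hcard',
        hiff', rfl⟩, ?_⟩
      · refine h.heap.congr ?_ ?_ ?_ ?_ ?_ ?_ ?_ ?_ ?_ ?_ ?_ <;> simp
      · simpa using h.node
      · simpa using hcount
      · simpa using hmax
      · simpa [e6] using hl''
      · simp; omega
  · rintro t τ ⟨ψ, ⟨H', E', φ', l', h, hmax, hl, hl', hlE, hcard, hiff, rfl⟩, hb, hF, ht⟩
    simp at hb ht
    rw [hb] at hl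
    obtain rfl := linked_zero hl
    simp at hcard hiff ht
    exact ⟨H', E', φ', h, hcard, hiff, ht⟩

/-- The loop potential reserves 600 for every edge not yet relaxed and one `deleteMin` with overhead
for every unfinished vertex. An edge is relaxed exactly when its tail finishes, so `E` is determined
by `D`. -/
theorem dijkstra_spec {G : Net} (hG : G.Valid) {σ : State} (hσ : G.Stored σ) {H : Finset ℕ}
    {ord : ℕ → ℕ} {φ L : ℕ} (h : G.Search σ ∅ H ord ∅ φ)
    (hL : ∀ r, Nat.fib (r + 1) ≤ G.n + G.m → r ≤ L) :
    WP dijkstra σ fun t τ => ∃ D ord E, G.Inv D ∅ ord (τ.rarr 2) (τ.iarr 3) E ∧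
      (∀ e, e ∈ E ↔ e < G.m ∧ G.tl e ∈ D) ∧ Clean τ ∧
      t ≤ φ + 600 * G.m + (400 * L + 600) * (G.n + 1) := by
  have hEcard : ∀ E : Finset ℕ, (∀ e ∈ E, e < G.m) → E.card ≤ G.m := fun E hE => by
    simpa using Finset.card_le_card (t := Finset.range G.m) fun e he => by simpa using hE e he
  have hDcard : ∀ D : Finset ℕ, (∀ v ∈ D, v < G.n) → D.card ≤ G.n := fun D hD => by
    simpa using Finset.card_le_card (t := Finset.range G.n) fun e he => by simpa using hD e he
  rw [dijkstra, wp_block_cons]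
  refine (deleteMin_spec h.heap (by have := h.count; simp at this; omega) hL).frame.mono ?_
  rintro t₁ σ₁ ⟨⟨φ₁, g1, g2, g3⟩, hF₁⟩
  rw [wp_block_cons]
  -- At the loop test the minimum in register 16 has left the heap but is still unfinished: it
  -- belongs to `H`, and the heap holds `H` without it.
  refine (wp_loop (φ₀ := φ₁ + 600 * G.m + (400 * L + 600) * G.n) (fun τ ψ => ∃ D H ord E φ,
      G.Inv D H ord (τ.rarr 2) (τ.iarr 3) E ∧ (∀ e, e ∈ E ↔ e < G.m ∧ G.tl e ∈ D) ∧
      (∀ v < G.n, τ.iarr 7 v = 0 ↔ v ∉ D ∪ H) ∧ τ.ireg 7 ≤ G.n + E.card ∧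
      (τ.ireg 15 = 0 → H = ∅ ∧ Clean τ) ∧
      (τ.ireg 15 ≠ 0 → τ.ireg 16 ∈ H ∧ (∀ v ∈ H, τ.rarr 2 (τ.ireg 16) ≤ τ.rarr 2 v) ∧
        IsHeap τ (G.n + G.m) (H.erase (τ.ireg 16)) (τ.rarr 2) φ) ∧
      ψ = φ + 600 * (G.m - E.card) + (400 * L + 600) * (G.n - D.card)) ?_ ?_).mono ?_
  · have r2 : σ₁.rarr 2 = σ.rarr 2 := hF₁.rarr 2 (by decide)
    have a3 : σ₁.iarr 3 = σ.iarr 3 := hF₁.iarr 3 (by decide)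
    have a7 : σ₁.iarr 7 = σ.iarr 7 := hF₁.iarr 7 (by decide)
    have i7 : σ₁.ireg 7 = σ.ireg 7 := hF₁.ireg 7 (by decide)
    refine ⟨∅, H, ord, ∅, φ₁, ?_, by simp, ?_, ?_, g2, ?_, by simp⟩
    · rw [r2, a3]; exact h.inv
    · rw [a7]; exact h.node
    · rw [i7]; exact h.count
    · rw [r2]; exact g3
  · rintro τ ψ ⟨D, H, ord, E, φ, h, hE, hn, hc, -, h15, rfl⟩ hF hb
    simp only [BExpr.holds, IExpr.eval] at hb
    obtain ⟨hu, hmin, hheap⟩ := h15 hb.ne'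
    have hτ := (hσ.congr (hF₁.ireg 4 (by decide)) (hF₁.iarr 1 (by decide)) (hF₁.iarr 4 (by decide))
      (hF₁.iarr 5 (by decide)) (hF₁.iarr 6 (by decide)) (hF₁.rarr 0 (by decide))
      (hF₁.rarr 1 (by decide))).congr (hF.ireg 4 (by decide)) (hF.iarr 1 (by decide))
      (hF.iarr 4 (by decide)) (hF.iarr 5 (by decide)) (hF.iarr 6 (by decide))
      (hF.rarr 0 (by decide)) (hF.rarr 1 (by decide))
    have huD := h.disj _ hu
    have hun : insert (τ.ireg 16) D ∪ H.erase (τ.ireg 16) = D ∪ H := by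
      ext v
      simp only [Finset.mem_union, Finset.mem_insert, Finset.mem_erase]
      by_cases hv : v = τ.ireg 16 <;> simp [hv, hu]
    obtain ⟨l, q1, q2, q3⟩ := hτ.adj _ (h.lt _ (Finset.mem_union_right _ hu))
    have hfin := h.finish hu hmin
    rw [wp_block_cons, wp_iset, wp_block_cons]
    refine (relaxEdges_spec hG (l := l) (φ := φ) (D := insert (τ.ireg 16) D)
      (H := H.erase (τ.ireg 16)) (ord := Function.update ord (τ.ireg 16) D.card) (E := E)
      (hτ.congr ?_ ?_ ?_ ?_ ?_ ?_ ?_) ⟨?_, ?_, ?_, ?_⟩ ?_ ?_ ?_ q2 ?_).frame.mono ?_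
    iterate 7 simp
    · simpa using hfin
    · refine hheap.congr ?_ ?_ ?_ ?_ ?_ ?_ ?_ ?_ ?_ ?_ ?_ <;> simp
    · rw [hun]; simpa using hn
    · simpa using hc
    · simp
    · simp
      exact fun a ha => h.mono a ha _ hu
    · simpa using q1
    · intro i hi
      obtain ⟨e, f1, f2, f3⟩ := (q3 i).1 hi
      refine ⟨e, f1, f2, by simpa using f3, ?_⟩
      rw [hE, not_and, f3]
      exact fun _ => huD
    rintro t₂ σ₂ ⟨⟨H₂, E₂, φ₂, p1, p2, p3, p4⟩, hF₂⟩
    have hE₂ := hEcard E₂ p1.inv.edge_lt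
    have hE₁ := hEcard E h.edge_lt
    have hD₁ := hDcard (insert (τ.ireg 16) D) fun v hv => hfin.lt v (Finset.mem_union_left _ hv)
    rw [Finset.card_insert_of_notMem huD] at hD₁
    rw [wp_block_cons]
    refine (deleteMin_spec p1.heap (by have := p1.count; omega) hL).frame.mono ?_
    rintro t₃ σ₃ ⟨⟨φ₃, o1, o2, o3⟩, hF₃⟩
    rw [wp_block_nil]
    have r2 : σ₃.rarr 2 = σ₂.rarr 2 := hF₃.rarr 2 (by decide)
    have a3 : σ₃.iarr 3 = σ₂.iarr 3 := hF₃.iarr 3 (by decide)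
    have a7 : σ₃.iarr 7 = σ₂.iarr 7 := hF₃.iarr 7 (by decide)
    have i7 : σ₃.ireg 7 = σ₂.ireg 7 := hF₃.ireg 7 (by decide)
    refine ⟨_, ⟨insert (τ.ireg 16) D, H₂, Function.update ord (τ.ireg 16) D.card, E₂, φ₃, ?_, ?_, ?_, ?_, o2, ?_, rfl⟩, ?_⟩
    · rw [r2, a3]; exact p1.inv
    · intro e
      rw [p3, hE, q3, Finset.mem_insert]
      constructor
      · rintro (⟨a, b⟩ | ⟨f, a, b, c⟩)
        · exact ⟨a, Or.inr b⟩
        · obtain rfl : e = f := by omega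
          exact ⟨a, Or.inl c⟩
      · rintro ⟨a, b | b⟩
        · exact Or.inr ⟨e, a, rfl, b⟩
        · exact Or.inl ⟨a, b⟩
    · rw [a7]; exact p1.node
    · rw [i7]; exact p1.count
    · rw [r2]; exact o3
    · rw [Finset.card_insert_of_notMem huD]
      obtain ⟨k, hk⟩ : ∃ k, G.n - D.card = k + 1 := ⟨G.n - D.card - 1, by omega⟩
      rw [hk, show G.n - (D.card + 1) = k by omega]
      simp
      ring_nf
      ring_nf at o1 p4
      omega
  · rintro t τ ⟨ψ, ⟨D, H, ord, E, φ, h, hE, hn, hc, h0, h15, rfl⟩, hb, hF, ht⟩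
    simp at hb ht
    rw [(h0 hb).1] at h
    rw [wp_block_nil]
    refine ⟨D, ord, E, h, hE, (h0 hb).2, ?_⟩
    ring_nf
    ring_nf at ht g1
    omega

end Net

/-! ## Shortest paths, potentials and elimination forests -/

namespace TreeDepth

variable {V : Type*} {G : Digraph V} {w : V → V → ℝ}

theorem weight_append_singleton (w : V → V → ℝ) {p : List V} {u : V} (hp : p.getLast? = some u)
    (v : V) : weight w (p ++ [v]) = weight w p + w u v := by
  induction p with
  | nil => simp at hp
  | cons a p ih =>
    cases p with
    | nil =>
      simp at hp
      simp [weight, hp]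
    | cons b p =>
      rw [List.getLast?_cons_cons] at hp
      have := ih hp
      simp only [List.cons_append, weight] at this ⊢
      rw [this]
      ring

/-- In a search tree given by parents, with a potential `φ` and labels `d`, every vertex is reached
from a source by a path whose weight is determined by the labels. -/
theorem exists_tree_path {S hi : V → Prop} {D : Set V} {ord : V → ℕ} {d φ init : V → ℝ}
    {par : V → Option V}
    (h : ∀ v ∈ D, (S v ∧ d v = init v ∧ par v = none) ∨
      ∃ u ∈ D, G.Adj u v ∧ hi v ∧ par v = some u ∧ d v = d u + (φ u + w u v - φ v) ∧
        ord u < ord v ∧ 0 ≤ φ u + w u v - φ v) :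
    ∀ v ∈ D, ∃ r p, S r ∧ r ∈ D ∧ par r = none ∧
      (r :: p).IsChain (fun a b => par b = some a ∧ G.Adj a b) ∧ (r :: p).getLast? = some v ∧
      (∀ x ∈ p, hi x) ∧ (r :: p).Nodup ∧ (∀ x ∈ r :: p, ord x ≤ ord v) ∧
      d v = init r + (φ r + weight w (r :: p) - φ v) ∧ init r ≤ d v := by
  suffices H : ∀ k, ∀ v ∈ D, ord v = k → ∃ r p, S r ∧ r ∈ D ∧ par r = none ∧
      (r :: p).IsChain (fun a b => par b = some a ∧ G.Adj a b) ∧ (r :: p).getLast? = some v ∧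
      (∀ x ∈ p, hi x) ∧ (r :: p).Nodup ∧ (∀ x ∈ r :: p, ord x ≤ ord v) ∧
      d v = init r + (φ r + weight w (r :: p) - φ v) ∧ init r ≤ d v from
    fun v hv => H _ v hv rfl
  intro k
  induction k using Nat.strong_induction_on with
  | _ k ih =>
    intro v hv hk
    rcases h v hv with ⟨h1, h2, h3⟩ | ⟨u, hu, h1, h2, h3, h4, h5, h6⟩
    · exact ⟨v, [], h1, hv, h3, by simp, by simp, by simp, by simp, by simp,
        by simp [weight, h2], h2.ge⟩
    · obtain ⟨r, p, g1, g2, g3, g4, g5, g6, g7, g8, g9, g10⟩ := ih _ (hk ▸ h5) u hu rfl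
      refine ⟨r, p ++ [v], g1, g2, g3, ?_, by rw [← List.cons_append, List.getLast?_concat], ?_, ?_, ?_,
        ?_, by linarith⟩
      · rw [← List.cons_append, List.isChain_append]
        refine ⟨g4, by simp, ?_⟩
        intro x hx y hy
        rw [g5] at hx
        simp at hx hy
        subst hx hy
        exact ⟨h3, h1⟩
      · intro x hx
        rcases List.mem_append.1 hx with hx | hx
        · exact g6 x hx
        · rw [List.mem_singleton.1 hx]; exact h2
      · rw [← List.cons_append]
        refine List.nodup_append.2 ⟨g7, by simp, ?_⟩
        rintro a ha b hb rfl
        rw [List.mem_singleton] at hb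
        have := g8 a ha
        rw [hb] at this
        omega
      · intro x hx
        rw [← List.cons_append] at hx
        rcases List.mem_append.1 hx with hx | hx
        · exact (g8 x hx).trans h5.le
        · rw [List.mem_singleton.1 hx]
      · rw [← List.cons_append, weight_append_singleton w g5, h4, g9]
        ring

/-- Edge inequalities add up along a walk and the potentials telescope. `D` is closed under outgoing
edges, so the walk never leaves it. -/
theorem le_weight_of_isChain {D : Set V} {d φ : V → ℝ}
    (h : ∀ u ∈ D, ∀ v, G.Adj u v → v ∈ D ∧ d v ≤ d u + (φ u + w u v - φ v)) :
    ∀ (p : List V) (a v : V), a ∈ D → (a :: p).IsChain G.Adj → (a :: p).getLast? = some v →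
      v ∈ D ∧ d v ≤ d a + (φ a + weight w (a :: p) - φ v) := by
  intro p
  induction p with
  | nil =>
    intro a v ha _ hv
    simp at hv
    subst hv
    exact ⟨ha, by simp [weight]⟩
  | cons b p ih =>
    intro a v ha hc hv
    rw [List.isChain_cons_cons] at hc
    rw [List.getLast?_cons_cons] at hv
    obtain ⟨hb, hab⟩ := h a ha b hc.1
    obtain ⟨h1, h2⟩ := ih b v hb hc.2 hv
    refine ⟨h1, ?_⟩
    simp only [weight]
    linarith

theorem reflTransGen_of_isChain {R : V → V → Prop} :
    ∀ (p : List V) (a v : V), (a :: p).IsChain R → (a :: p).getLast? = some v →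
      Relation.ReflTransGen R a v := by
  intro p
  induction p with
  | nil =>
    intro a v _ hv
    simp at hv
    rw [hv]
  | cons b p ih =>
    intro a v hc hv
    rw [List.isChain_cons_cons] at hc
    rw [List.getLast?_cons_cons] at hv
    exact .head hc.1 (ih b v hc.2 hv)

/-- The search tree computed with a feasible potential is a shortest-path tree. -/
theorem isShortestPathTree_of_search {D : Set V} {ord : V → ℕ} {d φ : V → ℝ}
    {par : V → Option V} {s : V} (hs : s ∈ D) (hd : d s ≤ 0)
    (hφ : ∀ u v, G.Adj u v → 0 ≤ φ u + w u v - φ v)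
    (hD : ∀ u ∈ D, ∀ v, G.Adj u v → v ∈ D ∧ d v ≤ d u + (φ u + w u v - φ v))
    (horigin : ∀ v ∈ D, (v = s ∧ d v = 0 ∧ par v = none) ∨
      ∃ u ∈ D, G.Adj u v ∧ par v = some u ∧ d v = d u + (φ u + w u v - φ v) ∧ ord u < ord v)
    (hnone : ∀ v, v ∉ D → par v = none) : IsShortestPathTree G w s par := by
  have hpath := exists_tree_path (G := G) (w := w) (S := fun v => v = s) (hi := fun _ => True)
    (D := D) (ord := ord) (d := d) (φ := φ) (init := fun _ => 0) (par := par) (by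
      intro v hv
      rcases horigin v hv with h | ⟨u, hu, h1, h2, h3, h4⟩
      · exact Or.inl h
      · exact Or.inr ⟨u, hu, h1, trivial, h2, h3, h4, hφ u v h1⟩)
  have hsn : par s = none := by
    obtain ⟨r, p, rfl, -, h, -⟩ := hpath s hs
    exact h
  have hreach : ∀ v, v ∈ D ↔ Relation.ReflTransGen G.Adj s v := by
    intro v
    constructor
    · intro hv
      obtain ⟨r, p, rfl, -, -, h, h', -⟩ := hpath v hv
      exact reflTransGen_of_isChain p r v (h.imp fun _ _ h => h.2) h'
    · intro h
      induction h with
      | refl => exact hs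
      | tail _ h ih => exact (hD _ ih _ h).1
  refine ⟨hsn, ?_, ?_, ?_⟩
  · intro u v huv
    by_cases hv : v ∈ D
    · rcases horigin v hv with ⟨-, -, h⟩ | ⟨u', -, h1, h2, -⟩
      · rw [h] at huv; simp at huv
      · rw [h2] at huv
        simp at huv
        exact huv ▸ h1
    · rw [hnone v hv] at huv; simp at huv
  · intro v hvs
    rw [← hreach]
    constructor
    · rintro ⟨u, hu⟩
      by_contra hv
      rw [hnone v hv] at hu; simp at hu
    · intro hv
      rcases horigin v hv with ⟨h, -⟩ | ⟨u, -, -, h2, -⟩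
      exacts [absurd h hvs, ⟨u, h2⟩]
  · intro v hv
    rw [← hreach] at hv
    obtain ⟨r, p, rfl, -, -, h1, h2, -, h3, -, h4, -⟩ := hpath v hv
    refine ⟨r :: p, h1.imp fun _ _ h => h.1, ⟨h1.imp fun _ _ h => h.2, h3, by simp, h2⟩, ?_⟩
    rintro q ⟨q1, -, q3, q4⟩
    cases q with
    | nil => simp at q3
    | cons a q =>
      simp at q3
      subst q3
      -- Tree paths attain `d v = φ s + weight - φ v`, and every competing path has at least this
      -- reduced weight since `d s ≤ 0`; the potential terms cancel.
      have := (le_weight_of_isChain hD q a v hs q1 q4).2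
      linarith

/-! ### Levels in an elimination forest -/

namespace RootedForest

/-- The number of ancestors of a vertex. -/
noncomputable def level (F : RootedForest V) (v : V) : ℕ := {u | F.IsAncestor u v}.ncard

variable {F : RootedForest V}

/-- Parents are unique, so the ancestors of `v` form a chain. The induction climbs from `v` to `a`,
noting where `b` is passed. -/
theorem IsAncestor.comparable {a b v : V} (ha : F.IsAncestor a v) (hb : F.IsAncestor b v) :
    F.IsAncestor a b ∨ F.IsAncestor b a := by
  induction ha using Relation.ReflTransGen.head_induction_on with
  | refl => exact Or.inr hb
  | @head a c hac hcv ih =>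
    rcases ih with h | h
    · exact Or.inl (.head hac h)
    · rcases Relation.ReflTransGen.cases_tail h with h | ⟨c', h, hc'⟩
      · subst h
        exact Or.inl (.single hac)
      · rw [hac] at hc'
        simp at hc'
        subst hc'
        exact Or.inr h

theorem IsAncestor.antisymm {a b : V} (h : F.IsAncestor a b) (h' : F.IsAncestor b a) : a = b := by
  rcases Relation.reflTransGen_iff_eq_or_transGen.1 h with h | h
  · exact h.symm
  · exact absurd (Relation.TransGen.trans_left h h') (F.acyclic a)

theorem level_lt [Fintype V] {a b : V} (h : F.IsAncestor a b) (hab : a ≠ b) : F.level a < F.level b := by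
  refine Set.ncard_lt_ncard ?_ (Set.toFinite _)
  refine ⟨fun x hx => Relation.ReflTransGen.trans hx h, fun hs => hab ?_⟩
  exact h.antisymm (hs (Relation.ReflTransGen.refl : F.IsAncestor b b))

theorem level_root {v : V} (h : F.parent v = none) : F.level v = 1 := by
  have : {u | F.IsAncestor u v} = {v} := by
    ext u
    constructor
    · intro hu
      rcases Relation.ReflTransGen.cases_tail hu with hu | ⟨c, -, hc⟩
      · exact hu.symm
      · rw [h] at hc; simp at hc
    · rintro rfl
      exact Relation.ReflTransGen.refl
  rw [level, this, Set.ncard_singleton]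

theorem level_parent [Fintype V] {u v : V} (h : F.parent v = some u) : F.level v = F.level u + 1 := by
  have : {x | F.IsAncestor x v} = insert v {x | F.IsAncestor x u} := by
    ext x
    constructor
    · intro hx
      rcases Relation.ReflTransGen.cases_tail hx with hx | ⟨c, hc, hc'⟩
      · exact Or.inl hx.symm
      · rw [h] at hc'
        simp at hc'
        subst hc'
        exact Or.inr hc
    · rintro (rfl | hx)
      · exact Relation.ReflTransGen.refl
      · exact Relation.ReflTransGen.tail hx h
  rw [level, this, Set.ncard_insert_of_notMem _ (Set.toFinite _), level]
  intro hv
  exact F.acyclic v (Relation.TransGen.tail' hv h)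

variable [Fintype V]

theorem level_pos (v : V) : 0 < F.level v := by
  cases h : F.parent v with
  | none => rw [level_root h]; omega
  | some u => rw [level_parent h]; omega

theorem level_le_depth (v : V) : F.level v ≤ F.depth :=
  Finset.le_sup (f := fun v => {u | F.IsAncestor u v}.ncard) (Finset.mem_univ v)

/-- Endpoints are comparable and distinct, and levels strictly increase along ancestry. Consequently
a level has no internal edges to care for when a potential is extended to it. -/
theorem IsEliminationForest.level_ne (hF : F.IsEliminationForest G) (hG : ∀ v, ¬ G.Adj v v)
    {u v : V} (h : G.Adj u v) : F.level u ≠ F.level v := by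
  have huv : u ≠ v := by rintro rfl; exact hG u h
  rcases hF u v h with h | h
  · exact (level_lt h huv).ne
  · exact (level_lt h huv.symm).ne'

/-- A path that starts at level `j` and then stays above it leads to a descendant. -/
theorem IsEliminationForest.isAncestor_of_isChain (hF : F.IsEliminationForest G) {r : V} :
    ∀ (p : List V) (a v : V), F.IsAncestor r a → (a :: p).IsChain G.Adj →
      (∀ x ∈ p, F.level r < F.level x) → (a :: p).getLast? = some v → F.IsAncestor r v := by
  intro p
  induction p with
  | nil =>
    intro a v ha _ _ hv
    simp at hv
    exact hv ▸ ha
  | cons b p ih =>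
    intro a v ha hc hp hv
    rw [List.isChain_cons_cons] at hc
    rw [List.getLast?_cons_cons] at hv
    refine ih b v ?_ hc.2 (fun x hx => hp x (by simp [hx])) hv
    rcases hF a b hc.1 with h | h
    · exact Relation.ReflTransGen.trans ha h
    -- The edge goes up from `a` to `b`. Then `b` and `r` are ancestors of `a`; were `b` properly
    -- above `r`, its level would be too small.
    · rcases ha.comparable h with h | h
      · exact h
      · have := hp b (by simp)
        by_cases hbr : b = r
        · rw [hbr]; exact Relation.ReflTransGen.refl
        · have := level_lt h hbr
          omega

/-- Dijkstra's algorithm on the vertices of level at least `j` respects the edges into the vertices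
of level `j`, although it does not use them. -/
theorem IsEliminationForest.label_le (hF : F.IsEliminationForest G)
    (hw : ¬ HasNegativeCycle G w) {j : ℕ} {D : Set V} {ord : V → ℕ}
    {d φ init : V → ℝ} {par : V → Option V}
    (h : ∀ v ∈ D, (j ≤ F.level v ∧ d v = init v ∧ par v = none) ∨
      ∃ u ∈ D, G.Adj u v ∧ j < F.level v ∧ par v = some u ∧ d v = d u + (φ u + w u v - φ v) ∧
        ord u < ord v ∧ 0 ≤ φ u + w u v - φ v)
    (hinit : ∀ v, j < F.level v → init v = 0)
    (hinit' : ∀ u r, G.Adj u r → j < F.level u → F.level r = j → init r ≤ φ u + w u r - φ r)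
    {u r : V} (hu : u ∈ D) (hr : r ∈ D) (hur : G.Adj u r) (hlu : j < F.level u)
    (hlr : F.level r = j) : d r ≤ d u + (φ u + w u r - φ r) := by
  -- Edges into level `j` are not used, so `r` has no tree parent and keeps its start label.
  have hdr : d r = init r := by
    rcases h r hr with h | ⟨u', -, -, h, -⟩
    · exact h.2.1
    · omega
  obtain ⟨r', p, h1, -, -, h2, h3, h4, h5, -, h6, h7⟩ := exists_tree_path h u hu
  -- A source of greater level starts at 0, so `0 ≤ d u`, and the start label of `r` already
  -- respects the edge `ur`.
  by_cases hr' : j < F.level r'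
  · have := hinit' u r hur hlu hlr
    rw [hinit r' hr'] at h7
    linarith
  · have hr' : F.level r' = j := by omega
    have hc : (r' :: p).IsChain G.Adj := h2.imp fun _ _ h => h.2
    have hanc := hF.isAncestor_of_isChain p r' u Relation.ReflTransGen.refl hc
      (fun x hx => by rw [hr']; exact h4 x hx) h3
    have hanc' : F.IsAncestor r u := by
      rcases hF u r hur with h | h
      · by_cases hur' : u = r
        · rw [hur']; exact Relation.ReflTransGen.refl
        · have := level_lt h hur'
          omega
      · exact h
    -- Two ancestors of `u` on the same level coincide.
    have hrr : r = r' := by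
      by_contra hne
      rcases hanc.comparable hanc' with h | h
      · have := level_lt h (Ne.symm hne); omega
      · have := level_lt h hne; omega
    subst hrr
    -- The only use of the absence of negative cycles: the tree path from `r` to `u`, simple by the
    -- finishing order, closed by the edge `ur`.
    have hcyc : 0 ≤ weight w (r :: p ++ [r]) := by
      by_contra hneg
      refine hw ⟨r, p, ⟨h5, ?_⟩, not_le.1 hneg⟩
      rw [List.isChain_append]
      refine ⟨hc, by simp, ?_⟩
      intro x hx y hy
      rw [h3] at hx
      simp at hx hy
      subst hx hy
      exact hur
    rw [weight_append_singleton w h3] at hcyc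
    linarith

end RootedForest

end TreeDepth

/-! ### Counting loops -/

namespace RAM

/-- Run `c` with register `x` equal to `0, 1, …, b - 1`, where `b` is the value of register `y`. -/
def Cmd.forLoop (x y : ℕ) (c : Cmd) : Cmd :=
  .block [.iset x (.const 0),
    .loop (.ilt (.reg x) (.reg y)) (.block [c, .iset x (.succ (.reg x))])]

/-- The invariant is indexed by the counter and must tolerate overwriting its register, by `hI`.
Each round adds 7 steps to the body: 3 for the test, 3 for the increment, 1 for the end of the
block. The final 6 are initialization, last test and end of block. -/
theorem wp_forLoop {x y : ℕ} {c : Cmd} {σ : State} (I : ℕ → State → ℕ → Prop) {ψ₀ : ℕ} (T : ℕ)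
    (hxy : x ≠ y) (hx : (0, x) ∉ c.writes) (hy : (0, y) ∉ c.writes)
    (hI : ∀ i τ ψ k, I i τ ψ → I i (τ.iset x k) ψ) (h₀ : I 0 σ ψ₀)
    (hstep : ∀ i τ ψ, i < σ.ireg y → I i τ ψ → τ.ireg x = i → Frame ((0, x) :: c.writes) σ τ →
      WP c τ fun t υ => ∃ ψ', I (i + 1) υ ψ' ∧ t + ψ' ≤ ψ + T) :
    WP (.forLoop x y c) σ fun t τ => ∃ ψ, I (σ.ireg y) τ ψ ∧
      Frame ((0, x) :: c.writes) σ τ ∧ t + ψ ≤ ψ₀ + (T + 7) * σ.ireg y + 6 := by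
  have hF₀ : Frame ((0, x) :: c.writes) σ (σ.iset x 0) :=
    (Exec.iset σ x (.const 0)).frame.mono (by simp [Cmd.writes])
  have hw : (Cmd.block [c, .iset x (.succ (.reg x))]).writes ⊆ (0, x) :: c.writes := by
    simp [Cmd.block, Cmd.writes]
  rw [Cmd.forLoop, wp_block_cons, wp_iset, wp_block_cons]
  refine (wp_loop (φ₀ := ψ₀ + (T + 7) * σ.ireg y) (fun τ φ => ∃ i ψ, I i τ ψ ∧ τ.ireg x = i ∧
    i ≤ σ.ireg y ∧ φ = ψ + (T + 7) * (σ.ireg y - i)) ?_ ?_).mono ?_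
  · exact ⟨0, ψ₀, hI _ _ _ _ h₀, by simp, by simp, by simp⟩
  · rintro τ φ ⟨i, ψ, hi, hxi, hle, rfl⟩ hF hb
    have hF' := hF₀.trans (hF.mono hw)
    have hy' : τ.ireg y = σ.ireg y := hF'.ireg y (by simp [hy, hxy.symm])
    simp [hxi, hy'] at hb
    rw [wp_block_cons]
    refine (hstep i τ ψ hb hi hxi hF').frame.mono ?_
    rintro t υ ⟨⟨ψ', h1, h2⟩, h3⟩
    have hx' : υ.ireg x = i := (h3.ireg x hx).trans hxi
    simp only [wp_block_cons, wp_iset, wp_block_nil]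
    refine ⟨_, ⟨i + 1, ψ', hI _ _ _ _ h1, ?_, by omega, rfl⟩, ?_⟩
    · simp [hx']
    · obtain ⟨k, hk⟩ : ∃ k, σ.ireg y - i = k + 1 := ⟨σ.ireg y - i - 1, by omega⟩
      rw [hk, show σ.ireg y - (i + 1) = k by omega]
      simp
      ring_nf
      omega
  · rintro t τ ⟨φ, ⟨i, ψ, h1, h2, h3, rfl⟩, hb, hF, ht⟩
    have hF' := hF₀.trans (hF.mono hw)
    have hy' : τ.ireg y = σ.ireg y := hF'.ireg y (by simp [hy, hxy.symm])
    simp [h2, hy'] at hb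
    obtain rfl : i = σ.ireg y := by omega
    simp at ht ⊢
    exact ⟨ψ, h1, hF', by omega⟩

end RAM

/-! ## The program -/

/-- Build adjacency lists: integer array `5` holds the first entry of the list of each vertex,
integer array `6` the next entry; edge `e` is represented by `e + 1`. -/
def buildAdjacency : Cmd :=
  .forLoop 6 1 (.block
    [.iput 6 (.succ (.reg 6)) (.get 5 (.get 0 (.reg 6))),
     .iput 5 (.get 0 (.reg 6)) (.succ (.reg 6))])

/-- Compute the level of each vertex in integer array `4`, and the maximum level in
register `3`. -/
def computeLevels : Cmd :=
  .forLoop 5 0 (.block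
    [.iset 13 (.succ (.reg 5)),
     .iset 12 (.const 0),
     .loop (.ilt (.const 0) (.reg 13)) (.block
       [.iset 12 (.succ (.reg 12)), .iset 13 (.get 2 (.pred (.reg 13)))]),
     .iput 4 (.reg 5) (.reg 12),
     .ite (.ilt (.reg 3) (.reg 12)) (.iset 3 (.reg 12)) .skip])

/-- Reset the labels, the parents and the heap. -/
def resetLabels : Cmd :=
  .block [.iset 7 (.const 0), .iset 8 (.const 0), .iset 9 (.const 0),
    .forLoop 5 0 (.block
      [.iput 7 (.reg 5) (.const 0), .rput 2 (.reg 5) .zero, .iput 3 (.reg 5) (.const 0)])]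

/-- Raise the potentials of the vertices at the current level so that the edges to higher levels
have nonnegative reduced length. -/
def raisePotentials : Cmd :=
  .forLoop 6 1 (.block
    [.iset 16 (.get 0 (.reg 6)),
     .iset 17 (.get 1 (.reg 6)),
     .ite (.and (.ieq (.get 4 (.reg 16)) (.reg 4)) (.ilt (.reg 4) (.get 4 (.reg 17))))
       (.block
         [.rset 0 (.sub (.get 1 (.reg 17)) (.get 0 (.reg 6))),
          .ite (.rlt (.get 1 (.reg 16)) (.reg 0)) (.rput 1 (.reg 16) (.reg 0)) .skip])
       .skip])

/-- Lower the labels of the vertices at the current level to the reduced lengths of the edges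
from higher levels. -/
def lowerLabels : Cmd :=
  .forLoop 6 1 (.block
    [.iset 16 (.get 0 (.reg 6)),
     .iset 17 (.get 1 (.reg 6)),
     .ite (.and (.ieq (.get 4 (.reg 17)) (.reg 4)) (.ilt (.reg 4) (.get 4 (.reg 16))))
       (.block
         [.rset 0 (.sub (.add (.get 1 (.reg 16)) (.get 0 (.reg 6))) (.get 1 (.reg 17))),
          .ite (.rlt (.reg 0) (.get 2 (.reg 17))) (.rput 2 (.reg 17) (.reg 0)) .skip])
       .skip])

/-- Insert all vertices of at least the current level into the heap. -/
def insertSeeds : Cmd :=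
  .forLoop 5 0 (.ite (.ilt (.get 4 (.reg 5)) (.reg 4)) .skip
    (.block [.iset 17 (.reg 5), decreaseKey]))

/-- Add the labels to the potentials of all vertices of at least the current level. -/
def addLabels : Cmd :=
  .forLoop 5 0 (.ite (.ilt (.get 4 (.reg 5)) (.reg 4)) .skip
    (.rput 1 (.reg 5) (.add (.get 1 (.reg 5)) (.get 2 (.reg 5)))))

/-- Extend the potential to the vertices of the current level. -/
def levelStep : Cmd :=
  .block [resetLabels, raisePotentials, lowerLabels, insertSeeds, dijkstra, addLabels,
    .iset 4 (.pred (.reg 4))]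

/-- Single-source shortest paths by means of an elimination forest. -/
def shortestPathTree : Cmd :=
  .block [buildAdjacency, computeLevels, .iset 4 (.reg 3),
    .loop (.ilt (.const 0) (.reg 4)) levelStep,
    resetLabels, .iset 17 (.reg 2), decreaseKey, dijkstra]

/-! ### Specifications of the initialization and of the passes over a level -/

/-- Edge `i` is put in front of the list of its tail under the name `i + 1`, which leaves 0 as the
end mark. Earlier entries are at most `i`, so writing the link at `i + 1` disturbs no list. -/
theorem buildAdjacency_spec {σ : State} (h5 : ∀ u, σ.iarr 5 u = 0) :
    WP buildAdjacency σ fun t τ => (∀ u, ∃ l : List ℕ, Linked (τ.iarr 6) (τ.iarr 5 u) l ∧ l.Nodup ∧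
      ∀ i, i ∈ l ↔ ∃ e < σ.ireg 1, i = e + 1 ∧ σ.iarr 0 e = u) ∧
      t ≤ 30 * σ.ireg 1 + 6 := by
  refine (wp_forLoop (ψ₀ := 0) (fun k τ ψ => ψ = 0 ∧ ∀ u, ∃ l : List ℕ,
      Linked (τ.iarr 6) (τ.iarr 5 u) l ∧ l.Nodup ∧
      ∀ i, i ∈ l ↔ ∃ e < k, i = e + 1 ∧ σ.iarr 0 e = u) 23 (by decide) (by decide) (by decide)
      (fun i τ ψ k h => h) ?_ ?_).mono ?_
  · exact ⟨rfl, fun u => ⟨[], h5 u, by simp, by simp⟩⟩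
  · rintro i τ ψ hi ⟨rfl, h⟩ hx hF
    have e0 : τ.iarr 0 = σ.iarr 0 := hF.iarr 0 (by decide)
    refine WP.of_forall fun Q hQ => ?_
    simp [hx, e0]
    refine hQ _ _ ⟨0, ⟨rfl, ?_⟩, by simp⟩
    intro u
    obtain ⟨l, h1, h2, h3⟩ := h u
    have hne : ∀ (u : ℕ) (l : List ℕ), (∀ k, k ∈ l ↔ ∃ e < i, k = e + 1 ∧ σ.iarr 0 e = u) → ∀ y ∈ l, y ≠ i + 1 := by
      intro u l h3 y hy
      obtain ⟨e, he, rfl, -⟩ := (h3 y).1 hy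
      omega
    have h1' : ∀ k, Linked (Function.update (τ.iarr 6) (i + 1) k) (τ.iarr 5 u) l := fun k =>
      h1.congr fun y hy => Function.update_of_ne (hne u l h3 y hy) _ _
    simp
    by_cases hu : u = σ.iarr 0 i
    · subst hu
      refine ⟨(i + 1) :: l, ?_, ?_, ?_⟩
      · rw [Function.update_self]
        refine ⟨rfl, by omega, ?_⟩
        rw [Function.update_self]
        exact h1' _
      · exact List.nodup_cons.2 ⟨fun hm => hne _ l h3 _ hm rfl, h2⟩
      · intro k
        rw [List.mem_cons, h3]
        constructor
        · rintro (rfl | ⟨e, he, rfl, he'⟩)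
          · exact ⟨i, by omega, rfl, rfl⟩
          · exact ⟨e, by omega, rfl, he'⟩
        · rintro ⟨e, he, rfl, he'⟩
          by_cases hei : e = i
          · exact Or.inl (by omega)
          · exact Or.inr ⟨e, by omega, rfl, he'⟩
    · refine ⟨l, ?_, h2, ?_⟩
      · rw [Function.update_of_ne hu]
        exact h1' _
      · intro k
        rw [h3]
        constructor
        · rintro ⟨e, he, rfl, he'⟩
          exact ⟨e, by omega, rfl, he'⟩
        · rintro ⟨e, he, rfl, he'⟩
          by_cases hei : e = i
          · rw [hei] at he'
            exact absurd he'.symm hu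
          · exact ⟨e, by omega, rfl, he'⟩
  · rintro t τ ⟨ψ, ⟨rfl, h⟩, -, ht⟩
    exact ⟨h, by omega⟩

/-- Each vertex climbs to its root, at a cost proportional to its level; the total, of order depth
times `n`, is within the budget. Climbing preserves the sum of the counter and the level of the
current vertex. The stored code `u + 1` of a parent serves directly as cursor. -/
theorem computeLevels_spec {n : ℕ} {F : TreeDepth.RootedForest (Fin n)} {σ : State}
    (hn : σ.ireg 0 = n) (hp : ∀ v : Fin n, σ.iarr 2 v = TreeDepth.encode (F.parent v))
    (h3 : σ.ireg 3 = 0) :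
    WP computeLevels σ fun t τ => (∀ v : Fin n, τ.iarr 4 v = F.level v) ∧
      (∀ v : Fin n, F.level v ≤ τ.ireg 3) ∧ τ.ireg 3 ≤ F.depth ∧
      t ≤ (20 * F.depth + 40) * n + 6 := by
  refine (wp_forLoop (ψ₀ := 0) (fun k τ ψ => ψ = 0 ∧ (∀ v : Fin n, v < k → τ.iarr 4 v = F.level v) ∧
    (∀ v : Fin n, v < k → F.level v ≤ τ.ireg 3) ∧ τ.ireg 3 ≤ F.depth) (20 * F.depth + 33)
    (by decide) (by decide) (by decide) (fun i τ ψ k h => by simpa using h) ?_ ?_).mono ?_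
  · exact ⟨rfl, by simp, by simp, by simp [h3]⟩
  · rintro i τ ψ hi ⟨rfl, h1, h2, h4⟩ hx hF
    rw [hn] at hi
    have e2 : τ.iarr 2 = σ.iarr 2 := hF.iarr 2 (by decide)
    rw [wp_block_cons, wp_iset, wp_block_cons, wp_iset, wp_block_cons]
    refine (wp_loop (φ₀ := 13 * F.level ⟨i, hi⟩) (fun υ ψ =>
      (υ.ireg 13 = 0 ∧ υ.ireg 12 = F.level ⟨i, hi⟩ ∧ ψ = 0) ∨
      ∃ x : Fin n, υ.ireg 13 = x + 1 ∧ υ.ireg 12 + F.level x = F.level ⟨i, hi⟩ ∧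
        ψ = 13 * F.level x) ?_ ?_).mono ?_
    · exact Or.inr ⟨⟨i, hi⟩, by simp [hx], by simp, rfl⟩
    · rintro υ φ (⟨g1, -⟩ | ⟨x, g1, g2, rfl⟩) hF' hb
      · simp [g1] at hb
      · have e2' : υ.iarr 2 = σ.iarr 2 := by rw [← e2]; exact hF'.iarr 2 (by decide)
        refine WP.of_forall fun Q hQ => ?_
        simp [g1, e2', hp]
        cases hpx : F.parent x with
        | none =>
          rw [TreeDepth.RootedForest.level_root hpx] at g2 hQ
          exact hQ _ _ ⟨0, Or.inl ⟨by simp [TreeDepth.encode], by simpa using g2, rfl⟩, by simp⟩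
        | some u =>
          rw [TreeDepth.RootedForest.level_parent hpx] at g2 hQ
          refine hQ _ _ ⟨13 * F.level u, Or.inr ⟨u, by simp [TreeDepth.encode], ?_, rfl⟩, ?_⟩
          · simp; omega
          · simp; omega
    · rintro t υ ⟨ψ, hor, hb, hF', ht⟩
      simp at hb
      rcases hor with ⟨-, hl, rfl⟩ | ⟨x, g1, -⟩
      swap
      · omega
      have i3 : υ.ireg 3 = τ.ireg 3 := by simpa using hF'.ireg 3 (by decide)
      have i5 : υ.ireg 5 = i := by rw [← hx]; simpa using hF'.ireg 5 (by decide)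
      have a4 : υ.iarr 4 = τ.iarr 4 := by simpa using hF'.iarr 4 (by decide)
      have hle := F.level_le_depth ⟨i, hi⟩
      have hlev : ∀ v : Fin n, v < i + 1 →
          Function.update (τ.iarr 4) i (F.level ⟨i, hi⟩) v = F.level v := by
        intro v hv
        by_cases hvi : (v : ℕ) = i
        · subst hvi; simp
        · rw [Function.update_of_ne hvi]
          exact h1 v (by omega)
      simp at ht
      refine WP.of_forall fun Q hQ => ?_
      simp [i3, i5, hl]
      constructor
      · intro hlt
        refine hQ _ _ ⟨0, ⟨rfl, ?_, ?_, ?_⟩, ?_⟩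
        · simpa [a4] using hlev
        · intro v hv
          by_cases hvi : (v : ℕ) = i
          · subst hvi; simp
          · have := h2 v (by omega)
            simp; omega
        · simpa using hle
        · simp; omega
      · intro hlt
        refine hQ _ _ ⟨0, ⟨rfl, ?_, ?_, ?_⟩, ?_⟩
        · simpa [a4] using hlev
        · intro v hv
          by_cases hvi : (v : ℕ) = i
          · subst hvi; simp [i3]; omega
          · have := h2 v (by omega)
            simp [i3]; omega
        · simpa [i3] using h4
        · simp; omega
  · rintro t τ ⟨ψ, ⟨rfl, h1, h2, h4⟩, -, ht⟩
    rw [hn] at h1 h2 ht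
    exact ⟨fun v => h1 v v.2, fun v => h2 v v.2, h4, by linarith⟩

theorem resetLabels_spec {σ : State} (hσ : Clean σ) {M : ℕ} (hM : 1 ≤ M) :
    WP resetLabels σ fun t τ => IsHeap τ M ∅ (τ.rarr 2) 0 ∧ τ.ireg 7 = 0 ∧
      (∀ v < σ.ireg 0, τ.iarr 7 v = 0) ∧ (∀ v < σ.ireg 0, τ.rarr 2 v = 0) ∧
      (∀ v < σ.ireg 0, τ.iarr 3 v = 0) ∧ t ≤ 30 * σ.ireg 0 + 30 := by
  rw [resetLabels, wp_block_cons, wp_iset, wp_block_cons, wp_iset, wp_block_cons, wp_iset,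
    wp_block_cons]
  refine (wp_forLoop (ψ₀ := 0) (fun k τ ψ => ψ = 0 ∧ (∀ v < k, τ.iarr 7 v = 0) ∧
    (∀ v < k, τ.rarr 2 v = 0) ∧ (∀ v < k, τ.iarr 3 v = 0)) 20
    (by decide) (by decide) (by decide) (fun i τ ψ k h => by simpa using h) ?_ ?_).mono ?_
  · simp
  · rintro i τ ψ hi ⟨rfl, h1, h2, h3⟩ hx hF
    refine WP.of_forall fun Q hQ => ?_
    simp [hx]
    refine hQ _ _ ⟨0, ⟨rfl, ?_, ?_, ?_⟩, by simp⟩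
    all_goals
      intro v hv
      simp
      by_cases hvi : v = i
      · simp [hvi]
      · rw [Function.update_of_ne hvi]
        first
        | exact h1 v (by omega)
        | exact h2 v (by omega)
        | exact h3 v (by omega)
  · rintro t τ ⟨ψ, ⟨rfl, h1, h2, h3⟩, hF, ht⟩
    simp at h1 h2 h3 ht ⊢
    have i7 : τ.ireg 7 = 0 := by simpa using hF.ireg 7 (by decide)
    refine ⟨?_, i7, h1, h2, h3, by omega⟩
    refine Clean.isHeap (hσ.congr ?_ ?_ ?_ ?_) ?_ ?_ hM _
    · simpa using hF.iarr 9 (by decide)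
    · simpa using hF.iarr 10 (by decide)
    · simpa using hF.iarr 11 (by decide)
    · simpa using hF.iarr 13 (by decide)
    · simpa using hF.ireg 8 (by decide)
    · simpa using hF.ireg 9 (by decide)

/-- Only tails at the current level are raised, and heads of the edges concerned lie at greater
levels, hence are fixed. Raising a tail again can only increase the reduced lengths already
repaired, so the starting values are irrelevant. -/
theorem raisePotentials_spec {σ : State} :
    WP raisePotentials σ fun t τ =>
      (∀ v, σ.iarr 4 v ≠ σ.ireg 4 → τ.rarr 1 v = σ.rarr 1 v) ∧
      (∀ e < σ.ireg 1, σ.iarr 4 (σ.iarr 0 e) = σ.ireg 4 → σ.ireg 4 < σ.iarr 4 (σ.iarr 1 e) →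
        0 ≤ τ.rarr 1 (σ.iarr 0 e) + σ.rarr 0 e - τ.rarr 1 (σ.iarr 1 e)) ∧
      t ≤ 60 * σ.ireg 1 + 6 := by
  refine (wp_forLoop (ψ₀ := 0) (fun k τ ψ => ψ = 0 ∧
      (∀ v, σ.iarr 4 v ≠ σ.ireg 4 → τ.rarr 1 v = σ.rarr 1 v) ∧
      (∀ e < k, σ.iarr 4 (σ.iarr 0 e) = σ.ireg 4 → σ.ireg 4 < σ.iarr 4 (σ.iarr 1 e) →
        0 ≤ τ.rarr 1 (σ.iarr 0 e) + σ.rarr 0 e - τ.rarr 1 (σ.iarr 1 e))) 50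
      (by decide) (by decide) (by decide) (fun i τ ψ k h => h) ?_ ?_).mono ?_
  · simp
  · rintro i τ ψ hi ⟨rfl, h1, h2⟩ hx hF
    have a0 : τ.iarr 0 = σ.iarr 0 := hF.iarr 0 (by decide)
    have a1 : τ.iarr 1 = σ.iarr 1 := hF.iarr 1 (by decide)
    have a4 : τ.iarr 4 = σ.iarr 4 := hF.iarr 4 (by decide)
    have i4 : τ.ireg 4 = σ.ireg 4 := hF.ireg 4 (by decide)
    have r0 : τ.rarr 0 = σ.rarr 0 := hF.rarr 0 (by decide)
    refine WP.of_forall fun Q hQ => ?_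
    simp [hx, a0, a1, a4, i4, r0]
    refine ⟨fun hl hl' => ⟨fun hlt => ?_, fun hlt => ?_⟩, fun hl => ?_⟩
    · refine hQ _ _ ⟨0, ⟨rfl, ?_, ?_⟩, by simp⟩
      · intro v hv
        have : v ≠ σ.iarr 0 i := by rintro rfl; exact hv hl
        simp [this, h1 v hv]
      · intro e he he1 he2
        have h3 : σ.iarr 1 e ≠ σ.iarr 0 i := by intro e; rw [e] at he2; omega
        simp [h3]
        by_cases hei : σ.iarr 0 e = σ.iarr 0 i
        · rw [hei, Function.update_self]
          by_cases hei' : e = i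
          · rw [hei']; simp
          · have := h2 e (by omega) he1 he2
            rw [hei] at this
            linarith
        · rw [Function.update_of_ne hei]
          refine sub_nonneg.1 (h2 e ?_ he1 he2)
          have : e ≠ i := by rintro rfl; exact hei rfl
          omega
    · refine hQ _ _ ⟨0, ⟨rfl, by simpa using h1, ?_⟩, by simp⟩
      intro e he he1 he2
      simp
      by_cases hei : e = i
      · rw [hei]; linarith
      · have := h2 e (by omega) he1 he2
        linarith
    · refine hQ _ _ ⟨0, ⟨rfl, by simpa using h1, ?_⟩, by simp⟩
      intro e he he1 he2
      simp
      by_cases hei : e = i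
      · subst hei
        have := hl he1
        omega
      · have := h2 e (by omega) he1 he2
        linarith
  · rintro t τ ⟨ψ, ⟨rfl, h1, h2⟩, -, ht⟩
    exact ⟨h1, h2, by omega⟩

/-- Labels at the current level only decrease during the pass and potentials do not change, so each
bound persists once established. -/
theorem lowerLabels_spec {σ : State} :
    WP lowerLabels σ fun t τ =>
      (∀ v, σ.iarr 4 v ≠ σ.ireg 4 → τ.rarr 2 v = σ.rarr 2 v) ∧
      (∀ e < σ.ireg 1, σ.iarr 4 (σ.iarr 1 e) = σ.ireg 4 → σ.ireg 4 < σ.iarr 4 (σ.iarr 0 e) →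
        τ.rarr 2 (σ.iarr 1 e) ≤ σ.rarr 1 (σ.iarr 0 e) + σ.rarr 0 e - σ.rarr 1 (σ.iarr 1 e)) ∧
      t ≤ 60 * σ.ireg 1 + 6 := by
  refine (wp_forLoop (ψ₀ := 0) (fun k τ ψ => ψ = 0 ∧
      (∀ v, σ.iarr 4 v ≠ σ.ireg 4 → τ.rarr 2 v = σ.rarr 2 v) ∧
      (∀ e < k, σ.iarr 4 (σ.iarr 1 e) = σ.ireg 4 → σ.ireg 4 < σ.iarr 4 (σ.iarr 0 e) →
        τ.rarr 2 (σ.iarr 1 e) ≤ σ.rarr 1 (σ.iarr 0 e) + σ.rarr 0 e - σ.rarr 1 (σ.iarr 1 e))) 50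
      (by decide) (by decide) (by decide) (fun i τ ψ k h => h) ?_ ?_).mono ?_
  · simp
  · rintro i τ ψ hi ⟨rfl, h1, h2⟩ hx hF
    have a0 : τ.iarr 0 = σ.iarr 0 := hF.iarr 0 (by decide)
    have a1 : τ.iarr 1 = σ.iarr 1 := hF.iarr 1 (by decide)
    have a4 : τ.iarr 4 = σ.iarr 4 := hF.iarr 4 (by decide)
    have i4 : τ.ireg 4 = σ.ireg 4 := hF.ireg 4 (by decide)
    have r0 : τ.rarr 0 = σ.rarr 0 := hF.rarr 0 (by decide)
    have r1 : τ.rarr 1 = σ.rarr 1 := hF.rarr 1 (by decide)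
    refine WP.of_forall fun Q hQ => ?_
    simp [hx, a0, a1, a4, i4, r0, r1]
    refine ⟨fun hl hl' => ⟨fun hlt => ?_, fun hlt => ?_⟩, fun hl => ?_⟩
    · refine hQ _ _ ⟨0, ⟨rfl, ?_, ?_⟩, by simp⟩
      · intro v hv
        have : v ≠ σ.iarr 1 i := by rintro rfl; exact hv hl
        simp [this, h1 v hv]
      · intro e he he1 he2
        simp
        by_cases hei : σ.iarr 1 e = σ.iarr 1 i
        · rw [hei, Function.update_self]
          by_cases hei' : e = i
          · rw [hei']
          · have := h2 e (by omega) he1 he2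
            rw [hei] at this
            linarith
        · rw [Function.update_of_ne hei]
          refine h2 e ?_ he1 he2
          have : e ≠ i := by rintro rfl; exact hei rfl
          omega
    · refine hQ _ _ ⟨0, ⟨rfl, by simpa using h1, ?_⟩, by simp⟩
      intro e he he1 he2
      simp
      by_cases hei : e = i
      · rw [hei]; exact hlt
      · exact h2 e (by omega) he1 he2
    · refine hQ _ _ ⟨0, ⟨rfl, by simpa using h1, ?_⟩, by simp⟩
      intro e he he1 he2
      simp
      by_cases hei : e = i
      · subst hei
        have := hl he1
        omega
      · exact h2 e (by omega) he1 he2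
  · rintro t τ ⟨ψ, ⟨rfl, h1, h2⟩, -, ht⟩
    exact ⟨h1, h2, by omega⟩

theorem insertSeeds_spec {σ : State} {M : ℕ} (h : IsHeap σ M ∅ (σ.rarr 2) 0) (h7 : σ.ireg 7 = 0)
    (hn : ∀ v < σ.ireg 0, σ.iarr 7 v = 0) :
    WP insertSeeds σ fun t τ => ∃ φ,
      IsHeap τ M ((Finset.range (σ.ireg 0)).filter fun v => σ.ireg 4 ≤ σ.iarr 4 v) (σ.rarr 2) φ ∧
      τ.ireg 7 ≤ σ.ireg 0 ∧
      (∀ v < σ.ireg 0, τ.iarr 7 v = 0 ↔ ¬ σ.ireg 4 ≤ σ.iarr 4 v) ∧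
      t + φ ≤ 600 * σ.ireg 0 + 6 := by
  refine (wp_forLoop (ψ₀ := 0) (fun k τ ψ =>
      IsHeap τ M ((Finset.range k).filter fun v => σ.ireg 4 ≤ σ.iarr 4 v) (σ.rarr 2) ψ ∧
      τ.ireg 7 ≤ k ∧
      (∀ v < σ.ireg 0, τ.iarr 7 v = 0 ↔ ¬ (v < k ∧ σ.ireg 4 ≤ σ.iarr 4 v))) 550
      (by decide) (by decide) (by decide) (fun i τ ψ k h => ?_) ?_ ?_).mono ?_
  · refine ⟨h.1.congr ?_ ?_ ?_ ?_ ?_ ?_ ?_ ?_ ?_ ?_ ?_, ?_, ?_⟩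
    all_goals simp
    · exact h.2.1
    · simpa using h.2.2
  · exact ⟨by simpa using h, by simp [h7], by simpa using hn⟩
  · rintro i τ ψ hi ⟨h1, h2, h3⟩ hx hF
    have a4 : τ.iarr 4 = σ.iarr 4 := hF.iarr 4 (by decide)
    have i4 : τ.ireg 4 = σ.ireg 4 := hF.ireg 4 (by decide)
    have r2 : τ.rarr 2 = σ.rarr 2 := hF.rarr 2 (by decide)
    rw [wp_ite]
    simp only [BExpr.holds, IExpr.eval, hx, a4, i4]
    constructor
    · intro hlt
      rw [wp_skip]
      refine ⟨ψ, ⟨?_, by omega, ?_⟩, by simp; omega⟩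
      · rwa [Finset.range_add_one, Finset.filter_insert, if_neg (by omega)]
      · intro v hv
        rw [h3 v hv]
        by_cases hvi : v = i
        · subst hvi; omega
        · omega
    · intro hlt
      rw [wp_block_cons, wp_iset, wp_block_cons]
      have hi' : i ∉ (Finset.range i).filter fun v => σ.ireg 4 ≤ σ.iarr 4 v := by simp
      refine (decreaseKey_spec (v := i) (σ := τ.iset 17 ((IExpr.reg 5).eval τ)) (φ := ψ)
        (h1.congr ?_ ?_ ?_ ?_ ?_ ?_ ?_ ?_ ?_ ?_ ?_) (by simp [hx])
        (Or.inr ⟨hi', (h3 i hi).2 (by omega)⟩)).mono ?_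
      iterate 11 simp
      rintro t υ ⟨φ', g1, g2, g3, g4⟩
      simp [r2] at g2 g3 g4
      rw [wp_block_nil]
      refine ⟨φ', ⟨?_, by omega, ?_⟩, by simp; omega⟩
      · rwa [Finset.range_add_one, Finset.filter_insert, if_pos (by omega)]
      · intro v hv
        rw [g4, Function.update_apply]
        split_ifs with hvi
        · subst hvi; simp; omega
        · rw [h3 v hv]; omega
  · rintro t τ ⟨φ, ⟨h1, h2, h3⟩, -, ht⟩
    refine ⟨φ, h1, h2, ?_, by omega⟩
    intro v hv
    rw [h3 v hv]
    simp [hv]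

theorem addLabels_spec {σ : State} :
    WP addLabels σ fun t τ =>
      (∀ v < σ.ireg 0, σ.ireg 4 ≤ σ.iarr 4 v → τ.rarr 1 v = σ.rarr 1 v + σ.rarr 2 v) ∧
      t ≤ 40 * σ.ireg 0 + 6 := by
  refine (wp_forLoop (ψ₀ := 0) (fun k τ ψ => ψ = 0 ∧ ∀ v < σ.ireg 0, σ.ireg 4 ≤ σ.iarr 4 v →
      τ.rarr 1 v = if v < k then σ.rarr 1 v + σ.rarr 2 v else σ.rarr 1 v) 30
      (by decide) (by decide) (by decide) (fun i τ ψ k h => h) ?_ ?_).mono ?_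
  · simp
  · rintro i τ ψ hi ⟨rfl, h⟩ hx hF
    have a4 : τ.iarr 4 = σ.iarr 4 := hF.iarr 4 (by decide)
    have i4 : τ.ireg 4 = σ.ireg 4 := hF.ireg 4 (by decide)
    have r2 : τ.rarr 2 = σ.rarr 2 := hF.rarr 2 (by decide)
    refine WP.of_forall fun Q hQ => ?_
    simp [hx, a4, i4, r2]
    refine ⟨fun hlt => ?_, fun hlt => ?_⟩
    · refine hQ _ _ ⟨0, ⟨rfl, ?_⟩, by simp⟩
      intro v hv hj
      rw [h v hv hj]
      have : v ≠ i := by rintro rfl; omega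
      congr 1
      simp; omega
    · refine hQ _ _ ⟨0, ⟨rfl, ?_⟩, by simp⟩
      intro v hv hj
      have := h v hv hj
      simp [Function.update_apply]
      by_cases hvi : v = i
      · subst hvi
        simp [this]
      · rw [if_neg hvi, this]
        congr 1
        simp; omega
  · rintro t τ ⟨ψ, ⟨rfl, h⟩, -, ht⟩
    refine ⟨fun v hv hj => ?_, by omega⟩
    rw [h v hv hj, if_pos hv]

/-! ## Correctness and running time -/

namespace TreeDepth

/-- Inverse of `encode`. -/
def decode (n k : ℕ) : Option (Fin n) :=
  if h : 0 < k ∧ k ≤ n then some ⟨k - 1, by omega⟩ else none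

theorem decode_zero (n : ℕ) : decode n 0 = none := by simp [decode]

theorem decode_succ {n : ℕ} (u : Fin n) : decode n (u + 1) = some u := by simp [decode]

variable {n m : ℕ} {G : Digraph (Fin n)} {w : Fin n → Fin n → ℝ} {F : RootedForest (Fin n)}
  {σ τ : State}

/-- Position `i` of the edge list holds the edge from `u` to `v`. -/
structure EdgeAt (w : Fin n → Fin n → ℝ) (σ : State) (i : ℕ) (u v : Fin n) : Prop where
  tl : σ.iarr 0 i = u
  hd : σ.iarr 1 i = v
  weight : σ.rarr 0 i = w u v

/-- The graph `G` with `m` edges and its adjacency lists are stored in memory together with the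
levels of its vertices in `F`. -/
structure Loaded (m : ℕ) (G : Digraph (Fin n)) (w : Fin n → Fin n → ℝ) (F : RootedForest (Fin n))
    (σ : State) : Prop where
  n_eq : σ.ireg 0 = n
  m_eq : σ.ireg 1 = m
  adj_of_lt : ∀ i < m, ∃ u v, G.Adj u v ∧ EdgeAt w σ i u v
  exists_of_adj : ∀ u v, G.Adj u v → ∃ i < m, EdgeAt w σ i u v
  level : ∀ v : Fin n, σ.iarr 4 v = F.level v
  list : ∀ u, ∃ l : List ℕ, Linked (σ.iarr 6) (σ.iarr 5 u) l ∧ l.Nodup ∧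
    ∀ i, i ∈ l ↔ ∃ e < m, i = e + 1 ∧ σ.iarr 0 e = u

theorem Loaded.frame (h : Loaded m G w F σ) {l : List (ℕ × ℕ)} (hF : Frame l σ τ)
    (hl : ∀ x ∈ [(0, 0), (0, 1), (2, 0), (2, 1), (2, 4), (2, 5), (2, 6), (3, 0)], x ∉ l) :
    Loaded m G w F τ := by
  simp only [List.forall_mem_cons] at hl
  obtain ⟨h1, h2, h3, h4, h5, h6, h7, h8, -⟩ := hl
  have i0 := hF.ireg 0 h1
  have i1 := hF.ireg 1 h2
  have a0 := hF.iarr 0 h3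
  have a1 := hF.iarr 1 h4
  have a4 := hF.iarr 4 h5
  have a5 := hF.iarr 5 h6
  have a6 := hF.iarr 6 h7
  have r0 := hF.rarr 0 h8
  have hE : ∀ i u v, EdgeAt w σ i u v → EdgeAt w τ i u v := fun i u v h =>
    ⟨by rw [a0]; exact h.tl, by rw [a1]; exact h.hd, by rw [r0]; exact h.weight⟩
  constructor
  · rw [i0]; exact h.n_eq
  · rw [i1]; exact h.m_eq
  · intro i hi
    obtain ⟨u, v, h1, h2⟩ := h.adj_of_lt i hi
    exact ⟨u, v, h1, hE _ _ _ h2⟩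
  · intro u v huv
    obtain ⟨i, h1, h2⟩ := h.exists_of_adj u v huv
    exact ⟨i, h1, hE _ _ _ h2⟩
  · rw [a4]; exact h.level
  · rw [a0, a5, a6]; exact h.list

/-- The network searched by Dijkstra's algorithm. -/
noncomputable def network (σ : State) (S : Finset ℕ) : Net where
  n := σ.ireg 0
  m := σ.ireg 1
  j := σ.ireg 4
  tl := σ.iarr 0
  hd := σ.iarr 1
  lev := σ.iarr 4
  len e := σ.rarr 1 (σ.iarr 0 e) + σ.rarr 0 e - σ.rarr 1 (σ.iarr 1 e)
  seeds := S
  init := σ.rarr 2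

/-- The reduced length of an edge with respect to the potential in real array `1`. -/
noncomputable def redLen (w : Fin n → Fin n → ℝ) (σ : State) (u v : Fin n) : ℝ :=
  σ.rarr 1 u + w u v - σ.rarr 1 v

/-- Dijkstra's algorithm on the edges into the vertices above level `j` of the forest, started
at the vertices in `S` with the labels in real array `2`. -/
theorem search_spec (h : Loaded m G w F σ) {j L φ : ℕ} {S : Finset ℕ} (hj : σ.ireg 4 = j)
    (hφ : ∀ u v, G.Adj u v → j ≤ F.level u → j < F.level v → 0 ≤ redLen w σ u v)
    (hheap : IsHeap σ (n + m) S (σ.rarr 2) φ) (hnode : ∀ v < n, σ.iarr 7 v = 0 ↔ v ∉ S)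
    (hcount : σ.ireg 7 ≤ n) (hS : ∀ v ∈ S, v < n) (hS' : ∀ v : Fin n, (v : ℕ) ∈ S → j ≤ F.level v)
    (hpar : ∀ v < n, σ.iarr 3 v = 0) (hL : ∀ r, Nat.fib (r + 1) ≤ n + m → r ≤ L) :
    WP dijkstra σ fun t τ => Clean τ ∧ t ≤ φ + 600 * m + (400 * L + 600) * (n + 1) ∧
      ∃ (D : Set (Fin n)) (ord : Fin n → ℕ) (par : Fin n → Option (Fin n)),
        Outputs τ par ∧
        (∀ v : Fin n, (v : ℕ) ∈ S → v ∈ D ∧ τ.rarr 2 v ≤ σ.rarr 2 v) ∧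
        (∀ v ∈ D, ((v : ℕ) ∈ S ∧ τ.rarr 2 v = σ.rarr 2 v ∧ par v = none) ∨
          ∃ u ∈ D, G.Adj u v ∧ j < F.level v ∧ par v = some u ∧
            τ.rarr 2 v = τ.rarr 2 u + redLen w σ u v ∧ ord u < ord v) ∧
        (∀ u ∈ D, ∀ v, G.Adj u v → j < F.level v →
          v ∈ D ∧ τ.rarr 2 v ≤ τ.rarr 2 u + redLen w σ u v) ∧
        ∀ v, v ∉ D → par v = none := by
  have hV : (network σ S).Valid := by
    constructor
    · intro e he
      obtain ⟨u, v, -, he⟩ := h.adj_of_lt e (h.m_eq ▸ he)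
      change σ.iarr 1 e < σ.ireg 0
      rw [he.hd, h.n_eq]
      exact v.2
    · intro e he
      obtain ⟨u, v, huv, he⟩ := h.adj_of_lt e (h.m_eq ▸ he)
      change σ.ireg 4 ≤ σ.iarr 4 (σ.iarr 0 e) → σ.ireg 4 < σ.iarr 4 (σ.iarr 1 e) →
        0 ≤ σ.rarr 1 (σ.iarr 0 e) + σ.rarr 0 e - σ.rarr 1 (σ.iarr 1 e)
      rw [he.tl, he.hd, he.weight, h.level, h.level, hj]
      exact hφ u v huv
  have hSt : (network σ S).Stored σ := by
    refine ⟨rfl, rfl, rfl, fun _ => rfl, fun u _ => ?_⟩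
    change ∃ l : List ℕ, Linked (σ.iarr 6) (σ.iarr 5 u) l ∧ l.Nodup ∧
      ∀ i, i ∈ l ↔ ∃ e < σ.ireg 1, i = e + 1 ∧ σ.iarr 0 e = u
    rw [h.m_eq]
    exact h.list u
  have hlev : ∀ v ∈ S, σ.ireg 4 ≤ σ.iarr 4 v := fun v hv => by
    rw [hj, h.level ⟨v, hS v hv⟩]
    exact hS' ⟨v, hS v hv⟩ hv
  have hSe : (network σ S).Search σ ∅ S (fun _ => 0) ∅ φ := by
    constructor
    · constructor <;> simp [network, h.n_eq]
      · exact hS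
      · exact hlev
      · exact fun v hv => ⟨hv, hpar v (hS v hv)⟩
      · exact fun v hv _ => hpar v hv
    · change IsHeap σ (σ.ireg 0 + σ.ireg 1) S (σ.rarr 2) φ
      rw [h.n_eq, h.m_eq]
      exact hheap
    · simpa [network, h.n_eq] using hnode
    · simpa [network, h.n_eq] using hcount
  refine (Net.dijkstra_spec hV hSt hSe (L := L) ?_).mono ?_
  · simpa [network, h.n_eq, h.m_eq] using hL
  rintro t τ ⟨D, ord, E, hI, hE, hc, ht⟩
  simp only [network, h.n_eq, h.m_eq] at ht
  have hDn : ∀ v ∈ D, v < n := fun v hv => by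
    have := hI.lt v (by simp [hv])
    simpa [network, h.n_eq] using this
  have horig : ∀ v : Fin n, (v : ℕ) ∈ D → ((v : ℕ) ∈ S ∧ τ.rarr 2 v = σ.rarr 2 v ∧
      τ.iarr 3 v = 0) ∨ ∃ u : Fin n, (u : ℕ) ∈ D ∧ G.Adj u v ∧ j < F.level v ∧
        τ.iarr 3 v = u + 1 ∧ τ.rarr 2 v = τ.rarr 2 u + redLen w σ u v ∧ ord u < ord v := by
    intro v hv
    rcases hI.origin v (by simp [hv]) with ⟨h1, h2, h3⟩ | ⟨e, h1, h2, h3, h4, h5, h6, h7⟩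
    · exact Or.inl ⟨h1, h2, h3⟩
    · obtain ⟨a, b, hab, he⟩ := h.adj_of_lt e (h.m_eq ▸ h1)
      simp only [network, he.tl, he.hd, he.weight, hj, h.level] at h2 h3 h4 h5 h6 h7
      obtain rfl := Fin.ext h3
      exact Or.inr ⟨a, h2, hab, h4, h5, h6, h7 hv⟩
  refine ⟨hc, ht, {v | (v : ℕ) ∈ D}, fun v => ord v, fun v => decode n (τ.iarr 3 v), ?_, ?_, ?_,
    ?_, ?_⟩
  · intro v
    by_cases hv : (v : ℕ) ∈ D
    · rcases horig v hv with ⟨-, -, h⟩ | ⟨u, -, -, -, h, -⟩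
      · simp [h, decode_zero, encode]
      · simp [h, decode_succ, encode]
    · have := hI.unseen v (by simp [network, h.n_eq]) (by simpa using hv)
      simp [this, decode_zero, encode]
  · intro v hv
    exact ⟨by simpa using hI.seed_mem v hv, hI.seed_le v hv⟩
  · intro v hv
    rcases horig v hv with ⟨h1, h2, h3⟩ | ⟨u, h1, h2, h3, h4, h5⟩
    · exact Or.inl ⟨h1, h2, by simp only [h3, decode_zero]⟩
    · exact Or.inr ⟨u, h1, h2, h3, by simp only [h4, decode_succ], h5⟩
  · intro u hu v huv hv
    obtain ⟨i, hi, he⟩ := h.exists_of_adj u v huv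
    have hiE : i ∈ E := (hE i).2 ⟨by simpa [network, h.m_eq] using hi, by
      simpa [network, he.tl] using hu⟩
    have h1 := hI.edge_hd i hiE
    have h2 := hI.edge_le i hiE
    simp only [network, he.tl, he.hd, he.weight, hj, h.level] at h1 h2
    exact ⟨by simpa using h1 hv, h2 hv⟩
  · intro v hv
    have := hI.unseen v (by simp [network, h.n_eq]) (by simpa using hv)
    simp only [this, decode_zero]

/-- The potential is feasible on the edges between vertices above level `j`. -/
def Feasible (G : Digraph (Fin n)) (w : Fin n → Fin n → ℝ) (F : RootedForest (Fin n)) (j : ℕ)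
    (σ : State) : Prop :=
  ∀ u v, G.Adj u v → j < F.level u → j < F.level v → 0 ≤ redLen w σ u v

/-- The induction step of the construction: feasibility is gained on all edges that touch level `j`
and lead to or from greater levels, for the price of one multi-source search and a few linear
passes. -/
theorem levelStep_spec (hG : ∀ v, ¬ G.Adj v v) (hw : ¬ HasNegativeCycle G w)
    (hF : F.IsEliminationForest G) (h : Loaded m G w F σ) (hc : Clean σ) {j L : ℕ}
    (hj : σ.ireg 4 = j) (hj0 : 0 < j) (hf : Feasible G w F j σ) (hnm : 1 ≤ n + m)
    (hL : ∀ r, Nat.fib (r + 1) ≤ n + m → r ≤ L) :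
    WP levelStep σ fun t τ => Loaded m G w F τ ∧ Clean τ ∧ τ.ireg 4 = j - 1 ∧
      Feasible G w F (j - 1) τ ∧ t ≤ 720 * m + (400 * L + 1300) * (n + 1) := by
  rw [levelStep, wp_block_cons]
  refine (resetLabels_spec hc hnm).frame.mono ?_
  rintro t₁ σ₁ ⟨⟨a1, a2, a3, a4, a5, a6⟩, hF₁⟩
  have l₁ := h.frame hF₁ (by decide)
  have j₁ : σ₁.ireg 4 = j := (hF₁.ireg 4 (by decide)).trans hj
  have p₁ : σ₁.rarr 1 = σ.rarr 1 := hF₁.rarr 1 (by decide)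
  rw [h.n_eq] at a3 a4 a5 a6
  rw [wp_block_cons]
  refine raisePotentials_spec.frame.mono ?_
  rintro t₂ σ₂ ⟨⟨b1, b2, b3⟩, hF₂⟩
  have l₂ := l₁.frame hF₂ (by decide)
  have j₂ : σ₂.ireg 4 = j := (hF₂.ireg 4 (by decide)).trans j₁
  rw [l₁.m_eq] at b2 b3
  rw [j₁] at b1 b2
  -- Nonnegativity on every edge the search may use: edges leaving level `j` were repaired by
  -- raising, those between greater levels were feasible before and are untouched.
  have hφ₂ : ∀ u v, G.Adj u v → j ≤ F.level u → j < F.level v → 0 ≤ redLen w σ₂ u v := by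
    intro u v huv hu hv
    by_cases huj : F.level u = j
    · obtain ⟨i, hi, he⟩ := l₁.exists_of_adj u v huv
      have := b2 i hi
      rw [he.tl, he.hd, he.weight, l₁.level, l₁.level] at this
      exact this huj hv
    · rw [redLen, b1 u (by rwa [l₁.level]), b1 v (by rw [l₁.level]; omega), p₁]
      exact hf u v huv (by omega) hv
  rw [wp_block_cons]
  refine lowerLabels_spec.frame.mono ?_
  rintro t₃ σ₃ ⟨⟨c1, c2, c3⟩, hF₃⟩
  have l₃ := l₂.frame hF₃ (by decide)
  have j₃ : σ₃.ireg 4 = j := (hF₃.ireg 4 (by decide)).trans j₂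
  have p₃ : σ₃.rarr 1 = σ₂.rarr 1 := hF₃.rarr 1 (by decide)
  rw [l₂.m_eq] at c2 c3
  rw [j₂] at c1 c2
  have hF₁₃ := (hF₂.mono (List.subset_append_left _ lowerLabels.writes)).trans
    (hF₃.mono (List.subset_append_right raisePotentials.writes _))
  have hinit : ∀ v : Fin n, j < F.level v → σ₃.rarr 2 v = 0 := by
    intro v hv
    rw [c1 v (by rw [l₂.level]; omega), hF₂.rarr 2 (by decide), a4 v v.2]
  have hinit' : ∀ u r, G.Adj u r → j < F.level u → F.level r = j →
      σ₃.rarr 2 r ≤ redLen w σ₂ u r := by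
    intro u r hur hu hr
    obtain ⟨i, hi, he⟩ := l₂.exists_of_adj u r hur
    have := c2 i hi
    rw [he.tl, he.hd, he.weight, l₂.level, l₂.level] at this
    exact this hr hu
  rw [wp_block_cons]
  refine (insertSeeds_spec (σ := σ₃) (M := n + m) ?_ ?_ ?_).frame.mono ?_
  · refine (a1.congr_keys (by simp)).congr (hF₁₃.iarr 7 (by decide)) (hF₁₃.iarr 8 (by decide))
      (hF₁₃.iarr 9 (by decide)) (hF₁₃.iarr 10 (by decide)) (hF₁₃.iarr 11 (by decide))
      (hF₁₃.iarr 12 (by decide)) (hF₁₃.iarr 13 (by decide)) (hF₁₃.rarr 3 (by decide))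
      (hF₁₃.ireg 7 (by decide)) (hF₁₃.ireg 8 (by decide)) (hF₁₃.ireg 9 (by decide))
  · rw [hF₁₃.ireg 7 (by decide), a2]
  · rw [l₃.n_eq, hF₁₃.iarr 7 (by decide)]
    exact a3
  rintro t₄ σ₄ ⟨⟨φ, d1, d2, d3, d4⟩, hF₄⟩
  have l₄ := l₃.frame hF₄ (by decide)
  have j₄ : σ₄.ireg 4 = j := (hF₄.ireg 4 (by decide)).trans j₃
  have p₄ : σ₄.rarr 1 = σ₂.rarr 1 := (hF₄.rarr 1 (by decide)).trans p₃
  have r₄ : σ₄.rarr 2 = σ₃.rarr 2 := hF₄.rarr 2 (by decide)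
  rw [l₃.n_eq] at d1 d2 d3 d4
  rw [j₃] at d1 d3
  have hred : redLen w σ₄ = redLen w σ₂ := by
    funext u v
    rw [redLen, redLen, p₄]
  have hmem : ∀ v : Fin n, (v : ℕ) ∈ ((Finset.range n).filter fun v => j ≤ σ₃.iarr 4 v) ↔
      j ≤ F.level v := by
    intro v
    simp [l₃.level]
  rw [wp_block_cons]
  refine (search_spec l₄ (L := L) j₄ (by rwa [hred]) (by rwa [r₄]) ?_ d2
    (fun v hv => Finset.mem_range.1 (Finset.mem_of_mem_filter v hv)) (fun v => (hmem v).1) ?_ hL).frame.mono ?_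
  · intro v hv
    rw [d3 v hv]
    simp [hv]
  · intro v hv
    rw [hF₄.iarr 3 (by decide), hF₁₃.iarr 3 (by decide)]
    exact a5 v hv
  rintro t₅ σ₅ ⟨⟨e1, e2, D, ord, par, -, e3, e4, e5, -⟩, hF₅⟩
  rw [hred] at e4 e5
  rw [r₄] at e3 e4
  have l₅ := l₄.frame hF₅ (by decide)
  have j₅ : σ₅.ireg 4 = j := (hF₅.ireg 4 (by decide)).trans j₄
  have p₅ : σ₅.rarr 1 = σ₂.rarr 1 := (hF₅.rarr 1 (by decide)).trans p₄
  rw [wp_block_cons]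
  refine addLabels_spec.frame.mono ?_
  rintro t₆ σ₆ ⟨⟨f1, f2⟩, hF₆⟩
  have l₆ := l₅.frame hF₆ (by decide)
  have j₆ : σ₆.ireg 4 = j := (hF₆.ireg 4 (by decide)).trans j₅
  rw [l₅.n_eq, j₅, p₅] at f1
  rw [l₅.n_eq] at f2
  have hF₇ := (Exec.iset σ₆ 4 (.pred (.reg 4))).frame
  rw [wp_block_cons, wp_iset, wp_block_nil]
  have horig : ∀ v ∈ D, (j ≤ F.level v ∧ σ₅.rarr 2 v = σ₃.rarr 2 v ∧ par v = none) ∨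
      ∃ u ∈ D, G.Adj u v ∧ j < F.level v ∧ par v = some u ∧
        σ₅.rarr 2 v = σ₅.rarr 2 u + redLen w σ₂ u v ∧ ord u < ord v ∧ 0 ≤ redLen w σ₂ u v := by
    intro v hv
    rcases e4 v hv with ⟨h1, h2⟩ | ⟨u, h1, h2, h3, h4, h5, h6⟩
    · exact Or.inl ⟨(hmem v).1 h1, h2⟩
    · refine Or.inr ⟨u, h1, h2, h3, h4, h5, h6, hφ₂ u v h2 ?_ h3⟩
      rcases e4 u h1 with ⟨h1, -⟩ | ⟨-, -, -, h, -⟩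
      exacts [(hmem u).1 h1, h.le]
  refine ⟨l₆.frame hF₇ (by decide), ?_, by simp [j₆], ?_, ?_⟩
  · refine e1.congr ?_ ?_ ?_ ?_
    · simpa using hF₆.iarr 9 (by decide)
    · simpa using hF₆.iarr 10 (by decide)
    · simpa using hF₆.iarr 11 (by decide)
    · simpa using hF₆.iarr 13 (by decide)
  · intro u v huv hu hv
    have hu' : j ≤ F.level u := by omega
    have hv' : j ≤ F.level v := by omega
    -- All vertices of level at least `j` are seeds, so all of them are finished.
    have huD := (e3 u ((hmem u).2 hu')).1
    have hvD := (e3 v ((hmem v).2 hv')).1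
    -- Edges into greater levels were relaxed by the search; an edge into level `j` comes from a
    -- greater level and needs the cycle argument of `label_le`.
    have key : σ₅.rarr 2 v ≤ σ₅.rarr 2 u + redLen w σ₂ u v := by
      by_cases hvj : j < F.level v
      · exact (e5 u huD v huv hvj).2
      · have := hF.level_ne hG huv
        exact hF.label_le (d := fun v => σ₅.rarr 2 v) (φ := fun v => σ₂.rarr 1 v)
          (init := fun v => σ₃.rarr 2 v) hw horig hinit hinit' huD hvD huv (by omega) (by omega)
    rw [redLen] at key ⊢
    simp only [iset_rarr]
    rw [f1 u u.2 (by rw [l₅.level]; exact hu'), f1 v v.2 (by rw [l₅.level]; exact hv')]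
    linarith
  · have hs : (400 * L + 1300) * (n + 1) = (400 * L + 600) * (n + 1) + 700 * n + 700 := by ring
    rw [hs]
    -- Naming the product makes the remaining arithmetic linear.
    obtain ⟨X, hX⟩ : ∃ X, X = (400 * L + 600) * (n + 1) := ⟨_, rfl⟩
    rw [← hX] at e2 ⊢
    simp only [IExpr.cost]
    omega

/-! ### Rank bound, total cost and conclusion -/

theorem two_pow_le_fib (r : ℕ) : 2 ^ (r / 2) ≤ Nat.fib (r + 1) := by
  induction r using Nat.twoStepInduction with
  | zero => simp
  | one => simp
  | more r h _ =>
    rw [show (r + 2) / 2 = r / 2 + 1 by omega, pow_succ, Nat.fib_add_two (n := r + 1)]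
    have := Nat.fib_mono (show r + 1 ≤ r + 1 + 1 by omega)
    omega

/-- Since `m ≤ n * n`, a bound logarithmic in the number of heap nodes `n + m` is logarithmic in
`n`. -/
theorem le_log_of_fib_le (hm : m ≤ n * n) {r : ℕ} (hr : Nat.fib (r + 1) ≤ n + m) :
    r ≤ 4 * Nat.log 2 n + 5 := by
  have h1 : n < 2 ^ (Nat.log 2 n + 1) := Nat.lt_pow_succ_log_self (by norm_num) n
  have h2 : 2 ^ (r / 2) < 2 ^ (2 * Nat.log 2 n + 3) := by
    calc 2 ^ (r / 2) ≤ n + m := (two_pow_le_fib r).trans hr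
      _ < 2 ^ (Nat.log 2 n + 1) * 2 ^ (Nat.log 2 n + 1) * 2 := by nlinarith
      _ = 2 ^ (2 * Nat.log 2 n + 3) := by ring
  have := (Nat.pow_lt_pow_iff_right (by norm_num : 1 < 2)).1 h2
  omega

theorem shortestPathTree_spec (s : Fin n) (e : Fin m ≃ {p : Fin n × Fin n // G.Adj p.1 p.2})
    (hG : ∀ v, ¬ G.Adj v v) (hw : ¬ HasNegativeCycle G w) (hF : F.IsEliminationForest G) {L : ℕ}
    (hL : ∀ r, Nat.fib (r + 1) ≤ n + m → r ≤ L) :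
    WP shortestPathTree (input w s F e) fun t τ =>
      (∃ par, Outputs τ par ∧ IsShortestPathTree G w s par) ∧
      t ≤ 30 * m + (20 * F.depth + 40) * n +
        (F.depth + 1) * (720 * m + (400 * L + 1300) * (n + 1) + 10) := by
  have hn : 0 < n := s.pos
  rw [shortestPathTree, wp_block_cons]
  refine (buildAdjacency_spec (σ := input w s F e) (by simp [input])).frame.mono ?_
  rintro t₁ σ₁ ⟨⟨a1, a2⟩, hF₁⟩
  have m₀ : (input w s F e).ireg 1 = m := rfl
  have n₁ : σ₁.ireg 0 = n := hF₁.ireg 0 (by decide)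
  rw [m₀] at a1 a2
  rw [wp_block_cons]
  refine (computeLevels_spec (n := n) (F := F) n₁ ?_ ?_).frame.mono ?_
  · intro v
    rw [hF₁.iarr 2 (by decide)]
    simp [input]
  · rw [hF₁.ireg 3 (by decide)]
    rfl
  rintro t₂ σ₂ ⟨⟨b1, b2, b3, b4⟩, hF₂⟩
  have hF₁₂ := (hF₁.mono (List.subset_append_left _ computeLevels.writes)).trans
    (hF₂.mono (List.subset_append_right buildAdjacency.writes _))
  have x0 : σ₂.iarr 0 = (input w s F e).iarr 0 := hF₁₂.iarr 0 (by decide)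
  have x1 : σ₂.iarr 1 = (input w s F e).iarr 1 := hF₁₂.iarr 1 (by decide)
  have y0 : σ₂.rarr 0 = (input w s F e).rarr 0 := hF₁₂.rarr 0 (by decide)
  have l₂ : Loaded m G w F σ₂ := by
    have hE : ∀ i : Fin m, EdgeAt w σ₂ i (e i).1.1 (e i).1.2 := by
      intro i
      constructor
      · rw [x0]; simp [input]
      · rw [x1]; simp [input]
      · rw [y0]; simp [input]
    constructor
    · exact (hF₂.ireg 0 (by decide)).trans n₁
    · exact hF₁₂.ireg 1 (by decide)
    · exact fun i hi => ⟨_, _, (e ⟨i, hi⟩).2, hE ⟨i, hi⟩⟩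
    · intro u v huv
      refine ⟨e.symm ⟨(u, v), huv⟩, Fin.is_lt _, ?_⟩
      simpa using hE (e.symm ⟨(u, v), huv⟩)
    · exact b1
    · rw [hF₂.iarr 5 (by decide), hF₂.iarr 6 (by decide), x0]
      exact a1
  have c₂ : Clean σ₂ := by
    constructor
    · rw [hF₁₂.iarr 9 (by decide)]; simp [input]
    · rw [hF₁₂.iarr 10 (by decide)]; simp [input]
    · rw [hF₁₂.iarr 11 (by decide)]; simp [input]
    · rw [hF₁₂.iarr 13 (by decide)]; simp [input]
  have s₂ : σ₂.ireg 2 = s := hF₁₂.ireg 2 (by decide)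
  have hF₃ := (Exec.iset σ₂ 4 (.reg 3)).frame
  rw [wp_block_cons, wp_iset, wp_block_cons]
  obtain ⟨B, hB⟩ : ∃ B, B = 720 * m + (400 * L + 1300) * (n + 1) := ⟨_, rfl⟩
  refine (wp_loop (φ₀ := (B + 3) * σ₂.ireg 3) (fun τ φ => Loaded m G w F τ ∧ Clean τ ∧
    Feasible G w F (τ.ireg 4) τ ∧ φ = (B + 3) * τ.ireg 4) ?_ ?_).mono ?_
  -- No level exceeds register 3, so feasibility beyond it is vacuous.
  · refine ⟨l₂.frame hF₃ (by decide), c₂.congr rfl rfl rfl rfl, ?_, by simp⟩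
    intro u v _ hu
    have := b2 u
    simp at hu
    omega
  · rintro σ φ ⟨h1, h2, h3, rfl⟩ - hb
    simp at hb
    refine (levelStep_spec hG hw hF h1 h2 rfl hb h3 (by omega) hL).mono ?_
    rintro t τ ⟨g1, g2, g3, g4, g5⟩
    refine ⟨_, ⟨g1, g2, by rwa [g3], rfl⟩, ?_⟩
    obtain ⟨k, hk⟩ : ∃ k, σ.ireg 4 = k + 1 := ⟨σ.ireg 4 - 1, by omega⟩
    rw [g3, hk, Nat.add_sub_cancel, mul_add, mul_one]
    rw [← hB] at g5
    simp
    omega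
  rintro t₄ σ₄ ⟨φ, ⟨l₄, c₄, f₄, rfl⟩, j₄, hF₄, d1⟩
  simp at j₄
  rw [j₄] at f₄ d1
  have s₄ : σ₄.ireg 2 = s := by
    rw [hF₄.ireg 2 (by decide)]
    exact s₂
  -- Levels start at 1, so threshold 0 covers every edge, and the last search uses all of them.
  have hφ : ∀ u v, G.Adj u v → 0 ≤ redLen w σ₄ u v := fun u v huv =>
    f₄ u v huv (F.level_pos u) (F.level_pos v)
  rw [wp_block_cons]
  refine (resetLabels_spec c₄ (M := n + m) (by omega)).frame.mono ?_
  rintro t₅ σ₅ ⟨⟨g1, g2, g3, g4, g5, g6⟩, hF₅⟩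
  have l₅ := l₄.frame hF₅ (by decide)
  rw [l₄.n_eq] at g3 g4 g5 g6
  have s₅ : σ₅.ireg 2 = s := (hF₅.ireg 2 (by decide)).trans s₄
  have j₅ : σ₅.ireg 4 = 0 := (hF₅.ireg 4 (by decide)).trans j₄
  have p₅ : σ₅.rarr 1 = σ₄.rarr 1 := hF₅.rarr 1 (by decide)
  obtain ⟨σ₆, h₆⟩ : ∃ σ₆, σ₆ = σ₅.iset 17 s := ⟨_, rfl⟩
  have hF₆ : Frame (Cmd.iset 17 (.reg 2)).writes σ₅ σ₆ := by
    rw [h₆, ← s₅]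
    exact (Exec.iset σ₅ 17 (.reg 2)).frame
  rw [wp_block_cons, wp_iset, IExpr.eval, s₅, ← h₆, wp_block_cons]
  refine (decreaseKey_spec (v := s) (φ := 0) (M := n + m) (H := ∅) (kf := σ₅.rarr 2) ?_ ?_
    ?_).frame.mono ?_
  · rw [h₆]
    exact g1.congr rfl rfl rfl rfl rfl rfl rfl rfl (by simp) (by simp) (by simp)
  · simp [h₆]
  · rw [h₆]
    exact Or.inr ⟨by simp, g3 s s.2⟩
  rintro t₇ σ₇ ⟨⟨φ, k1, k2, k3, k4⟩, hF₇⟩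
  have hF₅₇ := (hF₆.mono (List.subset_append_left _ decreaseKey.writes)).trans
    (hF₇.mono (List.subset_append_right (Cmd.iset 17 (.reg 2)).writes _))
  have l₇ := l₅.frame hF₅₇ (by decide)
  have j₇ : σ₇.ireg 4 = 0 := (hF₅₇.ireg 4 (by decide)).trans j₅
  have p₇ : σ₇.rarr 1 = σ₄.rarr 1 := (hF₅₇.rarr 1 (by decide)).trans p₅
  have r₇ : σ₇.rarr 2 = σ₅.rarr 2 := hF₅₇.rarr 2 (by decide)
  have hred : redLen w σ₇ = redLen w σ₄ := by
    funext u v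
    rw [redLen, redLen, p₇]
  have r₆ : σ₆.rarr 2 = σ₅.rarr 2 := hF₆.rarr 2 (by decide)
  rw [r₆, Function.update_eq_self] at k2
  have n₆ : σ₆.ireg 7 = 0 := (hF₆.ireg 7 (by decide)).trans g2
  have a₆ : σ₆.iarr 7 = σ₅.iarr 7 := hF₆.iarr 7 (by decide)
  rw [n₆] at k3 k4
  rw [a₆] at k4
  rw [wp_block_cons]
  refine (search_spec l₇ (L := L) j₇ (fun u v huv _ _ => by rw [hred]; exact hφ u v huv)
    (by rw [r₇]; exact k2) ?_ (by omega) (by simp) (by simp) ?_ hL).mono ?_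
  · intro v hv
    rw [k4, Function.update_apply]
    by_cases hvs : v = s
    · simp [hvs]
    · simp [hvs, g3 v hv]
  · intro v hv
    rw [hF₅₇.iarr 3 (by decide)]
    exact g5 v hv
  rintro t₈ σ₈ ⟨-, q1, D, ord, par, q2, q3, q4, q5, q6⟩
  rw [hred] at q4 q5
  have hs := q3 s (by simp)
  rw [r₇, g4 s s.2] at hs
  rw [wp_block_nil]
  refine ⟨⟨par, q2, isShortestPathTree_of_search (ord := ord)
    (d := fun v : Fin n => σ₈.rarr 2 v)
    (φ := fun v : Fin n => σ₄.rarr 1 v) hs.1 hs.2 hφ ?_ ?_ q6⟩, ?_⟩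
  · exact fun u hu v huv => q5 u hu v huv (F.level_pos v)
  · intro v hv
    rcases q4 v hv with ⟨h1, h2, h3⟩ | ⟨u, h1, h2, -, h4, h5, h6⟩
    · obtain rfl : v = s := by simpa [Fin.ext_iff] using h1
      refine Or.inl ⟨rfl, ?_, h3⟩
      rw [h2, r₇, g4 v v.2]
    · exact Or.inr ⟨u, h1, h2, h4, h5, h6⟩
  -- The last search fits into one more level budget `B`, which explains the factor `F.depth + 1`.
  · have hBt : t₈ + 700 * n + 700 ≤ φ + B := by
      rw [hB, show (400 * L + 1300) * (n + 1) = (400 * L + 600) * (n + 1) + 700 * n + 700 by ring]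
      omega
    have hBK : (B + 3) * σ₂.ireg 3 ≤ (B + 10) * F.depth := by gcongr; omega
    rw [← hB, add_mul F.depth, one_mul, mul_comm F.depth]
    simp only [IExpr.cost, BExpr.cost] at d1 ⊢
    omega

/-- For `n ≥ 2` the logarithm is bounded away from 0 and absorbs the additive constants; `k ≥ 1`
turns `k + 1` into `2 * k`. -/
theorem running_time_le {k m n t : ℕ} (hn : 2 ≤ n) (hk : 1 ≤ k)
    (ht : t ≤ 30 * m + (20 * k + 40) * n +
      (k + 1) * (720 * m + (400 * (4 * Nat.log 2 n + 5) + 1300) * (n + 1) + 10)) :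
    (t : ℝ) ≤ 100000 * (k * (m + n * Real.log n)) := by
  have hlog : (Nat.log 2 n : ℝ) ≤ 3 / 2 * Real.log n := by
    refine (Real.natLog_le_logb n 2).trans ?_
    have := Real.log_two_gt_d9
    have h0 : 0 ≤ Real.log n := Real.log_natCast_nonneg n
    rw [Real.logb, Nat.cast_ofNat, div_le_iff₀ (by linarith)]
    nlinarith
  have h1 : 1 ≤ 3 / 2 * Real.log n := by
    refine le_trans ?_ hlog
    exact_mod_cast Nat.log_pos (by norm_num) hn
  have ht' : (t : ℝ) ≤ 30 * m + (20 * k + 40) * n +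
      (k + 1) * (720 * m + (400 * (4 * Nat.log 2 n + 5) + 1300) * (n + 1) + 10) := by
    exact_mod_cast ht
  have hn' : (2 : ℝ) ≤ n := by exact_mod_cast hn
  have hk' : (1 : ℝ) ≤ k := by exact_mod_cast hk
  have hm' : (0 : ℝ) ≤ m := m.cast_nonneg
  set l := Real.log n
  have h2 : (400 * (4 * Nat.log 2 n + 5) + 1300) * ((n : ℝ) + 1) + 10 ≤
      11200 * (n * l) := by
    -- The left side is `1600 x + 3300` with `x = Nat.log 2 n`; both `x` and 1 are at most `3 / 2 *
    -- l`.
    have : (400 * (4 * (Nat.log 2 n : ℝ) + 5) + 1300) ≤ 4900 * (3 / 2 * l) := by linarith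
    calc _ ≤ 4900 * (3 / 2 * l) * ((n : ℝ) + 1) + 10 := by gcongr
      _ ≤ _ := by nlinarith
  have h3 : (n : ℝ) ≤ 3 / 2 * (n * l) := by nlinarith
  have hX : (0 : ℝ) ≤ n * l := by linarith
  generalize (n : ℝ) * l = X at *
  have h4 : 30 * (m : ℝ) + (20 * k + 40) * n ≤ k * (30 * m + 90 * X) := by nlinarith
  calc (t : ℝ) ≤ k * (30 * m + 90 * X) + (k + 1) * (720 * m + 11200 * X) := by
        refine ht'.trans (add_le_add h4 ?_)
        refine mul_le_mul_of_nonneg_left ?_ (by linarith)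
        linarith
    _ ≤ k * (30 * m + 90 * X) + (2 * k) * (720 * m + 11200 * X) := by
        gcongr
        linarith
    _ ≤ 100000 * (k * (m + X)) := by nlinarith [mul_nonneg (by linarith : (0 : ℝ) ≤ k) hX, mul_nonneg (by linarith : (0 : ℝ) ≤ k) hm']

end TreeDepth

/-- One program, and one constant, work for all inputs. The weight function is total for
convenience; only its values on edges of `G` matter. `m` is the number of edges. -/
theorem mainTheorem5 :
    ∃ (prog : RAM.Cmd) (C : ℝ),
      ∀ (n m : ℕ) (G : Digraph (Fin n)) (w : Fin n → Fin n → ℝ) (s : Fin n)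
        (F : TreeDepth.RootedForest (Fin n))
        (e : Fin m ≃ {p : Fin n × Fin n // G.Adj p.1 p.2}),
        (∀ v, ¬ G.Adj v v) →
        ¬ TreeDepth.HasNegativeCycle G w →
        F.IsEliminationForest G →
        ∃ (t : ℕ) (τ : RAM.State) (par : Fin n → Option (Fin n)),
          RAM.Exec prog (TreeDepth.input w s F e) t τ ∧
          TreeDepth.Outputs τ par ∧
          TreeDepth.IsShortestPathTree G w s par ∧
          (2 ≤ n → (t : ℝ) ≤ C * (F.depth * (m + n * Real.log n))) := by
  refine ⟨shortestPathTree, 100000, fun n m G w s F e hG hw hF => ?_⟩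
  have hm : m ≤ n * n := by
    simpa using Fintype.card_le_of_injective (fun i => (e i).1)
      (Subtype.val_injective.comp e.injective)
  obtain ⟨t, τ, hex, ⟨par, h1, h2⟩, h3⟩ := TreeDepth.shortestPathTree_spec s e hG hw hF
    fun r => TreeDepth.le_log_of_fib_le hm
  exact ⟨t, τ, par, hex, h1, h2, fun hn =>
    TreeDepth.running_time_le hn ((F.level_pos s).trans_le (F.level_le_depth s)) h3⟩
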